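/- **Setting.** Let $\mathcal S$ be a finite set, the vertex set of a connected graph ($r\sim s$ for adjacent distinct $r,s$), and $E:\mathcal S\to\mathbb R$ injective. For each $\beta>0$ let $(p(r,s))=(p_\beta(r,s))$ be a transition matrix on $\mathcal S$, reversible with respect to a probability distribution $\pi_\beta$, with $p(s,s)>0$ and, for $r\ne s$, $p(r,s)>0$ iff $r\sim s$. Assume there are $\gamma_\beta>0$ with $\gamma_\beta\to0$, $\beta\gamma_\beta\to\infty$ as $\beta\to\infty$ and $$e^{-\beta((E(s)-E(r))^++\gamma_\beta/|\mathcal S|)}\le p(r,s)\le e^{-\beta((E(s)-E(r))^+-\gamma_\beta/|\mathcal S|)}\qquad (r\ne s,\ p(r,s)>0),$$ and that the limits $p^*(r,s)=\lim_{\beta\to\infty}p(r,s)$ exist, are positive if $E(r)\ge E(s)$ and $r=s$ or $r\sim s$, and are $0$ if $E(r)<E(s)$. Let $X$ be the Markov chain with transition matrix $(p(r,s))$, with law $\mathbb P_x$ when started at $x$. **Valleys.** Let $H(r,s)$ be the minimum, over self-avoiding paths from $r$ to $s$, of the maximal energy along the path, endpoints included ($H(r,r)=E(r)$); a path attaining it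 is minimal. Enumerate the local minima of $E$ (states with $E(s)<E(r)$ for all $r\sim s$) as $m^{(1)},\dots,m^{(\mathfrak n)}$, in any order, and let $M^{(i)}=\{m^{(i)},\dots,m^{(\mathfrak n)}\}$. For $m\in M^{(i)}$ let $V^{(i)}_<(m)=\{s: H(s,m)<H(s,m')\ \forall m'\in M^{(i)}\setminus\{m\}\}$. Say $s\leadsto m$ at level $i$ if $H(s,m)=\min_{m'\in M^{(i)}}H(s,m')$ and every minimal path from $s$ to an $m'\in M^{(i)}\setminus\{m\}$ with $H(s,m')=H(s,m)$ hits $V^{(i)}_<(m)$. Let $l(i)$ be the least $j$ with $i<j\le\mathfrak n$ and $m^{(i)}\leadsto m$ at level $j$ for some $m\in M^{(j)}$ ($\infty$ if none). Put $V^{(1)}(m)=\{s:s\leadsto m\text{ at level }1\}$ and, for $2\le i\le\mathfrak n$, $m\in M^{(i)}$, $$V^{(i)}(m)=V^{(i-1)}(m)\cup\{s\in N^{(i-1)}:s\leadsto m\text{ at level }i\}\cup\bigcup_{j:\,l(j)=i,\ m^{(j)}\leadsto m\text{ at level }i}V^{(j)}(m^{(j)}),$$ where $N^{(i)}$ is the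 complement of $\bigcup_{j=1}^{\mathfrak n}V^{(i\wedge j)}(m^{(j)})$. Let $\mathcal S^{(i)}=\{m^{(j)}:l(j)>i\}\cup N^{(i)}$; for $s\in\mathcal S^{(i)}$ write $V(s)=V^{(i\wedge j)}(m^{(j)})$ if $s=m^{(j)}$ and $V(s)=\{s\}$ if $s\in N^{(i)}$. **Aggregated chains.** Let $\overline Y_n$ be the $s\in\mathcal S^{(i)}$ with $X_n\in V(s)$, $\sigma_0=0$, $\sigma_{n+1}=\inf\{k>\sigma_n:\overline Y_k\ne\overline Y_{k-1}\}$ and $Y_n=\overline Y_{\sigma_n}$. **Limit process.** For $r\in\mathcal S^{(i)}\setminus N^{(i)}$ let $s_r$ be the state of least energy among the states outside $V(r)$ adjacent to $V(r)$, and $\widehat p(r,\cdot)=\delta_{s_r}$ (if $V(r)=\mathcal S$, no move takes place and the holding time is $\infty$). For $r\in N^{(i)}$ and $s\in\mathcal S^{(i)}$ let $$\widehat p(r,s)=\frac1{1-p^*(r,r)}\sum_{r'\in V(s),\ r'\sim r}p^*(r,r').$$ For $x,y,z\in\mathcal S^{(i)}$ and $t\ge1$ let $$Q((x,y,z),\{t\})=\begin{cases}p(y,y)^{t-1}(1-p(y,y)),&y\in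 N^{(i)},\\[2pt] \sum_{s\in V(y),\,s\sim x}\mathbb P_s(\sigma_1=t\mid Y_1=z)\,\mathbb P_x(X_{\sigma_1}=s\mid Y_1=y,Y_2=z),&y\notin N^{(i)}.\end{cases}$$ Let $\widehat Y$ be a Markov chain on $\mathcal S^{(i)}$ with transition probabilities $\widehat p$, started at $y_0$, and $0=\widehat\sigma_0<\widehat\sigma_1<\cdots$ random times whose increments are conditionally independent given $\widehat Y$, $\widehat\sigma_{n+1}-\widehat\sigma_n$ having conditional law $Q((\widehat Y_{n-1},\widehat Y_n,\widehat Y_{n+1}),\cdot)$ for $n\ge1$; for $n=0$ the law is geometric on $\{1,2,\dots\}$ with parameter $1-p(y_0,y_0)$ if $y_0\in N^{(i)}$, and $\mathbb P_{y_0}(\sigma_1\in\cdot\mid Y_1=\widehat Y_1)$ otherwise. Let $\widehat\nu(n)=\sup\{k\ge0:\widehat\sigma_k\le n\}$. **Proposition.** For each $1\le i\le\mathfrak n$: (1) $((Y_n,Y_{n+1}),\sigma_{n+1})_{n\ge0}$ converges to the Markov renewal process $((\widehat Y_n,\widehat Y_{n+1}),\widehat\sigma_{n+1})_{n\ge0}$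 in the sense that $$\lim_{\beta\to\infty}\frac{\mathbb P_{y_0}\big((Y_k,Y_{k+1})=(y_k,y_{k+1}),\ \sigma_{k+1}=i_{k+1},\ 0\le k\le n\big)}{\mathbb P_{y_0}\big((\widehat Y_k,\widehat Y_{k+1})=(y_k,y_{k+1}),\ \widehat\sigma_{k+1}=i_{k+1},\ 0\le k\le n\big)}=1$$ for all $n\ge0$, $y_0,\dots,y_{n+1}\in\mathcal S^{(i)}$ and integers $0<i_1<\dots<i_{n+1}$ such that the denominator is positive (for all large $\beta$). (2) $(\overline Y_n,\overline Y_{n+1})_{n\ge0}$ is asymptotically semi-Markovian in the sense that $$\lim_{\beta\to\infty}\frac{\mathbb P_{y_0}\big((\overline Y_k,\overline Y_{k+1})=(y_k,y_{k+1}),\ 0\le k\le n\big)}{\mathbb P_{y_0}\big((\widehat Y_{\widehat\nu(k)},\widehat Y_{\widehat\nu(k+1)})=(y_k,y_{k+1}),\ 0\le k\le n\big)}=1$$ for all $n\ge0$ and $y_0,\dots,y_{n+1}\in\mathcal S^{(i)}$ such that the denominator is positive (for all large $\beta$). -/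

import Mathlib

open Filter Topology MeasureTheory ProbabilityTheory

namespace Metabasin

noncomputable section

/-- A finite connected graph of states with a non-degenerate energy function and an enumeration
`m⁽¹⁾, …, m⁽ⁿ⁾` of the local minima of the energy. Level `i` metastable states are the minima
`m⁽ⁱ⁾, …, m⁽ⁿ⁾`, so the enumeration is the order in which the minima are discarded. -/
structure Landscape (S : Type*) where
  graph : SimpleGraph S
  connected : graph.Connected
  energy : S → ℝ
  energy_injective : Function.Injective energy
  /-- the number of local minima -/
  numMin : ℕ
  /-- the enumeration of the local minima, relevant for the indices `1, …, numMin` only -/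
  label : ℕ → S
  label_bijOn : Set.BijOn label (Set.Icc 1 numMin)
    {s | ∀ r, graph.Adj s r → energy s < energy r}

namespace Landscape

variable {S : Type*} (L : Landscape S)

/-- Maximal energy along a path (both endpoints included). -/
def height {r s : S} (w : L.graph.Walk r s) : ℝ := sSup (L.energy '' {t | t ∈ w.support})

/-- The energy `E(z*(r,s))` of the essential saddle between `r` and `s`: the minimum over all
self-avoiding paths from `r` to `s` of the maximal energy along the path.
For `r = s` it is `E(r)`, that is, `z*(r,r) = r`. -/
def saddleEnergy (r s : S) : ℝ := ⨅ w : L.graph.Path r s, L.height w.1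

/-- `w` is a minimal path: self-avoiding and with least possible maximal energy. -/
def IsMinimalPath {r s : S} (w : L.graph.Walk r s) : Prop :=
  w.IsPath ∧ L.height w = L.saddleEnergy r s

/-- The set `M⁽ⁱ⁾ = {m⁽ⁱ⁾, …, m⁽ⁿ⁾}` of metastable states at level `i ≥ 1`. -/
def metastable (i : ℕ) : Set S := L.label '' Set.Icc i L.numMin

/-- The set `V_<⁽ⁱ⁾(m)` of states strongly attracted by `m`. -/
def innerValley (i : ℕ) (m : S) : Set S :=
  {s | ∀ m' ∈ L.metastable i, m' ≠ m → L.saddleEnergy s m < L.saddleEnergy s m'}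

/-- The state `s` is attracted by `m` at level `i`. -/
def Attracted (i : ℕ) (s m : S) : Prop :=
  m ∈ L.metastable i ∧
  (∀ m' ∈ L.metastable i, L.saddleEnergy s m ≤ L.saddleEnergy s m') ∧
  ∀ m' ∈ L.metastable i, m' ≠ m → L.saddleEnergy s m' = L.saddleEnergy s m →
    ∀ w : L.graph.Walk s m', L.IsMinimalPath w → ∃ t ∈ w.support, t ∈ L.innerValley i m

/-- The level `l(i)` at which the minimum `m⁽ⁱ⁾` becomes attracted by a minimum of superior level
(`⊤` if there is no such level). -/
def mergeLevel (i : ℕ) : ℕ∞ :=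
  ⨅ (j : ℕ) (_ : i < j ∧ j ≤ L.numMin ∧ ∃ m, L.Attracted j (L.label i) m), (j : ℕ∞)

/-- The valley `V⁽ⁱ⁾(m)` of order `i` around the minimum `m ∈ M⁽ⁱ⁾`, by recursion on `i`, with
`V⁽⁰⁾(m) = ∅`. The valley of order `i + 1` consists of the valley of order `i`, of the states which
are non-assigned at level `i` and attracted by `m` at level `i + 1`, and of the valleys
`V⁽ʲ⁾(m⁽ʲ⁾)` with `l(j) = i + 1` and `m⁽ʲ⁾` attracted by `m` at level `i + 1`.
As `V⁽⁰⁾` is empty, every state is non-assigned at level `0`, and `V⁽¹⁾(m)` is the set of the states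
attracted by `m` at level `1`. (The bound `j < i + 1` follows from `l(j) = i + 1`; it is there for
the recursion.) -/
def valley : ℕ → S → Set S
  | 0, _ => ∅
  | i + 1, m =>
      {s | s ∈ valley i m ∨
        ((∀ j ∈ Set.Icc 1 L.numMin, s ∉ valley (min i j) (L.label j)) ∧ L.Attracted (i + 1) s m) ∨
        ∃ j, ∃ _ : j < i + 1, 1 ≤ j ∧ j ≤ L.numMin ∧ L.mergeLevel j = ((i + 1 : ℕ) : ℕ∞) ∧
          L.Attracted (i + 1) (L.label j) m ∧ s ∈ valley j (L.label j)}
  termination_by i => i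
  decreasing_by all_goals omega

/-- The set `N⁽ⁱ⁾` of non-assigned states at level `i`. -/
def nonAssigned (i : ℕ) : Set S :=
  {s | ∀ j ∈ Set.Icc 1 L.numMin, s ∉ L.valley (min i j) (L.label j)}

/-- The minima `m⁽ʲ⁾` with `l(j) > i`, that is, the metastates at level `i` that are assigned. -/
def activeMinima (i : ℕ) : Set S :=
  {s | ∃ j ∈ Set.Icc 1 L.numMin, (i : ℕ∞) < L.mergeLevel j ∧ s = L.label j}

/-- The set `S⁽ⁱ⁾` of level `i` metastates. -/
def metastates (i : ℕ) : Set S := L.activeMinima i ∪ L.nonAssigned i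

/-- The set `V⁽ⁱ⁾(s)` for a level `i` metastate `s`: it is `V⁽ⁱ⁾(m⁽ʲ⁾)` if `s = m⁽ʲ⁾` with `j ≥ i`,
`V⁽ʲ⁾(m⁽ʲ⁾)` if `s = m⁽ʲ⁾` with `j < i`, and `{s}` if `s` is non-assigned. -/
def block (i : ℕ) (s : S) : Set S :=
  {x | (∃ j ∈ Set.Icc 1 L.numMin, s = L.label j ∧ x ∈ L.valley (min i j) (L.label j)) ∨
    (s ∈ L.nonAssigned i ∧ x = s)}

/-- The outer part `∂⁺V`: the states outside of `V` with a neighbor in `V`. -/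
def outerBoundary (V : Set S) : Set S := {s | s ∉ V ∧ ∃ r ∈ V, L.graph.Adj r s}

/-- `s` is the state `s_r` of minimal energy on the outer boundary of `V⁽ⁱ⁾(r)`. -/
def IsExitState (i : ℕ) (r s : S) : Prop :=
  s ∈ L.outerBoundary (L.block i r) ∧
    ∀ u ∈ L.outerBoundary (L.block i r), L.energy s ≤ L.energy u

open Classical in
/-- The level `i` metastate `s` with `x ∈ V⁽ⁱ⁾(s)`. -/
def aggregate (i : ℕ) (x : S) : S :=
  if h : ∃ s ∈ L.metastates i, x ∈ L.block i s then h.choose else x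

/-- The aggregated chain (AC) at level `i` along a trajectory `x`. -/
def ac (i : ℕ) (x : ℕ → S) (k : ℕ) : S := L.aggregate i (x k)

/-- The jump times `σ₀ = 0`, `σₙ₊₁ = inf {k > σₙ | AC_k ≠ AC_{k-1}}` of the AC. -/
def jumpTime (i : ℕ) (x : ℕ → S) : ℕ → ℕ∞
  | 0 => 0
  | n + 1 => ⨅ (k : ℕ) (_ : jumpTime i x n < k ∧ L.ac i x k ≠ L.ac i x (k - 1)), (k : ℕ∞)

/-- The accelerated aggregated chain (AAC) `Yₙ = AC_{σₙ}`, meaningful if `σₙ < ∞`. -/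
def aac (i : ℕ) (x : ℕ → S) (n : ℕ) : S := L.ac i x (L.jumpTime i x n).toNat

/-- The event `Y₁ = z` (which includes `σ₁ < ∞`). -/
def firstJumpTo (i : ℕ) (z : S) : Set (ℕ → S) :=
  {x | L.jumpTime i x 1 < ⊤ ∧ L.aac i x 1 = z}

/-- The event `Y₁ = y, Y₂ = z` (which includes `σ₁ < σ₂ < ∞`). -/
def firstJumpsTo (i : ℕ) (y z : S) : Set (ℕ → S) :=
  {x | L.jumpTime i x 2 < ⊤ ∧ L.aac i x 1 = y ∧ L.aac i x 2 = z}

end Landscape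

/-- A family, indexed by `β > 0`, of reversible Markov transition matrices `p β` on a finite energy
landscape with exponentially small transition probabilities. -/
structure LowTempChain (S : Type*) [Fintype S] extends Landscape S where
  /-- transition probabilities -/
  p : ℝ → S → S → ℝ
  /-- stationary distribution -/
  pi : ℝ → S → ℝ
  gamma : ℝ → ℝ
  /-- limiting transition probabilities `p*` -/
  pLim : S → S → ℝ
  p_nonneg : ∀ β > 0, ∀ r s, 0 ≤ p β r s
  p_sum : ∀ β > 0, ∀ r, ∑ s, p β r s = 1
  p_diag : ∀ β > 0, ∀ s, 0 < p β s s
  p_pos_iff : ∀ β > 0, ∀ r s, r ≠ s → (0 < p β r s ↔ graph.Adj r s)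
  gamma_pos : ∀ β > 0, 0 < gamma β
  gamma_tendsto : Tendsto gamma atTop (𝓝 0)
  mul_gamma_tendsto : Tendsto (fun β => β * gamma β) atTop atTop
  le_p : ∀ β > 0, ∀ r s, r ≠ s → 0 < p β r s →
    Real.exp (-β * (max (energy s - energy r) 0 + gamma β / Fintype.card S)) ≤ p β r s
  p_le : ∀ β > 0, ∀ r s, r ≠ s → 0 < p β r s →
    p β r s ≤ Real.exp (-β * (max (energy s - energy r) 0 - gamma β / Fintype.card S))
  p_tendsto : ∀ r s, Tendsto (fun β => p β r s) atTop (𝓝 (pLim r s))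
  pLim_pos : ∀ r s, r = s ∨ graph.Adj r s → energy s ≤ energy r → 0 < pLim r s
  pLim_zero : ∀ r s, energy r < energy s → pLim r s = 0
  pi_nonneg : ∀ β > 0, ∀ s, 0 ≤ pi β s
  pi_sum : ∀ β > 0, ∑ s, pi β s = 1
  detailed_balance : ∀ β > 0, ∀ r s, pi β r * p β r s = pi β s * p β s r

/-- Under `μ`, the process `X` is a Markov chain with transition matrix `p` started at `x`. -/
structure IsMarkovChain {S Ω : Type*} [MeasurableSpace Ω] (μ : Measure Ω) (X : ℕ → Ω → S)
    (p : S → S → ℝ) (x : S) : Prop where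
  isProbabilityMeasure : IsProbabilityMeasure μ
  measurableSet : ∀ k s, MeasurableSet {ω | X k ω = s}
  start : ∀ᵐ ω ∂μ, X 0 ω = x
  path : ∀ (n : ℕ) (w : ℕ → S), w 0 = x →
    μ.real {ω | ∀ k ≤ n, X k ω = w k} = ∏ k ∈ Finset.range n, p (w k) (w (k + 1))

namespace LowTempChain

variable {S : Type*} [Fintype S] (C : LowTempChain S)

open Classical in
/-- Transition probabilities `p̂(r,s)` of the asymptotic jump chain at level `i`: from an assigned
metastate `r` it moves to `s_r` (there is no move at all if `V⁽ⁱ⁾(r)` is the whole state space),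
and from a non-assigned `r` to a metastate `s` with probability
`∑ p*(r,r') / (1 - p*(r,r))`, the sum being over the neighbors `r' ≠ r` of `r` in `V⁽ⁱ⁾(s)`
(where `V⁽ⁱ⁾(s) = {s}` if `s` is non-assigned). -/
def jumpProb (i : ℕ) (r s : S) : ℝ :=
  if r ∈ C.nonAssigned i then
    if s ∈ C.metastates i then
      (∑ r' : S, if C.graph.Adj r r' ∧ r' ∈ C.block i s then C.pLim r r' else 0) /
        (1 - C.pLim r r)
    else 0
  else if C.IsExitState i r s then 1 else 0

/-- The geometric distribution on `{1, 2, …}` with success probability `q`. -/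
def geom (q : ℝ) (t : ℕ) : ℝ := if t = 0 then 0 else (1 - q) ^ (t - 1) * q

section Holding

variable {Ω : Type*} [MeasurableSpace Ω]

/-- `P_s(σ₁ = t | Y₁ = z)`, where `P s` is the law of the chain started at `s`. -/
def exitLaw (P : S → Measure Ω) (X : ℕ → Ω → S) (i : ℕ) (s z : S) (t : ℕ) : ℝ :=
  (P s)[|{ω | (fun k => X k ω) ∈ C.firstJumpTo i z}].real
    {ω | C.jumpTime i (fun k => X k ω) 1 = t}

/-- `P_x(X_{σ₁} = s | Y₁ = y, Y₂ = z)`. -/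
def entranceLaw (P : S → Measure Ω) (X : ℕ → Ω → S) (i : ℕ) (x y z s : S) : ℝ :=
  (P x)[|{ω | (fun k => X k ω) ∈ C.firstJumpsTo i y z}].real
    {ω | X (C.jumpTime i (fun k => X k ω) 1).toNat ω = s}

open Classical in
/-- The holding time law `Q((x,y,z),·)` in the metastate `y` between the metastates `x` and `z`, at
inverse temperature `β`. It is geometric if `y` is non-assigned, and otherwise it is the
mixture, over the states `s ∈ V⁽ⁱ⁾(y)` neighboring to `x`, of the laws `P_s(σ₁ ∈ · | Y₁ = z)` with
weights `P_x(X_{σ₁} = s | Y₁ = y, Y₂ = z)`. -/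
def holdingLaw (β : ℝ) (P : S → Measure Ω) (X : ℕ → Ω → S) (i : ℕ) (x y z : S) (t : ℕ) : ℝ :=
  if y ∈ C.nonAssigned i then geom (1 - C.p β y y) t
  else ∑ s : S, if s ∈ C.block i y ∧ C.graph.Adj x s then
    C.exitLaw P X i s z t * C.entranceLaw P X i x y z s else 0

open Classical in
/-- The law of the first holding time, when the chain starts at the metastate `y` and goes to `z`
next: there is no previous metastate and the entrance state is `y` itself. -/
def initialHoldingLaw (β : ℝ) (P : S → Measure Ω) (X : ℕ → Ω → S) (i : ℕ) (y z : S) (t : ℕ) : ℝ :=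
  if y ∈ C.nonAssigned i then geom (1 - C.p β y y) t else C.exitLaw P X i y z t

/-- The law of the `k`-th holding time `σ̂_{k+1} - σ̂_k` given that the asymptotic jump chain follows
the sequence `y`. -/
def holdingLawAt (β : ℝ) (P : S → Measure Ω) (X : ℕ → Ω → S) (i : ℕ) (y : ℕ → S) :
    ℕ → ℕ → ℝ
  | 0, t => C.initialHoldingLaw β P X i (y 0) (y 1) t
  | k + 1, t => C.holdingLaw β P X i (y k) (y (k + 1)) (y (k + 2)) t

/-- Under `μ`, the process `Yh` is the asymptotic jump chain at level `i` started at `y₀`, and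
`0 = σh 0 < σh 1 < …` are random times whose increments `σh (k+1) - σh k` are conditionally
independent given `Yh`, with conditional law `Q((Yh (k-1), Yh k, Yh (k+1)), ·)` (for `k = 0`: with
the law of the first holding time). If `V⁽ⁱ⁾(y₀)` is the whole state space, then this says
`σh 1 = ∞` almost surely. -/
structure IsMarkovRenewalLimit (β : ℝ) (P : S → Measure Ω) (X : ℕ → Ω → S) (i : ℕ) (y₀ : S)
    {Ω' : Type*} [MeasurableSpace Ω'] (μ : Measure Ω') (Yh : ℕ → Ω' → S) (σh : ℕ → Ω' → ℕ∞) :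
    Prop where
  isProbabilityMeasure : IsProbabilityMeasure μ
  measurableSet_chain : ∀ k s, MeasurableSet {ω | Yh k ω = s}
  measurableSet_time : ∀ k t, MeasurableSet {ω | σh k ω = t}
  start : ∀ᵐ ω ∂μ, Yh 0 ω = y₀ ∧ σh 0 ω = 0
  increasing : ∀ᵐ ω ∂μ, ∀ k, σh k ω < σh (k + 1) ω ∨ σh (k + 1) ω = ⊤
  law : ∀ (n : ℕ) (y : ℕ → S) (t : ℕ → ℕ), y 0 = y₀ → t 0 = 0 → (∀ k < n, t k < t (k + 1)) →
    μ.real {ω | ∀ k ≤ n, Yh k ω = y k ∧ σh k ω = t k} =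
      ∏ k ∈ Finset.range n,
        C.jumpProb i (y k) (y (k + 1)) * C.holdingLawAt β P X i y k (t (k + 1) - t k)

end Holding

end LowTempChain

/-- The counting process `ν(n) = sup {k | σ_k ≤ n}` of a sequence of times. -/
def counting (σ : ℕ → ℕ∞) (n : ℕ) : ℕ := sSup {k | σ k ≤ n}

end

end Metabasin

namespace Metabasin

noncomputable section

set_option linter.unusedSectionVars false

namespace Landscape

/-! ### Saddle energies, attraction and the geometry of valleys -/

section Saddle

variable {S : Type*} [Finite S] (L : Landscape S)

/-! The proof combines a geometric fact about valleys, an estimate for reversible chains and an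
exact computation.

Geometry. Saddle energies are symmetric and ultrametric. From this, by induction on the level, every
edge from `x` in a valley to `s` outside lies above some walk inside the valley from `x` to its
minimum (`Guarded`, `attracted_subset_valley_and_guarded`). So a valley is left only uphill, two
valleys are never adjacent, and for every boundary edge with outer end `s` other than the exit state
`u`, one can walk inside the valley to a neighbor of `u`, staying below `E(s)`, with `E(u) < E(s)`
(`exists_walk_exitState`). Blocks of metastates partition the state space, and the block of a
non-assigned state is a singleton.

Estimate. For the chain killed outside a valley with Green function `G`, the quantity `G(x,x)/π(x)`
is an effective resistance: by reversibility it grows along an edge by at most the resistance of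
that edge. Up to a common factor and `e^{βε}`, an edge `a, b` has resistance `e^{β max(E(a),E(b))}`.
Adding resistances along the walk above gives order `e^{β(E(s)-δ)}`, which the conductance of the
edge from `x` to `s` more than compensates. Hence exits to any `s ≠ u` have vanishing expected
number, uniformly in the starting state (`exit_at_exitState`, `tendsto_hit`).

Computation. A history of jumps is a cylinder event whose probability is an entry sum of a matrix
product, and this factorizes at non-assigned states. The holding laws of the limit process are
conditional laws of the same chain, so the weights of individual holding times, which in a valley
tend to zero, cancel exactly in the ratio. What remains are hitting probabilities of valleys and
exit states, divided by `p̂`, and these quotients tend to one (`tendsto_chainWeight_div`).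

For the second claim, a prescribed sequence of labels is cut into maximal constant runs
(`exists_runs`): a history of jumps followed by a stay. The probabilities of the stay agree exactly
in a non-assigned state, and both tend to one in a valley, which is not left within boundedly many
steps. -/

lemma height_le_iff {r s : S} (w : L.graph.Walk r s) (h : ℝ) :
    L.height w ≤ h ↔ ∀ t ∈ w.support, L.energy t ≤ h := by
  unfold height
  rw [csSup_le_iff]
  · simp
  · exact (Set.toFinite _).bddAbove
  · exact ⟨_, r, w.start_mem_support, rfl⟩

lemma height_mem_range {r s : S} (w : L.graph.Walk r s) : L.height w ∈ Set.range L.energy := by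
  have h : L.height w ∈ L.energy '' {t | t ∈ w.support} :=
    Set.Nonempty.csSup_mem ⟨_, r, w.start_mem_support, rfl⟩ (Set.toFinite _)
  obtain ⟨t, -, ht⟩ := h
  exact ⟨t, ht⟩

lemma finite_range_height (r s : S) :
    (Set.range fun w : L.graph.Path r s => L.height w.1).Finite :=
  (Set.finite_range L.energy).subset (by rintro _ ⟨w, rfl⟩; exact L.height_mem_range _)

/-- The infimum runs over self-avoiding paths only, but any walk serves as an upper bound, since
bypassing its loops only removes vertices. -/
lemma saddleEnergy_le {r s : S} (w : L.graph.Walk r s) {h : ℝ}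
    (hw : ∀ t ∈ w.support, L.energy t ≤ h) : L.saddleEnergy r s ≤ h := by
  classical
  refine (ciInf_le (L.finite_range_height r s).bddBelow ⟨w.bypass, w.bypass_isPath⟩).trans ?_
  rw [height_le_iff]
  exact fun t ht => hw t (w.support_bypass_subset_support ht)

lemma exists_walk_saddleEnergy (r s : S) :
    ∃ w : L.graph.Walk r s, ∀ t ∈ w.support, L.energy t ≤ L.saddleEnergy r s := by
  classical
  obtain ⟨w⟩ := L.connected.preconnected r s
  have hne : (Set.range fun w : L.graph.Path r s => L.height w.1).Nonempty :=
    ⟨_, ⟨w.bypass, w.bypass_isPath⟩, rfl⟩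
  obtain ⟨v, hv⟩ := hne.csInf_mem (L.finite_range_height r s)
  exact ⟨v.1, (L.height_le_iff _ _).1 (le_of_eq hv)⟩

lemma energy_le_saddleEnergy_left (r s : S) : L.energy r ≤ L.saddleEnergy r s := by
  obtain ⟨w, hw⟩ := L.exists_walk_saddleEnergy r s
  exact hw _ w.start_mem_support

lemma saddleEnergy_self (r : S) : L.saddleEnergy r r = L.energy r :=
  le_antisymm (L.saddleEnergy_le SimpleGraph.Walk.nil (by simp))
    (L.energy_le_saddleEnergy_left r r)

lemma saddleEnergy_symm_le (r s : S) : L.saddleEnergy s r ≤ L.saddleEnergy r s := by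
  obtain ⟨w, hw⟩ := L.exists_walk_saddleEnergy r s
  exact L.saddleEnergy_le w.reverse (by simpa using hw)

lemma saddleEnergy_comm (r s : S) : L.saddleEnergy r s = L.saddleEnergy s r :=
  le_antisymm (L.saddleEnergy_symm_le s r) (L.saddleEnergy_symm_le r s)

/-- Optimal walks are concatenated. This ultrametric inequality is the main tool for comparing
saddles. -/
lemma saddleEnergy_trans (r s t : S) :
    L.saddleEnergy r t ≤ max (L.saddleEnergy r s) (L.saddleEnergy s t) := by
  obtain ⟨w, hw⟩ := L.exists_walk_saddleEnergy r s
  obtain ⟨v, hv⟩ := L.exists_walk_saddleEnergy s t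
  refine L.saddleEnergy_le (w.append v) fun u hu => ?_
  rcases (SimpleGraph.Walk.mem_support_append_iff _ _).1 hu with hu | hu
  · exact (hw u hu).trans (le_max_left _ _)
  · exact (hv u hu).trans (le_max_right _ _)

lemma saddleEnergy_le_of_mem_support {r s t : S} (w : L.graph.Walk r s) {h : ℝ}
    (hw : ∀ t ∈ w.support, L.energy t ≤ h) (ht : t ∈ w.support) :
    L.saddleEnergy r t ≤ h ∧ L.saddleEnergy t s ≤ h := by
  classical
  exact ⟨L.saddleEnergy_le (w.takeUntil t ht)
      fun u hu => hw u (w.support_takeUntil_subset_support ht hu),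
    L.saddleEnergy_le (w.dropUntil t ht)
      fun u hu => hw u (w.support_dropUntil_subset_support ht hu)⟩

lemma saddleEnergy_le_of_adj {x s : S} (hxs : L.graph.Adj x s) (m : S) :
    L.saddleEnergy x m ≤ max (L.energy x) (L.saddleEnergy s m) := by
  obtain ⟨w, hw⟩ := L.exists_walk_saddleEnergy s m
  refine L.saddleEnergy_le (w.cons hxs) fun t ht => ?_
  rw [SimpleGraph.Walk.support_cons, List.mem_cons] at ht
  rcases ht with rfl | ht
  · exact le_max_left _ _
  · exact (hw t ht).trans (le_max_right _ _)

variable {L}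

/-- Frees the definition of attraction from minimal paths: since `m` is a nearest minimum, the
bypass of any walk below the saddle to `m` is itself a minimal path. -/
lemma Attracted.exists_mem_innerValley {i : ℕ} {s m m' : S} (h : L.Attracted i s m)
    (hm' : m' ∈ L.metastable i) (hne : m' ≠ m)
    (w : L.graph.Walk s m') (hw : ∀ t ∈ w.support, L.energy t ≤ L.saddleEnergy s m) :
    ∃ t ∈ w.support, t ∈ L.innerValley i m := by
  classical
  have he : L.saddleEnergy s m' = L.saddleEnergy s m :=
    le_antisymm (L.saddleEnergy_le w hw) (h.2.1 m' hm')
  obtain ⟨t, ht, ht'⟩ := h.2.2 m' hm' hne he w.bypass ⟨w.bypass_isPath, le_antisymm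
    ((L.height_le_iff _ _).2 fun t ht => he ▸ hw t (w.support_bypass_subset_support ht))
    (L.saddleEnergy_le w.bypass ((L.height_le_iff _ _).1 le_rfl))⟩
  exact ⟨t, w.support_bypass_subset_support ht, ht'⟩

lemma attracted_of_walks {i : ℕ} {s m : S} (hm : m ∈ L.metastable i)
    (hmin : ∀ m' ∈ L.metastable i, L.saddleEnergy s m ≤ L.saddleEnergy s m')
    (h : ∀ m' ∈ L.metastable i, m' ≠ m → L.saddleEnergy s m' = L.saddleEnergy s m →
      ∀ w : L.graph.Walk s m', (∀ t ∈ w.support, L.energy t ≤ L.saddleEnergy s m') →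
        ∃ t ∈ w.support, t ∈ L.innerValley i m) : L.Attracted i s m :=
  ⟨hm, hmin, fun m' hm' hne he w hw =>
    h m' hm' hne he w ((L.height_le_iff _ _).1 hw.2.le)⟩

/-- States attracted by `m` are only left through edges climbing above the saddle to `m`. -/
lemma Attracted.of_adj {i : ℕ} {x s m : S} (h : L.Attracted i x m) (hxs : L.graph.Adj x s)
    (hs : L.energy s ≤ L.saddleEnergy x m) : L.Attracted i s m := by
  have hx : L.energy x ≤ L.saddleEnergy x m := L.energy_le_saddleEnergy_left x m
  have hsm : L.saddleEnergy s m ≤ L.saddleEnergy x m :=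
    (L.saddleEnergy_le_of_adj hxs.symm m).trans (max_le hs le_rfl)
  -- A walk from `s` is prolonged by `x`. It cannot be `x` that lies in the inner valley of `m`,
  -- because the prolonged walk shows that `m'` is no farther from `x` than `m` is.
  have key : ∀ m' ∈ L.metastable i, m' ≠ m → ∀ w : L.graph.Walk s m',
      (∀ t ∈ w.support, L.energy t ≤ L.saddleEnergy x m) →
      ∃ t ∈ w.support, t ∈ L.innerValley i m := by
    intro m' hm' hne w hw
    have hw' : ∀ t ∈ (w.cons hxs).support, L.energy t ≤ L.saddleEnergy x m := by
      simpa using ⟨hx, hw⟩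
    obtain ⟨t, ht, ht'⟩ := h.exists_mem_innerValley hm' hne (w.cons hxs) hw'
    rw [SimpleGraph.Walk.support_cons, List.mem_cons] at ht
    rcases ht with rfl | ht
    · exact absurd (ht' m' hm' hne) (not_lt.2 (L.saddleEnergy_le _ hw'))
    · exact ⟨t, ht, ht'⟩
  refine attracted_of_walks h.1 (fun m' hm' => ?_) fun m' hm' hne he w hw =>
    key m' hm' hne w fun t ht => (hw t ht).trans (he.le.trans hsm)
  by_cases hne : m' = m
  · rw [hne]
  -- A strictly lower walk to `m'` would still meet the inner valley of `m`, at a point from which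
  -- `m` is closer than `m'`. Turning to `m` there contradicts the ultrametric inequality.
  by_contra! hlt
  obtain ⟨w, hw⟩ := L.exists_walk_saddleEnergy s m'
  obtain ⟨t, ht, ht'⟩ := key m' hm' hne w fun t ht => (hw t ht).trans (hlt.le.trans hsm)
  obtain ⟨h1, h2⟩ := L.saddleEnergy_le_of_mem_support w hw ht
  exact absurd (L.saddleEnergy_trans s t m)
    (not_le.2 ((max_le h1 ((ht' m' hm' hne).le.trans h2)).trans_lt hlt))

variable (L) in
/-- Every edge leaving `V` climbs above some walk inside `V` to `m`. -/
def Guarded (V : Set S) (m : S) : Prop :=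
  ∀ x ∈ V, ∀ s, s ∉ V → L.graph.Adj x s →
    ∃ w : L.graph.Walk x m, ∀ t ∈ w.support, t ∈ V ∧ L.energy t < L.energy s

/-- Where the walk first steps out of `V`, the rest is replaced by the guarding walk, which lies
below the state stepped on and hence below `h`. -/
lemma Guarded.exists_walk_le {V : Set S} {m : S} (hV : L.Guarded V m) {x y : S} (hx : x ∈ V)
    {h : ℝ} (w : L.graph.Walk x y) (hw : ∀ t ∈ w.support, L.energy t ≤ h) (hy : y = m) :
    ∃ v : L.graph.Walk x m, ∀ t ∈ v.support, t ∈ V ∧ L.energy t ≤ h := by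
  induction w with
  | nil =>
    subst hy
    exact ⟨SimpleGraph.Walk.nil, by simpa using ⟨hx, hw _ (by simp)⟩⟩
  | @cons a b c hab w ih =>
    simp only [SimpleGraph.Walk.support_cons, List.mem_cons, forall_eq_or_imp] at hw
    by_cases hb : b ∈ V
    · obtain ⟨v, hv⟩ := ih hb hw.2 hy
      exact ⟨v.cons hab, by simpa using ⟨⟨hx, hw.1⟩, hv⟩⟩
    · obtain ⟨v, hv⟩ := hV a hx b hb hab
      exact ⟨v, fun t ht => ⟨(hv t ht).1,
        (hv t ht).2.le.trans (hw.2 b w.start_mem_support)⟩⟩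

lemma Guarded.exists_walk {V : Set S} {m : S} (hV : L.Guarded V m) {x : S} (hx : x ∈ V) :
    ∃ v : L.graph.Walk x m, ∀ t ∈ v.support, t ∈ V ∧ L.energy t ≤ L.saddleEnergy x m := by
  obtain ⟨w, hw⟩ := L.exists_walk_saddleEnergy x m
  exact hV.exists_walk_le hx w hw rfl

/-- Follow an optimal walk to `m`. If its next state is not attracted, that state lies strictly
above the saddle between the present state and `m`; so this saddle is strictly lower than the
original one, and induction on the saddle energy continues from the present state. -/
lemma Attracted.exists_walk {i : ℕ} {x m : S} (h : L.Attracted i x m) :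
    ∃ v : L.graph.Walk x m, ∀ t ∈ v.support,
      L.Attracted i t m ∧ L.energy t ≤ L.saddleEnergy x m := by
  let R : S → S → Prop := fun a b => L.saddleEnergy a m < L.saddleEnergy b m
  have hwf : WellFounded R := by
    have : IsTrans S R := ⟨fun a b c => lt_trans⟩
    have : Std.Irrefl R := ⟨fun a => lt_irrefl _⟩
    exact Finite.wellFounded_of_trans_of_irrefl R
  induction x using hwf.induction with
  | _ x ih =>
    have key : ∀ (u y : S) (w : L.graph.Walk u y), y = m →
        (∀ t ∈ w.support, L.energy t ≤ L.saddleEnergy x m) → L.Attracted i u m →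
        ∃ v : L.graph.Walk u m, ∀ t ∈ v.support,
          L.Attracted i t m ∧ L.energy t ≤ L.saddleEnergy x m := by
      intro u y w hy hw hu
      induction w with
      | nil =>
        subst hy
        exact ⟨SimpleGraph.Walk.nil, by simpa using ⟨hu, hw _ (by simp)⟩⟩
      | @cons a b c hab w ih' =>
        simp only [SimpleGraph.Walk.support_cons, List.mem_cons, forall_eq_or_imp] at hw
        by_cases hb : L.Attracted i b m
        · obtain ⟨v, hv⟩ := ih' hy hw.2 hb
          exact ⟨v.cons hab, by simpa using ⟨⟨hu, hw.1⟩, hv⟩⟩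
        · have hlt : L.saddleEnergy a m < L.energy b := by
            by_contra! hle
            exact hb (hu.of_adj hab hle)
          have hlt' := hlt.trans_le (hw.2 b w.start_mem_support)
          obtain ⟨v, hv⟩ := ih a hlt' hu
          exact ⟨v, fun t ht => ⟨(hv t ht).1, (hv t ht).2.trans hlt'.le⟩⟩
    obtain ⟨w, hw⟩ := L.exists_walk_saddleEnergy x m
    exact key x m w rfl hw h

/-- An optimal walk to `m'` through states attracted by `m'` would have to meet the inner valley of
`m`, whose states are strictly closer to `m` than to `m'`. -/
lemma Attracted.unique {i : ℕ} {x m m' : S} (h : L.Attracted i x m) (h' : L.Attracted i x m') :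
    m' = m := by
  by_contra hne
  obtain ⟨w, hw⟩ := h'.exists_walk
  obtain ⟨t, ht, htm⟩ := h.exists_mem_innerValley h'.1 hne w
    fun t ht => (hw t ht).2.trans (h'.2.1 m h.1)
  exact absurd ((hw t ht).1.2.1 m h.1) (not_le.2 (htm m' h'.1 hne))

lemma metastable_anti {i j : ℕ} (hij : i ≤ j) : L.metastable j ⊆ L.metastable i :=
  Set.image_mono (Set.Icc_subset_Icc_left hij)

lemma label_mem_metastable {i j : ℕ} (hij : i ≤ j) (hj : j ≤ L.numMin) :
    L.label j ∈ L.metastable i := ⟨j, ⟨hij, hj⟩, rfl⟩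

lemma label_injective {j j' : ℕ} (hj : j ∈ Set.Icc 1 L.numMin) (hj' : j' ∈ Set.Icc 1 L.numMin)
    (h : L.label j = L.label j') : j = j' := L.label_bijOn.injOn hj hj' h

lemma energy_lt_of_mem_metastable {i : ℕ} (hi : 1 ≤ i) {m r : S} (hm : m ∈ L.metastable i)
    (h : L.graph.Adj m r) : L.energy m < L.energy r := by
  obtain ⟨j, ⟨hij, hj⟩, rfl⟩ := hm
  exact L.label_bijOn.mapsTo ⟨hi.trans hij, hj⟩ r h

lemma energy_lt_saddleEnergy {i : ℕ} (hi : 1 ≤ i) {m m' : S} (hm : m ∈ L.metastable i)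
    (hne : m' ≠ m) : L.energy m < L.saddleEnergy m m' := by
  obtain ⟨w, hw⟩ := L.exists_walk_saddleEnergy m m'
  cases w with
  | nil => exact absurd rfl hne
  | @cons _ b _ hab w =>
    exact (energy_lt_of_mem_metastable hi hm hab).trans_le (hw b (by simp))

lemma attracted_self {i : ℕ} (hi : 1 ≤ i) {m : S} (hm : m ∈ L.metastable i) :
    L.Attracted i m m := by
  refine ⟨hm, fun m' _ => ?_, fun m' _ hne he => ?_⟩
  · rw [saddleEnergy_self]; exact L.energy_le_saddleEnergy_left _ _
  · rw [saddleEnergy_self] at he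
    exact absurd he (energy_lt_saddleEnergy hi hm hne).ne'

lemma mem_valley_succ {i : ℕ} {s m : S} : s ∈ L.valley (i + 1) m ↔ s ∈ L.valley i m ∨
    (s ∈ L.nonAssigned i ∧ L.Attracted (i + 1) s m) ∨
    ∃ j < i + 1, 1 ≤ j ∧ j ≤ L.numMin ∧ L.mergeLevel j = ((i + 1 : ℕ) : ℕ∞) ∧
      L.Attracted (i + 1) (L.label j) m ∧ s ∈ L.valley j (L.label j) := by
  rw [valley]
  simp only [Set.mem_ofPred_eq, nonAssigned, exists_prop]

@[simp] lemma valley_zero (m : S) : L.valley 0 m = ∅ := by rw [valley]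

lemma valley_mono {i j : ℕ} (hij : i ≤ j) (m : S) : L.valley i m ⊆ L.valley j m := by
  induction hij with
  | refl => exact subset_rfl
  | step _ ih => exact fun s hs => mem_valley_succ.2 (Or.inl (ih hs))

/-- The minimality half of attraction survives the absorption of valleys: the absorbed minimum is
nearest to `s` within a larger set of minima, and the ultrametric inequality passes through it to
`m`. -/
lemma saddleEnergy_le_of_mem_valley {i : ℕ} {s m : S} (hs : s ∈ L.valley i m)
    (hm : m ∈ L.metastable i) : ∀ m' ∈ L.metastable i, L.saddleEnergy s m ≤ L.saddleEnergy s m' := by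
  induction i using Nat.strong_induction_on generalizing s m with
  | _ i ih =>
    cases i with
    | zero => simp at hs
    | succ i =>
      intro m' hm'
      rcases mem_valley_succ.1 hs with h | h | ⟨j, hj, h1, hjn, -, ha, h⟩
      · exact ih i (Nat.lt_succ_self i) h (metastable_anti (Nat.le_succ i) hm) m'
          (metastable_anti (Nat.le_succ i) hm')
      · exact h.2.2.1 m' hm'
      · have hsj := ih j hj h (label_mem_metastable le_rfl hjn) m'
          (metastable_anti hj.le hm')
        have h2 := ha.2.1 m' hm'
        have h3 := L.saddleEnergy_trans s (L.label j) m
        have h4 := L.saddleEnergy_trans (L.label j) s m'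
        rw [L.saddleEnergy_comm (L.label j) s] at h4
        exact h3.trans (max_le hsj (h2.trans (h4.trans (max_le hsj le_rfl))))

/-- Attraction of one state of a valley carries over to its minimum. Walks starting at the minimum
are prolonged backwards by a walk inside the valley from `s`. -/
lemma attracted_of_mem_valley {i k : ℕ} (hk : k ≤ i) {s m m' : S} (hm' : m' ∈ L.metastable k)
    (hV : L.Guarded (L.valley k m') m') (hs : s ∈ L.valley k m') (h : L.Attracted i s m) :
    L.Attracted i m' m := by
  have hmk := metastable_anti hk h.1
  obtain ⟨v, hv⟩ := hV.exists_walk hs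
  have hsm' : L.saddleEnergy s m' ≤ L.saddleEnergy s m :=
    saddleEnergy_le_of_mem_valley hs hm' m hmk
  have hm'm : L.saddleEnergy m' m ≤ L.saddleEnergy s m := by
    have := L.saddleEnergy_trans m' s m
    rw [L.saddleEnergy_comm m' s] at this
    exact this.trans (max_le hsm' le_rfl)
  have key : ∀ m'' ∈ L.metastable i, m'' ≠ m → ∀ w : L.graph.Walk m' m'', ∀ h' : ℝ,
      (∀ t ∈ w.support, L.energy t ≤ h') → h' ≤ L.saddleEnergy m' m →
      ∃ t ∈ w.support, t ∈ L.innerValley i m := by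
    intro m'' hm'' hne w h' hw hh
    obtain ⟨t, ht, ht'⟩ := h.exists_mem_innerValley hm'' hne (v.append w) (by
      intro t ht
      rcases (SimpleGraph.Walk.mem_support_append_iff _ _).1 ht with ht | ht
      · exact (hv t ht).2.trans hsm'
      · exact (hw t ht).trans (hh.trans hm'm))
    rcases (SimpleGraph.Walk.mem_support_append_iff _ _).1 ht with ht | ht
    -- The prepended part cannot meet the inner valley of `m`: its states belong to the valley of
    -- `m'`, so `m` is no closer to them than `m'`, and reaching `m''` through `m'` would then cost
    -- no more than reaching `m`.
    · exfalso
      have h1 := saddleEnergy_le_of_mem_valley (hv t ht).1 hm' m hmk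
      have h2 := ht' m'' hm'' hne
      have h3 := L.saddleEnergy_trans t m' m''
      have h4 := L.saddleEnergy_trans m' t m
      rw [L.saddleEnergy_comm m' t] at h4
      have h5 : L.saddleEnergy t m'' ≤ L.saddleEnergy m' m'' := by
        rcases le_max_iff.1 h3 with h | h
        · linarith
        · exact h
      have h6 := L.saddleEnergy_le w hw
      have h7 := h4.trans (max_le h1 le_rfl)
      linarith
    · exact ⟨t, ht, ht'⟩
  refine attracted_of_walks h.1 (fun m'' hm'' => ?_) fun m'' hm'' hne he w hw =>
    key m'' hm'' hne w _ hw he.le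
  by_cases hne : m'' = m
  · rw [hne]
  by_contra! hlt
  obtain ⟨w, hw⟩ := L.exists_walk_saddleEnergy m' m''
  obtain ⟨t, ht, ht'⟩ := key m'' hm'' hne w _ hw hlt.le
  obtain ⟨h1, h2⟩ := L.saddleEnergy_le_of_mem_support w hw ht
  exact absurd (L.saddleEnergy_trans m' t m)
    (not_le.2 ((max_le h1 ((ht' m'' hm'' hne).le.trans h2)).trans_lt hlt))

lemma mergeLevel_le {j k : ℕ} (hjk : j < k) (hk : k ≤ L.numMin) {m : S}
    (h : L.Attracted k (L.label j) m) : L.mergeLevel j ≤ k :=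
  iInf₂_le k ⟨hjk, hk, m, h⟩

lemma exists_attracted_of_mergeLevel_le {i j : ℕ} (h : L.mergeLevel j ≤ i) :
    ∃ k, j < k ∧ k ≤ i ∧ k ≤ L.numMin ∧ L.mergeLevel j = k ∧
      ∃ m, L.Attracted k (L.label j) m := by
  classical
  have hex : ∃ k, j < k ∧ k ≤ L.numMin ∧ ∃ m, L.Attracted k (L.label j) m := by
    by_contra! hno
    have : L.mergeLevel j = ⊤ := by
      simp only [mergeLevel, iInf_eq_top]
      rintro k ⟨h1, h2, m, h3⟩
      exact absurd h3 (hno k h1 h2 m)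
    rw [this] at h
    simp at h
  obtain ⟨h1, h2, m, h3⟩ := Nat.find_spec hex
  have he : L.mergeLevel j = (Nat.find hex : ℕ) := by
    refine le_antisymm (mergeLevel_le h1 h2 h3) (le_iInf₂ fun k hk => ?_)
    exact_mod_cast Nat.find_min' hex hk
  refine ⟨Nat.find hex, h1, ?_, h2, he, m, h3⟩
  rw [he] at h
  exact_mod_cast h

/-- Every assigned state lies in the valley of an active minimum. -/
lemma exists_active_of_not_mem_nonAssigned {i : ℕ} {x : S} (hx : x ∉ L.nonAssigned i) :
    ∃ j ∈ Set.Icc 1 L.numMin, (i : ℕ∞) < L.mergeLevel j ∧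
      x ∈ L.valley (min i j) (L.label j) := by
  classical
  let P : ℕ → Prop := fun j => j ∈ Set.Icc 1 L.numMin ∧ x ∈ L.valley (min i j) (L.label j)
  obtain ⟨j, hj⟩ : ∃ j, P j := by
    simpa only [nonAssigned, Set.mem_ofPred_eq, not_forall, not_not, exists_prop, P] using hx
  -- Take the largest index whose valley contains `x`. Had this minimum merged by level `i`, the
  -- absorbing minimum would have a larger index and a valley still containing `x`.
  have hm := Nat.findGreatest_spec hj.1.2 hj
  have hmax : ∀ k, P k → k ≤ Nat.findGreatest P L.numMin :=
    fun k hk => Nat.le_findGreatest hk.1.2 hk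
  set a := Nat.findGreatest P L.numMin
  refine ⟨a, hm.1, ?_, hm.2⟩
  by_contra! hle
  obtain ⟨k, hak, hki, hkn, hmk, m, hat⟩ := exists_attracted_of_mergeLevel_le hle
  obtain ⟨b, ⟨hkb, hbn⟩, rfl⟩ := hat.1
  have hx' : x ∈ L.valley k (L.label b) := by
    obtain ⟨k, rfl⟩ : ∃ k', k = k' + 1 := ⟨k - 1, by omega⟩
    refine mem_valley_succ.2 (Or.inr (Or.inr ⟨a, hak, hm.1.1, hm.1.2, hmk, hat, ?_⟩))
    have := hm.2
    rwa [min_eq_right (by omega)] at this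
  have := hmax b ⟨⟨by omega, hbn⟩, valley_mono (by omega) _ hx'⟩
  omega

/-- The two claims feed each other. That attracted states belong to the valley uses guarding at
lower levels. Conversely, guarding uses that a low neighbor of an attracted state is attracted,
hence inside, so that edges leaving the valley must climb. -/
lemma attracted_subset_valley_and_guarded (i : ℕ) : ∀ m ∈ L.metastable i,
    (1 ≤ i → ∀ s, L.Attracted i s m → s ∈ L.valley i m) ∧ L.Guarded (L.valley i m) m := by
  induction i using Nat.strong_induction_on with
  | _ i ih =>
    cases i with
    | zero =>
      intro m hm
      exact ⟨by omega, fun x hx => by simp at hx⟩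
    | succ i =>
      intro m hm
      have hD : ∀ s, L.Attracted (i + 1) s m → s ∈ L.valley (i + 1) m := by
        intro s hs
        by_cases hN : s ∈ L.nonAssigned i
        · exact mem_valley_succ.2 (Or.inr (Or.inl ⟨hN, hs⟩))
        obtain ⟨j, ⟨hj1, hjn⟩, hji, hsj⟩ := exists_active_of_not_mem_nonAssigned hN
        have hat : L.Attracted (i + 1) (L.label j) m :=
          attracted_of_mem_valley (k := min i j) (by omega)
            (label_mem_metastable (by omega) hjn)
            (ih (min i j) (by omega) _ (label_mem_metastable (by omega) hjn)).2 hsj hs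
        -- Either the minimum of the active valley containing `s` is still metastable, and then it
        -- equals `m` by uniqueness of attraction; or it has just merged, with merge level exactly
        -- `i + 1`, and its whole valley is absorbed.
        by_cases hij : i + 1 ≤ j
        · have hself := attracted_self (by omega : 1 ≤ i + 1) (label_mem_metastable hij hjn)
          rw [hat.unique hself, min_eq_left (by omega)] at hsj
          exact mem_valley_succ.2 (Or.inl hsj)
        · rw [min_eq_right (by omega)] at hsj
          obtain ⟨j', hj', rfl⟩ := hm
          refine mem_valley_succ.2 (Or.inr (Or.inr ⟨j, by omega, hj1, hjn, ?_, hat, hsj⟩))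
          refine le_antisymm
            (mergeLevel_le (k := i + 1) (by omega) (by have := hj'.1; have := hj'.2; omega) hat) ?_
          have := Order.add_one_le_of_lt hji
          exact_mod_cast this
      refine ⟨fun _ => hD, fun x hx s hs hxs => ?_⟩
      rcases mem_valley_succ.1 hx with h | h | ⟨j, hj, h1, hjn, hmj, ha, h⟩
      · have hs' : s ∉ L.valley i m := fun h' => hs (valley_mono (Nat.le_succ i) m h')
        obtain ⟨w, hw⟩ := (ih i (Nat.lt_succ_self i) m
          (metastable_anti (Nat.le_succ i) hm)).2 x h s hs' hxs
        exact ⟨w, fun t ht => ⟨valley_mono (Nat.le_succ i) m (hw t ht).1, (hw t ht).2⟩⟩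
      · obtain ⟨w, hw⟩ := h.2.exists_walk
        have hlt : L.saddleEnergy x m < L.energy s := by
          by_contra! hle
          exact hs (hD s (h.2.of_adj hxs hle))
        exact ⟨w, fun t ht => ⟨hD t (hw t ht).1, (hw t ht).2.trans_lt hlt⟩⟩
      · have hsub : L.valley j (L.label j) ⊆ L.valley (i + 1) m := fun t ht =>
          mem_valley_succ.2 (Or.inr (Or.inr ⟨j, hj, h1, hjn, hmj, ha, ht⟩))
        obtain ⟨w, hw⟩ := (ih j hj _ (label_mem_metastable le_rfl hjn)).2 x h s
          (fun h' => hs (hsub h')) hxs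
        obtain ⟨v, hv⟩ := ha.exists_walk
        have hlt : L.saddleEnergy (L.label j) m < L.energy s := by
          by_contra! hle
          -- Otherwise the guarding walk, read from the absorbed minimum to `x`, stays below the
          -- saddle to `m`. Attraction then propagates along it, with a saddle to `m` that does not
          -- drop, up to `x` and finally to `s`.
          have key : ∀ (u y : S) (q : L.graph.Walk u y), y = x → L.Attracted (i + 1) u m →
              L.saddleEnergy (L.label j) m ≤ L.saddleEnergy u m →
              (∀ t ∈ q.support, L.energy t < L.energy s) → False := by
            intro u y q hy
            induction q with
            | nil =>
              subst hy
              exact fun hu hle' _ => hs (hD s (hu.of_adj hxs (hle.trans hle')))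
            | @cons a b c hab q ihq =>
              intro hu hle' hq
              simp only [SimpleGraph.Walk.support_cons, List.mem_cons, forall_eq_or_imp] at hq
              have hb := hq.2 b q.start_mem_support
              have hb' := hu.of_adj hab ((hb.le.trans hle).trans hle')
              refine ihq hy hb' ?_ hq.2
              rcases le_max_iff.1 (L.saddleEnergy_le_of_adj hab m) with h' | h'
              · exact absurd (hq.1.trans_le hle) (not_lt.2 (hle'.trans h'))
              · exact hle'.trans h'
          exact key _ _ w.reverse rfl ha le_rfl (by simpa using fun t ht => (hw t ht).2)
        refine ⟨w.append v, fun t ht => ?_⟩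
        rcases (SimpleGraph.Walk.mem_support_append_iff _ _).1 ht with ht | ht
        · exact ⟨hsub (hw t ht).1, (hw t ht).2⟩
        · exact ⟨hD t (hv t ht).1, (hv t ht).2.trans_lt hlt⟩

lemma guarded_valley {i : ℕ} {m : S} (hm : m ∈ L.metastable i) : L.Guarded (L.valley i m) m :=
  (attracted_subset_valley_and_guarded i m hm).2

lemma label_mem_valley {i j : ℕ} (hi : 1 ≤ i) (hj : j ∈ Set.Icc 1 L.numMin) :
    L.label j ∈ L.valley (min i j) (L.label j) := by
  have h1 : 1 ≤ min i j := le_min hi hj.1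
  have hm : L.label j ∈ L.metastable (min i j) := label_mem_metastable (min_le_right i j) hj.2
  exact (attracted_subset_valley_and_guarded _ _ hm).1 h1 _ (attracted_self h1 hm)

lemma label_not_mem_nonAssigned {i j : ℕ} (hi : 1 ≤ i) (hj : j ∈ Set.Icc 1 L.numMin) :
    L.label j ∉ L.nonAssigned i := fun h => h j hj (label_mem_valley hi hj)

/-- The valley at level `i + 1` into which a valley of level `i` is absorbed. -/
lemma mem_valley_succ_cases {i j : ℕ} {x : S}
    (hx : x ∈ L.valley (min (i + 1) j) (L.label j)) :
    x ∈ L.valley (min i j) (L.label j) ∨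
    (i + 1 ≤ j ∧ x ∈ L.nonAssigned i ∧ L.Attracted (i + 1) x (L.label j)) ∨
    ∃ k ∈ Set.Icc 1 L.numMin, k < i + 1 ∧ i + 1 ≤ j ∧ (i : ℕ∞) < L.mergeLevel k ∧
      L.mergeLevel k ≤ ((i + 1 : ℕ) : ℕ∞) ∧
      L.Attracted (i + 1) (L.label k) (L.label j) ∧ x ∈ L.valley (min i k) (L.label k) := by
  by_cases hij : i + 1 ≤ j
  · rw [min_eq_left hij] at hx
    rcases mem_valley_succ.1 hx with h | h | ⟨k, hk, h1, hkn, hmk, ha, h⟩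
    · exact Or.inl (by rwa [min_eq_left (by omega)])
    · exact Or.inr (Or.inl ⟨hij, h⟩)
    · refine Or.inr (Or.inr ⟨k, ⟨h1, hkn⟩, hk, hij, ?_, hmk.le, ha, ?_⟩)
      · rw [hmk]; exact_mod_cast Nat.lt_succ_self i
      · rwa [min_eq_right (by omega)]
  · refine Or.inl ?_
    rw [min_eq_right (by omega)] at hx ⊢
    exact hx

/-- Induction on the level: at level `i + 1` the state was either already in a valley or
non-assigned at level `i`. Valleys absorbed from level `i` are identified by induction, and their
absorbing minima by uniqueness of attraction; an absorbed minimum is no longer active. -/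
lemma active_unique {i j j' : ℕ} (hj : j ∈ Set.Icc 1 L.numMin) (hj' : j' ∈ Set.Icc 1 L.numMin)
    (hl : (i : ℕ∞) < L.mergeLevel j) (hl' : (i : ℕ∞) < L.mergeLevel j') {x : S}
    (hx : x ∈ L.valley (min i j) (L.label j)) (hx' : x ∈ L.valley (min i j') (L.label j')) :
    j = j' := by
  induction i generalizing j j' with
  | zero => simp at hx
  | succ i ih =>
    have hlt : (i : ℕ∞) < ((i + 1 : ℕ) : ℕ∞) := by exact_mod_cast Nat.lt_succ_self i
    rcases mem_valley_succ_cases hx with h | ⟨hij, hN, ha⟩ | ⟨k, hk, hki, hij, hlk, hlk', ha, h⟩ <;>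
    rcases mem_valley_succ_cases hx' with
      h' | ⟨hij', hN', ha'⟩ | ⟨k', hk', hki', hij', hlkk, hlkk', ha', h'⟩
    · exact ih hj hj' (hlt.trans hl) (hlt.trans hl') h h'
    · exact absurd h (hN' j hj)
    · obtain rfl := ih hj hk' (hlt.trans hl) hlkk h h'
      exact absurd hl (not_lt.2 hlkk')
    · exact absurd h' (hN j' hj')
    · exact label_injective hj hj' (ha'.unique ha)
    · exact absurd h' (hN k' hk')
    · obtain rfl := ih hk hj' hlk (hlt.trans hl') h h'
      exact absurd hl' (not_lt.2 hlk')
    · exact absurd h (hN' k hk)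
    · obtain rfl := ih hk hk' hlk hlkk h h'
      exact label_injective hj hj' (ha'.unique ha)

lemma block_of_mem_nonAssigned {i : ℕ} (hi : 1 ≤ i) {r : S} (hr : r ∈ L.nonAssigned i) :
    L.block i r = {r} := by
  ext x
  constructor
  · rintro (⟨j, hj, rfl, -⟩ | ⟨-, rfl⟩)
    · exact absurd hr (label_not_mem_nonAssigned hi hj)
    · rfl
  · rintro rfl
    exact Or.inr ⟨hr, rfl⟩

lemma block_label {i j : ℕ} (hi : 1 ≤ i) (hj : j ∈ Set.Icc 1 L.numMin) :
    L.block i (L.label j) = L.valley (min i j) (L.label j) := by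
  ext x
  constructor
  · rintro (⟨k, hk, hjk, hx⟩ | ⟨h, -⟩)
    · obtain rfl := label_injective hj hk hjk
      exact hx
    · exact absurd h (label_not_mem_nonAssigned hi hj)
  · exact fun hx => Or.inl ⟨j, hj, rfl, hx⟩

lemma mem_block_self {i : ℕ} (hi : 1 ≤ i) {r : S} (hr : r ∈ L.metastates i) :
    r ∈ L.block i r := by
  rcases hr with ⟨j, hj, -, rfl⟩ | hr
  · rw [block_label hi hj]; exact label_mem_valley hi hj
  · exact Or.inr ⟨hr, rfl⟩

lemma exists_mem_block {i : ℕ} (hi : 1 ≤ i) (x : S) : ∃ s ∈ L.metastates i, x ∈ L.block i s := by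
  by_cases hx : x ∈ L.nonAssigned i
  · exact ⟨x, Or.inr hx, Or.inr ⟨hx, rfl⟩⟩
  · obtain ⟨j, hj, hl, hxj⟩ := exists_active_of_not_mem_nonAssigned hx
    exact ⟨L.label j, Or.inl ⟨j, hj, hl, rfl⟩, by rwa [block_label hi hj]⟩

/-- Together with `exists_mem_block` this makes the blocks of metastates a partition of the state
space. -/
lemma metastate_unique {i : ℕ} (hi : 1 ≤ i) {s s' x : S} (hs : s ∈ L.metastates i)
    (hs' : s' ∈ L.metastates i) (hx : x ∈ L.block i s) (hx' : x ∈ L.block i s') : s = s' := by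
  rcases hs with ⟨j, hj, hl, rfl⟩ | hs <;> rcases hs' with ⟨j', hj', hl', rfl⟩ | hs'
  · rw [block_label hi hj] at hx
    rw [block_label hi hj'] at hx'
    rw [active_unique hj hj' hl hl' hx hx']
  · rw [block_label hi hj] at hx
    rw [block_of_mem_nonAssigned hi hs'] at hx'
    obtain rfl : x = s' := hx'
    exact absurd hx (hs' j hj)
  · rw [block_of_mem_nonAssigned hi hs] at hx
    rw [block_label hi hj'] at hx'
    obtain rfl : x = s := hx
    exact absurd hx' (hs j' hj')
  · rw [block_of_mem_nonAssigned hi hs] at hx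
    rw [block_of_mem_nonAssigned hi hs'] at hx'
    exact (show x = s from hx).symm.trans hx'

lemma aggregate_spec {i : ℕ} (hi : 1 ≤ i) (x : S) :
    L.aggregate i x ∈ L.metastates i ∧ x ∈ L.block i (L.aggregate i x) := by
  unfold aggregate
  rw [dif_pos (exists_mem_block hi x)]
  exact (exists_mem_block hi x).choose_spec

lemma aggregate_eq_iff {i : ℕ} (hi : 1 ≤ i) {x r : S} (hr : r ∈ L.metastates i) :
    L.aggregate i x = r ↔ x ∈ L.block i r := by
  constructor
  · rintro rfl
    exact (aggregate_spec hi x).2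
  · exact fun h => metastate_unique hi (aggregate_spec hi x).1 hr (aggregate_spec hi x).2 h

lemma aggregate_self {i : ℕ} (hi : 1 ≤ i) {r : S} (hr : r ∈ L.metastates i) :
    L.aggregate i r = r := (aggregate_eq_iff hi hr).2 (mem_block_self hi hr)

lemma guarded_block {i : ℕ} (hi : 1 ≤ i) {r : S} (hr : r ∈ L.metastates i)
    (hN : r ∉ L.nonAssigned i) : L.Guarded (L.block i r) r := by
  rcases hr with ⟨j, hj, -, rfl⟩ | hr
  · rw [block_label hi hj]
    exact guarded_valley (label_mem_metastable (min_le_right i j) hj.2)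
  · exact absurd hr hN

lemma energy_lt_of_adj_block {i : ℕ} (hi : 1 ≤ i) {r : S} (hr : r ∈ L.metastates i)
    (hN : r ∉ L.nonAssigned i) {x s : S} (hx : x ∈ L.block i r) (hs : s ∉ L.block i r)
    (h : L.graph.Adj x s) : L.energy x < L.energy s := by
  obtain ⟨w, hw⟩ := guarded_block hi hr hN x hx s hs h
  exact (hw x w.start_mem_support).2

/-- The states adjacent to a valley are non-assigned. -/
lemma mem_nonAssigned_of_adj_block {i : ℕ} (hi : 1 ≤ i) {r : S} (hr : r ∈ L.metastates i)
    (hN : r ∉ L.nonAssigned i) {x s : S} (hx : x ∈ L.block i r) (hs : s ∉ L.block i r)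
    (h : L.graph.Adj x s) : s ∈ L.nonAssigned i := by
  have h1 := energy_lt_of_adj_block hi hr hN hx hs h
  obtain ⟨hm, hsm⟩ := aggregate_spec (L := L) hi s
  by_contra hsN
  have hmN : L.aggregate i s ∉ L.nonAssigned i := by
    intro hmN
    rw [block_of_mem_nonAssigned hi hmN] at hsm
    rw [← (show s = L.aggregate i s from hsm)] at hmN
    exact hsN hmN
  have hxs : x ∉ L.block i (L.aggregate i s) := by
    intro hx'
    exact hs ((metastate_unique hi hr hm hx hx') ▸ hsm)
  -- An edge between two valleys would have to climb in both directions.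
  exact lt_asymm h1 (energy_lt_of_adj_block hi hm hmN hsm hxs h.symm)

/-- Without a lower neighbor, `r` would be a local minimum and would lie in its own valley. The
downhill edge keeps `p*(r,r)` away from one. -/
lemma exists_adj_energy_lt {i : ℕ} (hi : 1 ≤ i) {r : S} (hr : r ∈ L.nonAssigned i) :
    ∃ s, L.graph.Adj r s ∧ L.energy s < L.energy r := by
  by_contra! hno
  obtain ⟨j, hj, rfl⟩ := L.label_bijOn.surjOn (show r ∈ {s | ∀ r, L.graph.Adj s r →
    L.energy s < L.energy r} from fun s hs =>
      lt_of_le_of_ne (hno s hs) fun he => hs.ne (L.energy_injective he))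
  exact label_not_mem_nonAssigned hi hj hr

/-- From a boundary edge of a valley other than the exit edge, the exit state can be reached
through the valley below the outer end of the edge. -/
lemma exists_walk_exitState {i : ℕ} (hi : 1 ≤ i) {r u x s : S} (hr : r ∈ L.metastates i)
    (hN : r ∉ L.nonAssigned i) (hu : L.IsExitState i r u) (hx : x ∈ L.block i r)
    (hs : s ∉ L.block i r) (h : L.graph.Adj x s) (hsu : s ≠ u) :
    ∃ y, L.graph.Adj y u ∧ ∃ w : L.graph.Walk x y, L.energy u < L.energy s ∧
      ∀ t ∈ w.support, t ∈ L.block i r ∧ L.energy t < L.energy s := by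
  obtain ⟨⟨huV, y, hy, hyu⟩, hmin⟩ := hu
  have hG := guarded_block hi hr hN
  have hlt : L.energy u < L.energy s :=
    lt_of_le_of_ne (hmin s ⟨hs, x, hx, h⟩) fun he => hsu (L.energy_injective he).symm
  obtain ⟨w, hw⟩ := hG x hx s hs h
  obtain ⟨v, hv⟩ := hG y hy u huV hyu
  -- The walk descends to the minimum along the guard of the edge from `x` to `s` and climbs back
  -- along the guard of the edge from `y` to `u`.
  refine ⟨y, hyu, w.append v.reverse, hlt, fun t ht => ?_⟩
  rcases (SimpleGraph.Walk.mem_support_append_iff _ _).1 ht with ht | ht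
  · exact hw t ht
  · have := hv t (by simpa using ht)
    exact ⟨this.1, this.2.trans hlt⟩

end Saddle

end Landscape

/-! ### Green function and effective resistance of a killed reversible chain -/

open Classical in
/-- The transition probabilities, restricted to steps from `V` to `W`. -/
def hop {S : Type*} (p : S → S → ℝ) (V W : Set S) : Matrix S S ℝ :=
  Matrix.of fun x y => if x ∈ V ∧ y ∈ W then p x y else 0

section Green

open Classical

variable {S : Type*} [Fintype S] {p : S → S → ℝ} {V W : Set S}

lemma hop_apply (x y : S) : hop p V W x y = if x ∈ V ∧ y ∈ W then p x y else 0 := rfl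

lemma hop_of_mem {x y : S} (hx : x ∈ V) (hy : y ∈ W) : hop p V W x y = p x y :=
  if_pos ⟨hx, hy⟩

lemma hop_eq_zero_left {x : S} (hx : x ∉ V) (y : S) : hop p V W x y = 0 :=
  if_neg fun h => hx h.1

lemma hop_eq_zero_right {y : S} (hy : y ∉ W) (x : S) : hop p V W x y = 0 :=
  if_neg fun h => hy h.2

lemma hop_nonneg (hp : ∀ x y, 0 ≤ p x y) (x y : S) : 0 ≤ hop p V W x y := by
  rw [hop_apply]; split_ifs
  exacts [hp x y, le_rfl]

lemma hop_le (hp : ∀ x y, 0 ≤ p x y) (x y : S) : hop p V W x y ≤ p x y := by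
  rw [hop_apply]; split_ifs
  exacts [le_rfl, hp x y]

lemma hop_pow_nonneg (hp : ∀ x y, 0 ≤ p x y) (n : ℕ) (x y : S) : 0 ≤ (hop p V V ^ n) x y := by
  induction n generalizing y with
  | zero => rw [pow_zero, Matrix.one_apply]; split_ifs <;> norm_num
  | succ n ih =>
    rw [pow_succ, Matrix.mul_apply]
    exact Finset.sum_nonneg fun z _ => mul_nonneg (ih z) (hop_nonneg hp z y)

lemma hop_pow_eq_zero {x y : S} (hx : x ∈ V) (hy : y ∉ V) (n : ℕ) : (hop p V V ^ n) x y = 0 := by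
  cases n with
  | zero => rw [pow_zero, Matrix.one_apply_ne]; rintro rfl; exact hy hx
  | succ n =>
    rw [pow_succ, Matrix.mul_apply]
    exact Finset.sum_eq_zero fun z _ => by rw [hop_eq_zero_right hy, mul_zero]

variable (p V) in
/-- Expected number of visits before time `N` of the chain killed outside of `V`. -/
def green (N : ℕ) : Matrix S S ℝ := ∑ n ∈ Finset.range N, hop p V V ^ n

lemma green_apply (N : ℕ) (x y : S) :
    green p V N x y = ∑ n ∈ Finset.range N, (hop p V V ^ n) x y := by
  rw [green, Matrix.sum_apply]

lemma green_succ (N : ℕ) (x y : S) : green p V (N + 1) x y =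
    (if x = y then 1 else 0) + ∑ z, hop p V V x z * green p V N z y := by
  rw [green, Finset.sum_range_succ', Matrix.add_apply, pow_zero, Matrix.one_apply, add_comm]
  congr 1
  rw [← Matrix.mul_apply, green, Finset.mul_sum]
  simp_rw [pow_succ']

lemma green_mono (hp : ∀ x y, 0 ≤ p x y) (N : ℕ) (x y : S) :
    green p V N x y ≤ green p V (N + 1) x y := by
  rw [green_apply, green_apply, Finset.sum_range_succ]
  exact le_add_of_nonneg_right (hop_pow_nonneg hp N x y)

lemma green_nonneg (hp : ∀ x y, 0 ≤ p x y) (N : ℕ) (x y : S) : 0 ≤ green p V N x y := by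
  rw [green_apply]
  exact Finset.sum_nonneg fun n _ => hop_pow_nonneg hp n x y

/-- Started elsewhere, the chain loses time before its first visit to `x`. In terms of the one-step
recursion, `green p V (N + 1) z x` is a sub-average of values at time `N`. -/
lemma green_le_diag (hp : ∀ x y, 0 ≤ p x y) (hs : ∀ x, ∑ y, p x y = 1) (N : ℕ) (z x : S) :
    green p V N z x ≤ green p V N x x := by
  induction N generalizing z with
  | zero => simp [green]
  | succ N ih =>
    by_cases hzx : z = x
    · rw [hzx]
    rw [green_succ, if_neg hzx, zero_add]
    calc ∑ u, hop p V V z u * green p V N u x ≤ ∑ u, p z u * green p V N x x :=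
          Finset.sum_le_sum fun u _ => mul_le_mul (hop_le hp z u) (ih u)
            (green_nonneg hp N u x) (hp z u)
      _ = green p V N x x := by rw [← Finset.sum_mul, hs, one_mul]
      _ ≤ _ := green_mono hp N x x

/-- Summed over all `y`, these differences describe the current leaving `x`, which is at most one by
the one-step recursion. All of them are nonnegative, so each single one is at most one. -/
lemma mul_green_sub_le_one (hp : ∀ x y, 0 ≤ p x y) (hs : ∀ x, ∑ y, p x y = 1) (N : ℕ)
    (x y : S) : p x y * green p V N x x - hop p V V x y * green p V N y x ≤ 1 := by
  have h1 := green_mono (V := V) hp N x x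
  rw [green_succ, if_pos rfl] at h1
  have h2 : ∑ z, (p x z * green p V N x x - hop p V V x z * green p V N z x) ≤ 1 := by
    rw [Finset.sum_sub_distrib, ← Finset.sum_mul, hs, one_mul]
    linarith
  refine le_trans ?_ h2
  exact Finset.single_le_sum
    (f := fun z => p x z * green p V N x x - hop p V V x z * green p V N z x)
    (fun z _ => sub_nonneg.2 (mul_le_mul (hop_le hp x z) (green_le_diag hp hs N z x)
      (green_nonneg hp N z x) (hp x z))) (Finset.mem_univ y)

lemma green_reversible {pi : S → ℝ} (hr : ∀ x y, pi x * p x y = pi y * p y x) (N : ℕ)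
    (x y : S) : pi x * green p V N x y = pi y * green p V N y x := by
  have h : ∀ n x y, pi x * (hop p V V ^ n) x y = pi y * (hop p V V ^ n) y x := by
    intro n
    induction n with
    | zero =>
      intro x y
      by_cases hxy : x = y
      · rw [hxy]
      · simp [Matrix.one_apply_ne hxy, Matrix.one_apply_ne (Ne.symm hxy)]
    | succ n ih =>
      intro x y
      rw [pow_succ, Matrix.mul_apply, ← pow_succ, pow_succ', Matrix.mul_apply, Finset.mul_sum,
        Finset.mul_sum]
      refine Finset.sum_congr rfl fun z _ => ?_
      rw [← mul_assoc, ih, mul_comm (hop p V V y z), ← mul_assoc,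
        mul_comm (pi z), mul_comm (pi y), mul_assoc, mul_assoc]
      congr 1
      rw [hop_apply, hop_apply]
      simp only [and_comm (a := y ∈ V)]
      split_ifs
      · exact hr z y
      · simp
  rw [green_apply, green_apply, Finset.mul_sum, Finset.mul_sum]
  exact Finset.sum_congr rfl fun n _ => h n x y

/-- The effective resistance `green x x / pi x` grows along an edge at most by the resistance of
the edge. -/
lemma conductance_mul_sub_le_one (hp : ∀ x y, 0 ≤ p x y) (hs : ∀ x, ∑ y, p x y = 1)
    {pi : S → ℝ} (hpi : ∀ x, 0 < pi x) (hr : ∀ x y, pi x * p x y = pi y * p y x) (N : ℕ)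
    {x y : S} :
    pi x * p x y * (green p V N x x / pi x - green p V N y y / pi y) ≤ 1 := by
  have h1 := mul_green_sub_le_one (V := V) hp hs N x y
  -- Reversibility exchanges source and target, so that the diagonal bound at `y` becomes available.
  have h2 : green p V N y x ≤ pi x * (green p V N y y / pi y) := by
    rw [mul_div_assoc', le_div_iff₀ (hpi y), mul_comm, ← green_reversible hr]
    exact mul_le_mul_of_nonneg_left (green_le_diag hp hs N x y) (hpi x).le
  have h3 : hop p V V x y * green p V N y x ≤ p x y * (pi x * (green p V N y y / pi y)) :=
    mul_le_mul (hop_le hp x y) h2 (green_nonneg hp N y x) (hp x y)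
  have h4 : pi x * p x y * (green p V N x x / pi x - green p V N y y / pi y) =
      p x y * green p V N x x - p x y * (pi x * (green p V N y y / pi y)) := by
    have := (hpi x).ne'
    field_simp
  linarith

/-- Outside of `V` the potential is zero, so the resistance from `x` is at most that of a single
edge to the outside. -/
lemma conductance_mul_le_one (hp : ∀ x y, 0 ≤ p x y) (hs : ∀ x, ∑ y, p x y = 1)
    {pi : S → ℝ} (hpi : ∀ x, 0 < pi x) (N : ℕ) {x u : S} (hu : u ∉ V) :
    pi x * p x u * (green p V N x x / pi x) ≤ 1 := by
  have h1 := mul_green_sub_le_one (V := V) hp hs N x u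
  rw [hop_eq_zero_right hu, zero_mul, sub_zero] at h1
  have := (hpi x).ne'
  calc _ = p x u * green p V N x x := by field_simp
    _ ≤ 1 := h1

lemma sum_hop_pow_succ (hs : ∀ x, ∑ y, p x y = 1) {x : S} (hx : x ∈ V) (n : ℕ) :
    ∑ u, (hop p V V ^ (n + 1)) x u + ∑ u, (hop p V V ^ n * hop p V Vᶜ) x u =
      ∑ u, (hop p V V ^ n) x u := by
  rw [← Finset.sum_add_distrib]
  simp_rw [pow_succ, Matrix.mul_apply, ← Finset.sum_add_distrib, ← mul_add]
  rw [Finset.sum_comm]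
  refine Finset.sum_congr rfl fun z _ => ?_
  rw [← Finset.mul_sum]
  by_cases hz : z ∈ V
  · have : ∑ u, (hop p V V z u + hop p V Vᶜ z u) = 1 := by
      rw [← hs z]
      refine Finset.sum_congr rfl fun u _ => ?_
      by_cases hu : u ∈ V <;> simp [hop_apply, hz, hu]
    rw [this, mul_one]
  · rw [hop_pow_eq_zero hx hz, zero_mul]

/-- Conservation of mass: by time `N` the chain has either left `V` or is still inside. -/
lemma exit_add_survival (hs : ∀ x, ∑ y, p x y = 1) {x : S} (hx : x ∈ V) (N : ℕ) :
    ∑ n ∈ Finset.range N, ∑ u, (hop p V V ^ n * hop p V Vᶜ) x u +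
      ∑ u, (hop p V V ^ N) x u = 1 := by
  induction N with
  | zero => simp [Matrix.one_apply]
  | succ N ih =>
    rw [Finset.sum_range_succ, ← ih, ← sum_hop_pow_succ hs hx N]
    ring

lemma sum_exit_eq (N : ℕ) (x u : S) :
    ∑ n ∈ Finset.range N, (hop p V V ^ n * hop p V W) x u =
      ∑ y, green p V N x y * hop p V W y u := by
  rw [← Matrix.mul_apply, green, Finset.sum_mul, Matrix.sum_apply]

end Green

/-! ### Low-temperature estimates and the exit from a valley -/

namespace LowTempChain

section Exit

open Classical

variable {S : Type*} [Fintype S] {C : LowTempChain S}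

lemma pi_pos {β : ℝ} (hβ : 0 < β) (s : S) : 0 < C.pi β s := by
  have hstep : ∀ a b, C.graph.Adj a b → 0 < C.pi β a → 0 < C.pi β b := by
    intro a b hab ha
    refine lt_of_le_of_ne (C.pi_nonneg β hβ b) fun h0 => ?_
    have h1 := C.detailed_balance β hβ a b
    rw [← h0, zero_mul] at h1
    exact (mul_pos ha ((C.p_pos_iff β hβ a b hab.ne).2 hab)).ne' h1
  obtain ⟨r, hr⟩ : ∃ r, 0 < C.pi β r := by
    by_contra! h
    have h0 : ∑ s, C.pi β s ≤ 0 := Finset.sum_nonpos fun s _ => h s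
    rw [C.pi_sum β hβ] at h0
    linarith
  obtain ⟨w⟩ := C.connected.preconnected r s
  induction w with
  | nil => exact hr
  | cons h _ ih => exact ih (hstep _ _ h hr)

lemma gamma_div_le {ε : ℝ} (hε : 0 < ε) : ∀ᶠ β in atTop, C.gamma β / Fintype.card S ≤ ε := by
  have h : Tendsto (fun β => C.gamma β / Fintype.card S) atTop (𝓝 0) := by
    simpa using C.gamma_tendsto.div_const (Fintype.card S : ℝ)
  exact (h.eventually (gt_mem_nhds hε)).mono fun β => le_of_lt

/-- The stationary law is a Gibbs law up to subexponential factors. Along an edge, detailed balance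
turns the difference of the two positive parts into the energy difference, at a cost of `2γ/|S|` in
the exponent. This takes half of `ε` and leaves the other half to the remaining walk. -/
lemma pi_mul_exp_le (a b : S) {ε : ℝ} (hε : 0 < ε) : ∀ᶠ β in atTop,
    C.pi β a * Real.exp (β * C.energy a) ≤
      Real.exp (β * ε) * (C.pi β b * Real.exp (β * C.energy b)) := by
  obtain ⟨w⟩ := C.connected.preconnected a b
  induction w generalizing ε with
  | nil =>
    filter_upwards [eventually_gt_atTop 0] with β hβ
    exact le_mul_of_one_le_left (mul_nonneg (pi_pos hβ _).le (Real.exp_pos _).le)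
      (Real.one_le_exp (by positivity))
  | @cons a c b hac _ ih =>
    filter_upwards [eventually_gt_atTop 0, ih (half_pos hε),
      gamma_div_le (C := C) (ε := ε / 4) (by linarith)] with β hβ h1 h2
    have h3 : C.pi β a * Real.exp (β * C.energy a) ≤
        Real.exp (β * (ε / 2)) * (C.pi β c * Real.exp (β * C.energy c)) := by
      have hac' := (C.p_pos_iff β hβ a c hac.ne).2 hac
      have hca' := (C.p_pos_iff β hβ c a hac.ne').2 hac.symm
      have h4 := C.le_p β hβ a c hac.ne hac'
      have h5 := C.p_le β hβ c a hac.ne' hca'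
      have h6 := C.detailed_balance β hβ a c
      generalize C.gamma β / Fintype.card S = g at h2 h4 h5
      have h7 : C.pi β a * Real.exp (-β * (max (C.energy c - C.energy a) 0 + g)) ≤
          C.pi β c * Real.exp (-β * (max (C.energy a - C.energy c) 0 - g)) :=
        (mul_le_mul_of_nonneg_left h4 (pi_pos hβ a).le).trans
          (h6.le.trans (mul_le_mul_of_nonneg_left h5 (pi_pos hβ c).le))
      have h8 : max (C.energy c - C.energy a) 0 - max (C.energy a - C.energy c) 0 =
          C.energy c - C.energy a := by
        rcases le_total (C.energy c) (C.energy a) with h | h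
        · rw [max_eq_right (by linarith), max_eq_left (by linarith)]; ring
        · rw [max_eq_left (by linarith), max_eq_right (by linarith)]; ring
      set A := max (C.energy c - C.energy a) 0
      set B := max (C.energy a - C.energy c) 0
      have h9 := mul_le_mul_of_nonneg_right h7
        (Real.exp_pos (β * (C.energy a + A + g))).le
      rw [mul_assoc, mul_assoc, ← Real.exp_add, ← Real.exp_add] at h9
      have e1 : -β * (A + g) + β * (C.energy a + A + g) = β * C.energy a := by ring
      rw [e1] at h9
      refine h9.trans ?_
      rw [mul_left_comm, ← Real.exp_add]
      refine mul_le_mul_of_nonneg_left (Real.exp_le_exp.2 ?_) (pi_pos hβ c).le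
      have e2 : -β * (B - g) + β * (C.energy a + A + g) =
          β * (2 * g + C.energy a + (A - B)) := by ring
      rw [e2, h8, ← mul_add]
      exact mul_le_mul_of_nonneg_left (by linarith) hβ.le
    refine h3.trans ((mul_le_mul_of_nonneg_left h1 (Real.exp_pos _).le).trans (le_of_eq ?_))
    rw [← mul_assoc, ← Real.exp_add]
    ring_nf

variable (C) in
/-- Normalization of the conductances: the weight of the reference state `m`. -/
def weight (m : S) (β : ℝ) : ℝ := C.pi β m * Real.exp (β * C.energy m)

lemma weight_pos (m : S) {β : ℝ} (hβ : 0 < β) : 0 < C.weight m β :=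
  mul_pos (pi_pos hβ m) (Real.exp_pos _)

lemma energy_add_max (a b : ℝ) : a + max (b - a) 0 = max a b := by
  rcases le_total a b with h | h
  · rw [max_eq_left (by linarith), max_eq_right h]; ring
  · rw [max_eq_right (by linarith), max_eq_left h]; ring

/-- With `E(a) + (E(b) - E(a))⁺ = max (E(a)) (E(b))`, the Gibbs comparison and the bounds on `p`
give every edge the conductance `e^{-β max(E(a),E(b))}` times the common weight, up to `e^{βε}`.
This is the lower bound; `conductance_le` is the upper one. -/
lemma le_conductance (m : S) {a b : S} (hab : C.graph.Adj a b) {ε : ℝ} (hε : 0 < ε) :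
    ∀ᶠ β in atTop, C.weight m β ≤
      Real.exp (β * (max (C.energy a) (C.energy b) + ε)) * (C.pi β a * C.p β a b) := by
  filter_upwards [eventually_gt_atTop 0, pi_mul_exp_le m a (half_pos hε),
    gamma_div_le (C := C) (half_pos hε)] with β hβ h1 h2
  refine h1.trans ?_
  have h3 := C.le_p β hβ a b hab.ne ((C.p_pos_iff β hβ a b hab.ne).2 hab)
  generalize C.gamma β / Fintype.card S = g at h2 h3
  have h4 : Real.exp (β * (ε / 2)) * Real.exp (β * C.energy a) ≤
      Real.exp (β * (max (C.energy a) (C.energy b) + ε)) * C.p β a b := by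
    refine le_trans ?_ (mul_le_mul_of_nonneg_left h3 (Real.exp_pos _).le)
    rw [← Real.exp_add, ← Real.exp_add, Real.exp_le_exp, ← energy_add_max]
    nlinarith
  calc _ = C.pi β a * (Real.exp (β * (ε / 2)) * Real.exp (β * C.energy a)) := by ring
    _ ≤ C.pi β a * _ := mul_le_mul_of_nonneg_left h4 (pi_pos hβ a).le
    _ = _ := by ring

lemma conductance_le (m : S) {a b : S} (hab : C.graph.Adj a b) {ε : ℝ} (hε : 0 < ε) :
    ∀ᶠ β in atTop, Real.exp (β * (max (C.energy a) (C.energy b) - ε)) * (C.pi β a * C.p β a b) ≤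
      C.weight m β := by
  filter_upwards [eventually_gt_atTop 0, pi_mul_exp_le a m (half_pos hε),
    gamma_div_le (C := C) (half_pos hε)] with β hβ h1 h2
  have h3 := C.p_le β hβ a b hab.ne ((C.p_pos_iff β hβ a b hab.ne).2 hab)
  generalize C.gamma β / Fintype.card S = g at h2 h3
  have h4 : Real.exp (β * (max (C.energy a) (C.energy b) - ε)) * C.p β a b ≤
      Real.exp (-(β * (ε / 2))) * Real.exp (β * C.energy a) := by
    refine (mul_le_mul_of_nonneg_left h3 (Real.exp_pos _).le).trans ?_
    rw [← Real.exp_add, ← Real.exp_add, Real.exp_le_exp, ← energy_add_max]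
    nlinarith
  calc _ = C.pi β a * (Real.exp (β * (max (C.energy a) (C.energy b) - ε)) * C.p β a b) := by ring
    _ ≤ C.pi β a * (Real.exp (-(β * (ε / 2))) * Real.exp (β * C.energy a)) :=
      mul_le_mul_of_nonneg_left h4 (pi_pos hβ a).le
    _ = Real.exp (-(β * (ε / 2))) * (C.pi β a * Real.exp (β * C.energy a)) := by ring
    _ ≤ Real.exp (-(β * (ε / 2))) * (Real.exp (β * (ε / 2)) * C.weight m β) :=
      mul_le_mul_of_nonneg_left h1 (Real.exp_pos _).le
    _ = C.weight m β := by rw [← mul_assoc, ← Real.exp_add]; simp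

/-- Resistances in series: the walk followed by the exit edge to `u` has finitely many edges, each
strictly below `e`. The gaps give one `δ`, and `K` counts the edges; neither depends on `β` or `N`.
-/
lemma resistance_le {V : Set S} (m : S) {x y u : S} {e : ℝ} (w : C.graph.Walk x y)
    (hw : ∀ t ∈ w.support, C.energy t < e) (hyu : C.graph.Adj y u) (hu : u ∉ V)
    (hue : C.energy u < e) : ∃ K > 0, ∃ δ > 0, ∀ᶠ β in atTop, ∀ N,
      green (C.p β) V N x x / C.pi β x * C.weight m β ≤ K * Real.exp (β * (e - δ)) := by
  induction w with
  | @nil y =>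
    have hye : C.energy y < e := hw y (by simp)
    set M := max (C.energy y) (C.energy u)
    have hM : M < e := max_lt hye hue
    refine ⟨1, one_pos, (e - M) / 2, by linarith, ?_⟩
    filter_upwards [eventually_gt_atTop 0,
      le_conductance m hyu (ε := (e - M) / 2) (by linarith)] with β hβ h1 N
    have h2 := conductance_mul_le_one (C.p_nonneg β hβ) (C.p_sum β hβ) (pi_pos (C := C) hβ) N hu
      (x := y)
    have h3 : 0 ≤ green (C.p β) V N y y / C.pi β y :=
      div_nonneg (green_nonneg (C.p_nonneg β hβ) N y y) (pi_pos hβ y).le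
    have e1 : e - (e - M) / 2 = M + (e - M) / 2 := by ring
    rw [e1, one_mul]
    refine (mul_le_mul_of_nonneg_left h1 h3).trans ?_
    calc _ = Real.exp (β * (M + (e - M) / 2)) *
          (C.pi β y * C.p β y u * (green (C.p β) V N y y / C.pi β y)) := by ring
      _ ≤ Real.exp (β * (M + (e - M) / 2)) * 1 :=
        mul_le_mul_of_nonneg_left h2 (Real.exp_pos _).le
      _ = _ := mul_one _
  | @cons x b y hxb w ih =>
    simp only [SimpleGraph.Walk.support_cons, List.mem_cons, forall_eq_or_imp] at hw
    obtain ⟨K, hK, δ, hδ, h0⟩ := ih hw.2 hyu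
    have hbe : C.energy b < e := hw.2 b w.start_mem_support
    set M := max (C.energy x) (C.energy b)
    have hM : M < e := max_lt hw.1 hbe
    refine ⟨K + 1, by linarith, min δ ((e - M) / 2), lt_min hδ (by linarith), ?_⟩
    filter_upwards [eventually_gt_atTop 0, h0,
      le_conductance m hxb (ε := (e - M) / 2) (by linarith)] with β hβ h1 h2 N
    have h3 := conductance_mul_sub_le_one (V := V) (C.p_nonneg β hβ) (C.p_sum β hβ) (pi_pos hβ)
      (C.detailed_balance β hβ) N (x := x) (y := b)
    have h4 := h1 N
    set gx := green (C.p β) V N x x / C.pi β x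
    set gb := green (C.p β) V N b b / C.pi β b
    have h5 : (gx - gb) * C.weight m β ≤ Real.exp (β * (M + (e - M) / 2)) := by
      by_cases hneg : gx - gb ≤ 0
      · exact (mul_nonpos_of_nonpos_of_nonneg hneg (weight_pos m hβ).le).trans
          (Real.exp_pos _).le
      push Not at hneg
      refine (mul_le_mul_of_nonneg_left h2 hneg.le).trans ?_
      calc _ = Real.exp (β * (M + (e - M) / 2)) * (C.pi β x * C.p β x b * (gx - gb)) := by ring
        _ ≤ Real.exp (β * (M + (e - M) / 2)) * 1 :=
          mul_le_mul_of_nonneg_left h3 (Real.exp_pos _).le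
        _ = _ := mul_one _
    have h6 : Real.exp (β * (M + (e - M) / 2)) ≤
        Real.exp (β * (e - min δ ((e - M) / 2))) := by
      refine Real.exp_le_exp.2 (mul_le_mul_of_nonneg_left ?_ hβ.le)
      linarith [min_le_right δ ((e - M) / 2)]
    have h7 : Real.exp (β * (e - δ)) ≤ Real.exp (β * (e - min δ ((e - M) / 2))) := by
      refine Real.exp_le_exp.2 (mul_le_mul_of_nonneg_left ?_ hβ.le)
      linarith [min_le_left δ ((e - M) / 2)]
    have h8 := mul_le_mul_of_nonneg_left h7 hK.le
    calc gx * C.weight m β = gb * C.weight m β + (gx - gb) * C.weight m β := by ring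
      _ ≤ K * Real.exp (β * (e - min δ ((e - M) / 2))) +
          1 * Real.exp (β * (e - min δ ((e - M) / 2))) := by linarith
      _ = _ := by ring

/-- The product is resistance times conductance. The resistance gains `e^{-βδ}` over `e^{β E(s)}`,
and estimating the conductance with error `δ/2` spends only half of that gain. -/
lemma exists_green_mul_p_le {V : Set S} {x y u s : S} (w : C.graph.Walk x y)
    (hw : ∀ t ∈ w.support, C.energy t < C.energy s) (hyu : C.graph.Adj y u) (hu : u ∉ V)
    (hus : C.energy u < C.energy s) (hxs : C.graph.Adj x s) :
    ∃ b : ℝ → ℝ, Tendsto b atTop (𝓝 0) ∧ ∀ᶠ β in atTop, ∀ N,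
      green (C.p β) V N x x * C.p β x s ≤ b β := by
  obtain ⟨K, hK, δ, hδ, h0⟩ := resistance_le (V := V) x w hw hyu hu hus
  refine ⟨fun β => K * Real.exp (-(β * (δ / 2))), ?_, ?_⟩
  · rw [show (0 : ℝ) = K * 0 by ring]
    refine Tendsto.const_mul K (Real.tendsto_exp_neg_atTop_nhds_zero.comp ?_)
    exact tendsto_id.atTop_mul_const (half_pos hδ)
  · filter_upwards [eventually_gt_atTop 0, h0, conductance_le x hxs (half_pos hδ)]
      with β hβ h1 h2 N
    rw [max_eq_right (hw x w.start_mem_support).le] at h2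
    have h3 := h1 N
    have hπ := pi_pos (C := C) hβ x
    have hW := weight_pos (C := C) x hβ
    set G := green (C.p β) V N x x
    have hG : 0 ≤ G := green_nonneg (C.p_nonneg β hβ) N x x
    have h4 : (G / C.pi β x) * (Real.exp (β * (C.energy s - δ / 2)) *
        (C.pi β x * C.p β x s)) ≤ K * Real.exp (β * (C.energy s - δ)) :=
      (mul_le_mul_of_nonneg_left h2 (div_nonneg hG hπ.le)).trans h3
    have h5 : (G / C.pi β x) * (Real.exp (β * (C.energy s - δ / 2)) *
        (C.pi β x * C.p β x s)) = Real.exp (β * (C.energy s - δ / 2)) * (G * C.p β x s) := by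
      field_simp
    rw [h5] at h4
    refine le_of_mul_le_mul_left (h4.trans (le_of_eq ?_))
      (Real.exp_pos (β * (C.energy s - δ / 2)))
    rw [mul_left_comm, ← Real.exp_add]
    ring_nf

/-- Only finiteness uniformly in `N` matters here, so the threshold `e + 1` is taken above all
energies and any walk will do. -/
lemma eventually_green_le {V : Set S} {y u : S} (hyu : C.graph.Adj y u) (hu : u ∉ V) :
    ∀ᶠ β in atTop, ∀ x, ∃ K, ∀ N, green (C.p β) V N x x ≤ K := by
  obtain ⟨e, he⟩ := (Set.finite_range C.energy).bddAbove
  have he' : ∀ t, C.energy t < e + 1 := fun t => by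
    have := he ⟨t, rfl⟩
    linarith
  have h : ∀ x, ∀ᶠ β in atTop, ∃ K, ∀ N, green (C.p β) V N x x ≤ K := by
    intro x
    obtain ⟨w⟩ := C.connected.preconnected x y
    obtain ⟨K, -, δ, -, h0⟩ := resistance_le (V := V) x w (fun t _ => he' t) hyu hu (he' u)
    filter_upwards [eventually_gt_atTop 0, h0] with β hβ h1
    refine ⟨K * Real.exp (β * (e + 1 - δ)) / C.weight x β * C.pi β x, fun N => ?_⟩
    rw [← div_le_iff₀ (pi_pos hβ x), le_div_iff₀ (weight_pos x hβ)]
    exact h1 N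
  exact eventually_all.2 h

lemma tendsto_survival {p : S → S → ℝ} (hp : ∀ x y, 0 ≤ p x y) (hs : ∀ x, ∑ y, p x y = 1)
    {V : Set S} (hK : ∀ x, ∃ K, ∀ N, green p V N x x ≤ K) (x : S) :
    Tendsto (fun N => ∑ u, (hop p V V ^ N) x u) atTop (𝓝 0) := by
  choose K hK using hK
  have h : ∀ u, Tendsto (fun N => (hop p V V ^ N) x u) atTop (𝓝 0) := by
    intro u
    refine Summable.tendsto_atTop_zero (summable_of_sum_range_le (c := K u)
      (fun N => hop_pow_nonneg hp N x u) fun N => ?_)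
    rw [← green_apply]
    exact (green_le_diag hp hs N x u).trans (hK u N)
  simpa using tendsto_finsetSum Finset.univ fun u _ => h u

/-- A valley is left through its exit state with probability tending to one, from any of its
states. -/
theorem exit_at_exitState {i : ℕ} (hi : 1 ≤ i) {r u : S} (hr : r ∈ C.metastates i)
    (hN : r ∉ C.nonAssigned i) (hu : C.IsExitState i r u) :
    ∃ b : ℝ → ℝ, Tendsto b atTop (𝓝 0) ∧ ∀ᶠ β in atTop, ∀ x ∈ C.block i r, ∀ η > 0, ∃ N,
      1 - b β - η ≤ ∑ n ∈ Finset.range N, (hop (C.p β) (C.block i r) (C.block i r) ^ n *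
        hop (C.p β) (C.block i r) {u}) x u := by
  set V := C.block i r
  have huV : u ∉ V := hu.1.1
  obtain ⟨y, -, hyu⟩ := hu.1.2
  -- One vanishing bound is chosen for each ordered pair, with the pairs ending in `u` and the pairs
  -- which are not exit edges contributing nothing. Their finite sum is the error, valid for all
  -- starting states.
  have h : ∀ q : S × S, ∃ b : ℝ → ℝ, Tendsto b atTop (𝓝 0) ∧ ∀ᶠ β in atTop, ∀ N,
      (if q.2 = u then 0 else green (C.p β) V N q.1 q.1 * hop (C.p β) V Vᶜ q.1 q.2) ≤ b β := by
    rintro ⟨a, s⟩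
    have hzero : (∀ᶠ β in atTop, s = u ∨ hop (C.p β) V Vᶜ a s = 0) →
        ∃ b : ℝ → ℝ, Tendsto b atTop (𝓝 0) ∧ ∀ᶠ β in atTop, ∀ N,
        (if s = u then 0 else green (C.p β) V N a a * hop (C.p β) V Vᶜ a s) ≤ b β := by
      refine fun h => ⟨fun _ => 0, tendsto_const_nhds, h.mono fun β hβ N => ?_⟩
      split_ifs with hsu
      · exact le_rfl
      · rw [hβ.resolve_left hsu, mul_zero]
    by_cases hsu : s = u
    · exact hzero (Eventually.of_forall fun β => Or.inl hsu)
    by_cases ha : a ∈ V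
    swap
    · exact hzero (Eventually.of_forall fun β => Or.inr (hop_eq_zero_left ha s))
    by_cases hs : s ∈ V
    · exact hzero (Eventually.of_forall fun β => Or.inr (hop_eq_zero_right (by simpa using hs) a))
    have hne : a ≠ s := by rintro rfl; exact hs ha
    by_cases has : C.graph.Adj a s
    · obtain ⟨y, hyu, w, hus, hw⟩ := Landscape.exists_walk_exitState hi hr hN hu ha hs has hsu
      obtain ⟨b, hb, hb'⟩ := exists_green_mul_p_le (V := V) w (fun t ht => (hw t ht).2) hyu huV
        hus has
      refine ⟨b, hb, hb'.mono fun β hβ N => ?_⟩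
      rw [if_neg hsu, hop_of_mem ha hs]
      exact hβ N
    · refine hzero ((eventually_gt_atTop 0).mono fun β hβ => Or.inr ?_)
      rw [hop_of_mem ha hs]
      exact le_antisymm (not_lt.1 fun h => has ((C.p_pos_iff β hβ a s hne).1 h))
        (C.p_nonneg β hβ a s)
  choose b hb hb' using h
  refine ⟨fun β => ∑ q, b q β, by simpa using tendsto_finsetSum Finset.univ fun q _ => hb q, ?_⟩
  filter_upwards [eventually_gt_atTop 0, eventually_all.2 hb', eventually_green_le hyu huV]
    with β hβ h1 h2 x hx η hη
  have hp := C.p_nonneg β hβ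
  have hs := C.p_sum β hβ
  obtain ⟨N, hN⟩ := ((tendsto_survival hp hs h2 x).eventually (gt_mem_nhds hη)).exists
  refine ⟨N, ?_⟩
  have h3 := exit_add_survival hs hx N
  rw [Finset.sum_comm, ← Finset.add_sum_erase _ _ (Finset.mem_univ u)] at h3
  have h4 : ∑ n ∈ Finset.range N, (hop (C.p β) V V ^ n * hop (C.p β) V Vᶜ) x u =
      ∑ n ∈ Finset.range N, (hop (C.p β) V V ^ n * hop (C.p β) V {u}) x u := by
    refine Finset.sum_congr rfl fun n _ => ?_
    rw [Matrix.mul_apply, Matrix.mul_apply]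
    refine Finset.sum_congr rfl fun z _ => ?_
    simp [hop_apply, huV]
  have h5 : ∑ s ∈ Finset.univ.erase u,
      ∑ n ∈ Finset.range N, (hop (C.p β) V V ^ n * hop (C.p β) V Vᶜ) x s ≤ ∑ q, b q β := by
    calc _ ≤ ∑ s ∈ Finset.univ.erase u, ∑ z, b (z, s) β := by
          refine Finset.sum_le_sum fun s hs' => ?_
          rw [sum_exit_eq]
          refine Finset.sum_le_sum fun z _ => ?_
          refine le_trans ?_ (h1 (z, s) N)
          rw [if_neg (Finset.ne_of_mem_erase hs')]
          exact mul_le_mul_of_nonneg_right (green_le_diag hp hs N x z) (hop_nonneg hp z s)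
      _ ≤ ∑ s, ∑ z, b (z, s) β := by
          refine Finset.sum_le_sum_of_subset_of_nonneg (Finset.erase_subset _ _)
            fun s _ hs' => Finset.sum_nonneg fun z _ => ?_
          have hsu : s = u := by simpa using hs'
          -- For `s = u` the chosen bound says just that `b` is nonnegative; the time zero is
          -- arbitrary.
          have := h1 (z, s) 0
          rwa [if_pos hsu] at this
      _ = _ := by rw [Fintype.sum_prod_type_right]
  rw [← h4]
  linarith

end Exit

end LowTempChain

/-! ### Path probabilities and the Markov property -/

section MeasureSums

lemma measureReal_eq_sum {Ω F : Type*} [MeasurableSpace Ω] [Fintype F] (μ : Measure Ω)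
    [IsFiniteMeasure μ] (f : Ω → F) (hf : ∀ v, MeasurableSet {ω | f ω = v}) {E : Set Ω}
    (hE : MeasurableSet E) : μ.real E = ∑ v, μ.real (E ∩ {ω | f ω = v}) := by
  rw [← measureReal_iUnion_fintype]
  · congr 1
    ext ω
    simp
  · intro v v' hv
    refine Set.disjoint_left.2 ?_
    rintro ω ⟨-, h1⟩ ⟨-, h2⟩
    exact hv (h1.symm.trans h2)
  · exact fun v => hE.inter (hf v)

lemma hasSum_measureReal {Ω ι : Type*} [MeasurableSpace Ω] [Countable ι] (μ : Measure Ω)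
    [IsFiniteMeasure μ] {f : ι → Set Ω} (hd : Pairwise (Function.onFun Disjoint f))
    (hf : ∀ v, MeasurableSet (f v)) : HasSum (fun v => μ.real (f v)) (μ.real (⋃ v, f v)) := by
  have h := measure_iUnion (μ := μ) hd hf
  have hfin : ∑' v, μ (f v) ≠ ⊤ := by rw [← h]; exact measure_ne_top _ _
  rw [measureReal_def, h, ENNReal.tsum_toReal_eq fun v => measure_ne_top _ _]
  exact ENNReal.hasSum_toReal hfin

lemma cond_real {Ω : Type*} [MeasurableSpace Ω] (μ : Measure Ω) {A : Set Ω}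
    (hA : MeasurableSet A) (B : Set Ω) : μ[|A].real B = μ.real (A ∩ B) / μ.real A := by
  rw [measureReal_def, cond_apply hA, ENNReal.toReal_mul, ENNReal.toReal_inv, div_eq_inv_mul]
  rfl

end MeasureSums

section Markov

open Classical

variable {S : Type*} [Fintype S] {Ω : Type*} [MeasurableSpace Ω]

/-- The event `E` only depends on the states up to time `n`. -/
def Past (X : ℕ → Ω → S) (n : ℕ) (E : Set Ω) : Prop :=
  ∀ ω ω', (∀ k ≤ n, X k ω = X k ω') → ω ∈ E → ω' ∈ E

/-- Weights of the paths which are in `B k` at time `k ≤ n`. -/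
def pathMat (p : S → S → ℝ) (B : ℕ → Set S) : ℕ → Matrix S S ℝ
  | 0 => Matrix.of fun x y => if x = y ∧ x ∈ B 0 then 1 else 0
  | n + 1 => pathMat p B n * hop p (B n) (B (n + 1))

variable {p : S → S → ℝ} {B : ℕ → Set S}

lemma pathMat_eq_zero {n : ℕ} {x y : S} (hy : y ∉ B n) : pathMat p B n x y = 0 := by
  cases n with
  | zero => exact if_neg (by rintro ⟨rfl, h⟩; exact hy h)
  | succ n =>
    rw [pathMat, Matrix.mul_apply]
    exact Finset.sum_eq_zero fun z _ => by rw [hop_eq_zero_right hy, mul_zero]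

lemma pathMat_congr {B' : ℕ → Set S} {n : ℕ} (h : ∀ k ≤ n, B k = B' k) :
    pathMat p B n = pathMat p B' n := by
  induction n with
  | zero => simp [pathMat, h 0 le_rfl]
  | succ n ih => rw [pathMat, pathMat, ih fun k hk => h k (hk.trans (Nat.le_succ n)),
      h n (Nat.le_succ n), h (n + 1) le_rfl]

lemma pathMat_add {V : Set S} {n : ℕ} (d : ℕ) (h : ∀ k, n ≤ k → k ≤ n + d → B k = V) :
    pathMat p B (n + d) = pathMat p B n * hop p V V ^ d := by
  induction d with
  | zero => simp
  | succ d ih =>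
    rw [← add_assoc, pathMat, ih fun k h1 h2 => h k h1 (by omega), h (n + d) (by omega) (by omega),
      h (n + d + 1) (by omega) (by omega), pow_succ, mul_assoc]

lemma pathMat_jump {V W : Set S} {n d : ℕ} (h : ∀ k, n ≤ k → k ≤ n + d → B k = V)
    (hW : B (n + d + 1) = W) :
    pathMat p B (n + d + 1) = pathMat p B n * (hop p V V ^ d * hop p V W) := by
  rw [pathMat, pathMat_add d h, hW, h (n + d) (by omega) le_rfl, mul_assoc]

variable {μ : Measure Ω} {X : ℕ → Ω → S} {x : S}

/-- The state space is finite, so such an event is a finite union of cylinders. -/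
lemma Past.measurableSet (hX : ∀ k s, MeasurableSet {ω | X k ω = s}) {n : ℕ} {E : Set Ω}
    (hE : Past X n E) : MeasurableSet E := by
  let H : Ω → (Fin (n + 1) → S) := fun ω k => X k ω
  have h : E = ⋃ v ∈ {v | ∃ ω ∈ E, H ω = v}, {ω | H ω = v} := by
    ext ω
    simp only [Set.mem_iUnion, exists_prop, Set.mem_ofPred_eq]
    constructor
    · exact fun hω => ⟨H ω, ⟨ω, hω, rfl⟩, rfl⟩
    · rintro ⟨v, ⟨ω', hω', h1⟩, h2⟩
      refine hE ω' ω (fun k hk => ?_) hω'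
      exact congrFun (h1.trans h2.symm) ⟨k, Nat.lt_succ_of_le hk⟩
  rw [h]
  refine MeasurableSet.biUnion (Set.to_countable _) fun v _ => ?_
  have : {ω | H ω = v} = ⋂ k : Fin (n + 1), {ω | X k ω = v k} := by
    ext ω
    simp [H, funext_iff]
  rw [this]
  exact MeasurableSet.iInter fun k => hX k _

/-- One step of the Markov chain. -/
lemma IsMarkovChain.step (hμ : IsMarkovChain μ X p x) {n : ℕ} {E : Set Ω} (hE : Past X n E)
    (s : S) : μ.real (E ∩ {ω | X (n + 1) ω = s}) =
      ∑ u, μ.real (E ∩ {ω | X n ω = u}) * p u s := by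
  have := hμ.isProbabilityMeasure
  let H : Ω → (Fin (n + 1) → S) := fun ω k => X k ω
  have hH : ∀ v, MeasurableSet {ω | H ω = v} := fun v => by
    refine Past.measurableSet (n := n) hμ.measurableSet fun ω ω' h h1 => ?_
    rw [Set.mem_ofPred_eq] at h1 ⊢
    rw [← h1]
    exact funext fun k => (h k (Nat.le_of_lt_succ k.2)).symm
  have hEm := hE.measurableSet hμ.measurableSet
  -- Condition on the full history. A history compatible with `E` lies entirely in `E`, because `E`
  -- depends on nothing else, and the path formula applies to it.
  have key : ∀ v, μ.real (E ∩ {ω | X (n + 1) ω = s} ∩ {ω | H ω = v}) =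
      μ.real (E ∩ {ω | H ω = v}) * p (v (Fin.last n)) s := by
    intro v
    by_cases hv : ∃ ω ∈ E, H ω = v
    swap
    · have h1 : E ∩ {ω | H ω = v} = ∅ := by
        ext ω
        simp only [Set.mem_inter_iff, Set.mem_ofPred_eq, Set.mem_empty_iff_false, iff_false]
        exact fun h => hv ⟨ω, h⟩
      rw [Set.inter_right_comm, h1, Set.empty_inter]
      simp
    obtain ⟨ω₀, hω₀, hv⟩ := hv
    have hsub : E ∩ {ω | H ω = v} = {ω | H ω = v} := by
      refine Set.inter_eq_right.2 fun ω hω => hE ω₀ ω (fun k hk => ?_) hω₀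
      exact congrFun (hv.trans (Eq.symm hω)) ⟨k, Nat.lt_succ_of_le hk⟩
    rw [Set.inter_right_comm, hsub]
    -- The path formula only covers histories starting at `x`; the others form null events.
    by_cases h0 : v 0 = x
    · let w : ℕ → S := fun k => if h : k < n + 1 then v ⟨k, h⟩ else s
      have hw0 : w 0 = x := by simpa [w] using h0
      have h1 : {ω | H ω = v} = {ω | ∀ k ≤ n, X k ω = w k} := by
        ext ω
        simp only [Set.mem_ofPred_eq, H, funext_iff]
        constructor
        · intro h k hk
          rw [show w k = v ⟨k, Nat.lt_succ_of_le hk⟩ from dif_pos (Nat.lt_succ_of_le hk)]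
          exact h ⟨k, Nat.lt_succ_of_le hk⟩
        · intro h k
          rw [h k (Nat.le_of_lt_succ k.2)]
          exact dif_pos k.2
      have hws : w (n + 1) = s := dif_neg (by omega)
      have h2 : {ω | H ω = v} ∩ {ω | X (n + 1) ω = s} = {ω | ∀ k ≤ n + 1, X k ω = w k} := by
        rw [h1]
        ext ω
        simp only [Set.mem_inter_iff, Set.mem_ofPred_eq, Nat.le_succ_iff_eq_or_le]
        constructor
        · rintro ⟨h3, h4⟩ k (rfl | hk)
          · rw [h4, hws]
          · exact h3 k hk
        · exact fun h => ⟨fun k hk => h k (Or.inr hk), (h _ (Or.inl rfl)).trans hws⟩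
      rw [h2, h1, hμ.path _ w hw0, hμ.path _ w hw0, Finset.prod_range_succ, hws]
      congr 2
      exact dif_pos (Nat.lt_succ_self n)
    · have h1 : μ.real {ω | H ω = v} = 0 := by
        rw [measureReal_def, measure_mono_null (t := {ω | ¬ X 0 ω = x}) _ hμ.start,
          ENNReal.toReal_zero]
        intro ω hω hx
        exact h0 ((congrFun hω 0).symm.trans hx)
      have h2 : μ.real ({ω | H ω = v} ∩ {ω | X (n + 1) ω = s}) = 0 :=
        le_antisymm ((measureReal_mono Set.inter_subset_left).trans h1.le) measureReal_nonneg
      rw [h1, h2, zero_mul]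
  rw [measureReal_eq_sum μ H hH (hEm.inter (hμ.measurableSet _ _))]
  simp_rw [key]
  have h3 : ∀ u, μ.real (E ∩ {ω | X n ω = u}) =
      ∑ v, if v (Fin.last n) = u then μ.real (E ∩ {ω | H ω = v}) else 0 := by
    intro u
    rw [measureReal_eq_sum μ H hH (hEm.inter (hμ.measurableSet _ _))]
    refine Finset.sum_congr rfl fun v _ => ?_
    split_ifs with hvu
    · congr 1
      ext ω
      simp only [Set.mem_inter_iff, Set.mem_ofPred_eq]
      constructor
      · exact fun h => ⟨h.1.1, h.2⟩
      · refine fun h => ⟨⟨h.1, ?_⟩, h.2⟩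
        rw [← hvu, ← h.2]
        rfl
    · rw [← measureReal_empty (μ := μ)]
      congr 1
      ext ω
      simp only [Set.mem_inter_iff, Set.mem_ofPred_eq, Set.mem_empty_iff_false, iff_false]
      rintro ⟨⟨-, h1⟩, h2⟩
      exact hvu (by rw [← h2]; exact h1)
  simp_rw [h3, Finset.sum_mul]
  rw [Finset.sum_comm]
  refine Finset.sum_congr rfl fun v _ => ?_
  rw [Finset.sum_eq_single (v (Fin.last n))]
  · rw [if_pos rfl]
  · intro u _ hu
    rw [if_neg (Ne.symm hu), zero_mul]
  · simp

/-- The Markov property at time `n`. -/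
lemma IsMarkovChain.markov (hμ : IsMarkovChain μ X p x) {n : ℕ} {E : Set Ω} (hE : Past X n E)
    (D : ℕ → Set S) (m : ℕ) (s u : S) :
    μ.real (E ∩ {ω | X n ω = s} ∩ {ω | (∀ k ≤ m, X (n + k) ω ∈ D k) ∧ X (n + m) ω = u}) =
      μ.real (E ∩ {ω | X n ω = s}) * pathMat p D m s u := by
  have := hμ.isProbabilityMeasure
  induction m generalizing u with
  | zero =>
    by_cases h : s = u ∧ s ∈ D 0
    · obtain ⟨rfl, hs⟩ := h
      rw [pathMat, Matrix.of_apply, if_pos ⟨rfl, hs⟩, mul_one, Set.inter_eq_left.2]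
      rintro ω ⟨-, h1⟩
      rw [Set.mem_ofPred_eq] at h1
      simp only [Nat.le_zero, Set.mem_ofPred_eq, forall_eq, add_zero, h1, hs, and_self]
    · rw [pathMat, Matrix.of_apply, if_neg h, mul_zero, ← measureReal_empty (μ := μ)]
      congr 1
      ext ω
      simp only [Set.mem_inter_iff, Set.mem_ofPred_eq, Set.mem_empty_iff_false, iff_false]
      rintro ⟨⟨-, h1⟩, h2, h3⟩
      have := h2 0 le_rfl
      simp only [add_zero, h1] at this h3
      exact h ⟨h3, this⟩
  | succ m ih =>
    by_cases hu : u ∈ D (m + 1)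
    · have hpast : Past X (n + m) (E ∩ {ω | X n ω = s} ∩ {ω | ∀ k ≤ m, X (n + k) ω ∈ D k}) := by
        rintro ω ω' h ⟨⟨h1, h2⟩, h3⟩
        refine ⟨⟨hE ω ω' (fun k hk => h k (by omega)) h1, ?_⟩, fun k hk => ?_⟩
        · rw [Set.mem_ofPred_eq, ← h n (by omega)]; exact h2
        · rw [← h (n + k) (by omega)]; exact h3 k hk
      have h1 : E ∩ {ω | X n ω = s} ∩ {ω | (∀ k ≤ m + 1, X (n + k) ω ∈ D k) ∧
          X (n + (m + 1)) ω = u} = E ∩ {ω | X n ω = s} ∩ {ω | ∀ k ≤ m, X (n + k) ω ∈ D k} ∩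
            {ω | X (n + m + 1) ω = u} := by
        ext ω
        simp only [Set.mem_inter_iff, Set.mem_ofPred_eq]
        constructor
        · exact fun h => ⟨⟨h.1, fun k hk => h.2.1 k (by omega)⟩, h.2.2⟩
        · refine fun h => ⟨h.1.1, fun k hk => ?_, h.2⟩
          rcases Nat.le_succ_iff_eq_or_le.1 hk with rfl | hk
          · have h2 : X (n + (m + 1)) ω = u := h.2
            rw [h2]; exact hu
          · exact h.1.2 k hk
      rw [h1, hμ.step hpast, pathMat, Matrix.mul_apply, Finset.mul_sum]
      refine Finset.sum_congr rfl fun v _ => ?_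
      rw [Set.inter_assoc, show ({ω | ∀ k ≤ m, X (n + k) ω ∈ D k} ∩ {ω | X (n + m) ω = v}) =
        {ω | (∀ k ≤ m, X (n + k) ω ∈ D k) ∧ X (n + m) ω = v} from rfl, ih, mul_assoc]
      congr 1
      by_cases hv : v ∈ D m
      · rw [hop_of_mem hv hu]
      · rw [pathMat_eq_zero hv, zero_mul, zero_mul]
    · rw [pathMat_eq_zero hu, mul_zero, ← measureReal_empty (μ := μ)]
      congr 1
      ext ω
      simp only [Set.mem_inter_iff, Set.mem_ofPred_eq, Set.mem_empty_iff_false, iff_false]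
      rintro ⟨-, h2, h3⟩
      exact hu (h3 ▸ h2 (m + 1) le_rfl)

lemma IsMarkovChain.real_path (hμ : IsMarkovChain μ X p x) (D : ℕ → Set S) (m : ℕ) (u : S) :
    μ.real {ω | (∀ k ≤ m, X k ω ∈ D k) ∧ X m ω = u} = pathMat p D m x u := by
  have := hμ.isProbabilityMeasure
  have h := hμ.markov (n := 0) (E := Set.univ) (fun _ _ _ h => h) D m x u
  have h0 : μ {ω | ¬ X 0 ω = x} = 0 := hμ.start
  have h1 : μ.real {ω | X 0 ω = x} = 1 := by
    rw [measureReal_def, (prob_compl_eq_zero_iff (hμ.measurableSet 0 x)).1 h0, ENNReal.toReal_one]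
  simp only [Set.univ_inter, zero_add, h1, one_mul] at h
  rw [← h]
  refine measureReal_congr ?_
  filter_upwards [hμ.start] with ω hω
  exact propext ⟨fun h => ⟨hω, h⟩, fun h => h.2⟩

lemma past_path (D : ℕ → Set S) (m : ℕ) : Past X m {ω | ∀ k ≤ m, X k ω ∈ D k} :=
  fun _ _ h h1 k hk => h k hk ▸ h1 k hk

lemma IsMarkovChain.real_path_sum (hμ : IsMarkovChain μ X p x) (D : ℕ → Set S) (m : ℕ) :
    μ.real {ω | ∀ k ≤ m, X k ω ∈ D k} = ∑ u, pathMat p D m x u := by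
  have := hμ.isProbabilityMeasure
  rw [measureReal_eq_sum μ (X m) (hμ.measurableSet m)
    ((past_path D m).measurableSet hμ.measurableSet)]
  exact Finset.sum_congr rfl fun u _ => hμ.real_path D m u

end Markov

/-! ### Jump times and labels along a trajectory -/

namespace Landscape

section Jumps

variable {S : Type*} {L : Landscape S} {i : ℕ} {x : ℕ → S}

lemma jumpTime_zero : L.jumpTime i x 0 = 0 := rfl

/-- Replaces the comparison with the preceding label by a comparison with the label at the last
jump, which is the form needed for cylinder events. -/
lemma jumpTime_succ_eq_iff {n T T' : ℕ} (hT : L.jumpTime i x n = T) :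
    L.jumpTime i x (n + 1) = T' ↔
      T < T' ∧ (∀ l, T ≤ l → l < T' → L.ac i x l = L.ac i x T) ∧ L.ac i x T' ≠ L.ac i x T := by
  classical
  have hdef : L.jumpTime i x (n + 1) =
      ⨅ (k : ℕ) (_ : T < k ∧ L.ac i x k ≠ L.ac i x (k - 1)), (k : ℕ∞) := by
    rw [jumpTime, hT]
    simp only [Nat.cast_lt]
  have hconst : ∀ T', (∀ k, T < k → k < T' → L.ac i x k = L.ac i x (k - 1)) →
      ∀ l, T ≤ l → l < T' → L.ac i x l = L.ac i x T := by
    intro T' h l hl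
    induction l, hl using Nat.le_induction with
    | base => exact fun _ => rfl
    | succ l hl ih =>
      intro hlT
      rw [h (l + 1) (by omega) hlT, Nat.add_sub_cancel]
      exact ih (by omega)
  have hle : ∀ k : ℕ, T < k → L.ac i x k ≠ L.ac i x (k - 1) →
      ⨅ (k : ℕ) (_ : T < k ∧ L.ac i x k ≠ L.ac i x (k - 1)), (k : ℕ∞) ≤ k :=
    fun k h1 h2 => iInf_le_of_le k (iInf_le _ ⟨h1, h2⟩)
  rw [hdef]
  constructor
  · intro h
    by_cases hex : ∃ k, T < k ∧ L.ac i x k ≠ L.ac i x (k - 1)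
    · have hfind : (⨅ (k : ℕ) (_ : T < k ∧ L.ac i x k ≠ L.ac i x (k - 1)), (k : ℕ∞)) =
          (Nat.find hex : ℕ) := by
        refine le_antisymm (hle _ (Nat.find_spec hex).1 (Nat.find_spec hex).2)
          (le_iInf₂ fun k hk => ?_)
        exact_mod_cast Nat.find_min' hex hk
      rw [hfind] at h
      obtain rfl : Nat.find hex = T' := by exact_mod_cast h
      obtain ⟨h1, h2⟩ := Nat.find_spec hex
      have h3 := hconst (Nat.find hex) fun k hk hk' => by
        by_contra hne
        exact Nat.find_min hex hk' ⟨hk, hne⟩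
      refine ⟨h1, h3, ?_⟩
      rwa [← h3 (Nat.find hex - 1) (by omega) (by omega)]
    · push Not at hex
      rw [iInf₂_eq_top.2 fun k hk => absurd (hex k hk.1) hk.2] at h
      exact absurd h (by simp)
  · rintro ⟨h1, h2, h3⟩
    have h4 : L.ac i x T' ≠ L.ac i x (T' - 1) := by
      rwa [h2 (T' - 1) (by omega) (by omega)]
    refine le_antisymm (hle T' h1 h4) (le_iInf₂ fun k hk => ?_)
    by_contra! hlt
    have hlt' : k < T' := by exact_mod_cast hlt
    refine hk.2 ?_
    rw [h2 k hk.1.le hlt', h2 (k - 1) (by have := hk.1; omega) (by omega)]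

lemma jumpTime_lt_of_succ_eq {n T' : ℕ} (h : L.jumpTime i x (n + 1) = T') :
    ∃ T : ℕ, L.jumpTime i x n = T ∧ T < T' := by
  have hlt : L.jumpTime i x n < T' := by
    by_contra! hle
    rw [jumpTime] at h
    have h1 : (⨅ (k : ℕ) (_ : L.jumpTime i x n < k ∧ L.ac i x k ≠ L.ac i x (k - 1)), (k : ℕ∞)) <
        ((T' + 1 : ℕ) : ℕ∞) := by
      rw [h]; exact_mod_cast Nat.lt_succ_self T'
    simp only [iInf_lt_iff] at h1
    obtain ⟨k, hk, h2⟩ := h1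
    have h3 := hle.trans_lt hk.1
    have h4 : T' < k := by exact_mod_cast h3
    have h5 : k < T' + 1 := by exact_mod_cast h2
    omega
  obtain ⟨T, hT⟩ := ENat.ne_top_iff_exists.1 (ne_top_of_lt hlt)
  refine ⟨T, hT.symm, ?_⟩
  rw [← hT] at hlt
  exact_mod_cast hlt

lemma aac_eq {n T : ℕ} (h : L.jumpTime i x n = T) : L.aac i x n = L.ac i x T := by
  simp [aac, h]

/-- Jump times are stopping times: the event that one equals `T` is decided by the trajectory up to
`T`. -/
lemma jumpTime_congr {x' : ℕ → S} {n T : ℕ} (hx : ∀ k ≤ T, x k = x' k)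
    (h : L.jumpTime i x n = T) : L.jumpTime i x' n = T := by
  induction n generalizing T with
  | zero => exact h
  | succ n ih =>
    obtain ⟨T₀, h0, hlt⟩ := jumpTime_lt_of_succ_eq h
    have h0' := ih (fun k hk => hx k (by omega)) h0
    have hac : ∀ k ≤ T, L.ac i x k = L.ac i x' k := fun k hk => by rw [ac, ac, hx k hk]
    obtain ⟨-, h1, h2⟩ := (jumpTime_succ_eq_iff h0).1 h
    refine (jumpTime_succ_eq_iff h0').2 ⟨hlt, fun l hl hl' => ?_, ?_⟩
    · rw [← hac l hl'.le, ← hac T₀ hlt.le]; exact h1 l hl hl'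
    · rw [← hac T le_rfl, ← hac T₀ hlt.le]; exact h2

variable (L i) in
/-- The accelerated aggregated chain follows `z` with jump times `t` up to the `k`-th jump. -/
def Entered (z : ℕ → S) (t : ℕ → ℕ) (k : ℕ) (x : ℕ → S) : Prop :=
  ∀ j ≤ k, L.aac i x j = z j ∧ L.jumpTime i x j = t j

lemma entered_zero {z : ℕ → S} {t : ℕ → ℕ} (h0 : t 0 = 0) :
    L.Entered i z t 0 x ↔ L.ac i x 0 = z 0 := by
  simp only [Entered, Nat.le_zero, forall_eq, h0, jumpTime_zero, Nat.cast_zero, and_true]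
  rw [aac_eq (T := 0) (by simp [jumpTime_zero])]

lemma entered_succ {z : ℕ → S} {t : ℕ → ℕ} {k : ℕ} (ht : t k < t (k + 1)) :
    L.Entered i z t (k + 1) x ↔ z (k + 1) ≠ z k ∧ L.Entered i z t k x ∧
      (∀ l, t k ≤ l → l < t (k + 1) → L.ac i x l = z k) ∧ L.ac i x (t (k + 1)) = z (k + 1) := by
  constructor
  · intro h
    have hk : L.Entered i z t k x := fun j hj => h j (by omega)
    obtain ⟨h1, h2⟩ := h k (by omega)
    obtain ⟨h3, h4⟩ := h (k + 1) le_rfl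
    obtain ⟨-, h5, h6⟩ := (jumpTime_succ_eq_iff h2).1 h4
    rw [aac_eq h2] at h1
    rw [aac_eq h4] at h3
    exact ⟨by rw [← h1, ← h3]; exact h6, hk, fun l hl hl' => (h5 l hl hl').trans h1, h3⟩
  · rintro ⟨hne, hk, h1, h2⟩ j hj
    rcases Nat.le_succ_iff_eq_or_le.1 hj with rfl | hj
    · obtain ⟨h3, h4⟩ := hk k le_rfl
      rw [aac_eq h4] at h3
      have h5 := (jumpTime_succ_eq_iff (T' := t (k + 1)) h4).2
        ⟨ht, fun l hl hl' => (h1 l hl hl').trans h3.symm, by rw [h2, h3]; exact hne⟩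
      exact ⟨(aac_eq h5).trans h2, h5⟩
    · exact hk j hj

variable (L) in
/-- The states which are aggregated to `z`. -/
def cell (i : ℕ) (z : S) : Set S := {s | L.aggregate i s = z}

end Jumps

/-! ### Jump histories as matrix products -/

section Matrices

open Classical

variable {S : Type*} [Fintype S] {L : Landscape S} {i : ℕ} {p : S → S → ℝ}

variable (L i p) in
/-- Weights of the paths along which the aggregated chain follows `z` with jump times `t`, up to
the `k`-th jump. -/
def entranceMat (z : ℕ → S) (t : ℕ → ℕ) : ℕ → Matrix S S ℝ
  | 0 => Matrix.of fun x y => if x = y ∧ x ∈ L.cell i (z 0) then 1 else 0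
  | k + 1 => entranceMat z t k * (hop p (L.cell i (z k)) (L.cell i (z k)) ^ (t (k + 1) - t k - 1) *
      hop p (L.cell i (z k)) (L.cell i (z (k + 1))))

/-- The event of following `z` with jump times `t` is a cylinder event. -/
lemma exists_labels (z : ℕ → S) (t : ℕ → ℕ) (h0 : t 0 = 0) (K : ℕ)
    (ht : ∀ k < K, t k < t (k + 1)) (hz : ∀ k < K, z (k + 1) ≠ z k) :
    ∃ W : ℕ → S, (∀ x, L.Entered i z t K x ↔ ∀ l ≤ t K, L.ac i x l = W l) ∧ W (t K) = z K ∧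
      pathMat p (fun l => L.cell i (W l)) (t K) = L.entranceMat i p z t K := by
  induction K with
  | zero =>
    refine ⟨fun _ => z 0, fun x => ?_, rfl, ?_⟩
    · rw [entered_zero h0, h0]; simp
    · rw [h0]; rfl
  | succ K ih =>
    obtain ⟨W, h1, h2, h3⟩ := ih (fun k hk => ht k (by omega)) (fun k hk => hz k (by omega))
    have htK := ht K (Nat.lt_succ_self K)
    let W' : ℕ → S := fun l => if l ≤ t K then W l else if l < t (K + 1) then z K else z (K + 1)
    have hW1 : ∀ l ≤ t K, W' l = W l := fun l hl => if_pos hl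
    have hW2 : ∀ l, t K ≤ l → l < t (K + 1) → W' l = z K := by
      intro l hl hl'
      rcases hl.eq_or_lt with rfl | hlt
      · rw [hW1 _ le_rfl, h2]
      · simp only [W', if_neg (not_le.2 hlt), if_pos hl']
    have hW3 : W' (t (K + 1)) = z (K + 1) := by
      simp only [W', if_neg (not_le.2 htK), lt_irrefl, if_false]
    refine ⟨W', fun x => ?_, hW3, ?_⟩
    · rw [entered_succ htK, h1]
      constructor
      · rintro ⟨-, h4, h5, h6⟩ l hl
        by_cases hl1 : l ≤ t K
        · rw [hW1 l hl1]; exact h4 l hl1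
        · rcases hl.eq_or_lt with rfl | hl2
          · rw [hW3, h6]
          · rw [hW2 l (by omega) hl2, h5 l (by omega) hl2]
      · refine fun h => ⟨hz K (Nat.lt_succ_self K), fun l hl => ?_, fun l hl hl' => ?_, ?_⟩
        · rw [← hW1 l hl]; exact h l (by omega)
        · rw [← hW2 l hl hl']; exact h l (by omega)
        · rw [← hW3]; exact h _ le_rfl
    · obtain ⟨d, hd⟩ : ∃ d, t (K + 1) = t K + d + 1 := ⟨t (K + 1) - t K - 1, by omega⟩
      have hd' : t (K + 1) - t K - 1 = d := by omega
      have hc : pathMat p (fun l => L.cell i (W' l)) (t K) =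
          pathMat p (fun l => L.cell i (W l)) (t K) :=
        pathMat_congr fun k hk => by rw [hW1 k hk]
      rw [entranceMat, hd', ← h3, ← hc, hd]
      refine pathMat_jump (fun k hk hk' => ?_) ?_
      · rw [hW2 k hk (by omega)]
      · rw [← hd, hW3]

variable (L i p) in
/-- `P_s(σ₁ = n + 1, Y₁ = z)` for `s` aggregated to `y`. -/
def flow (y z : S) (n : ℕ) (s : S) : ℝ :=
  ∑ u, (hop p (L.cell i y) (L.cell i y) ^ n * hop p (L.cell i y) (L.cell i z)) s u

end Matrices

/-! ### Laws of the first jumps -/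

section Laws

open Classical

variable {S : Type*} [Fintype S] {L : Landscape S} {i : ℕ} {p : S → S → ℝ}
  {Ω : Type*} [MeasurableSpace Ω] {P : S → Measure Ω} {X : ℕ → Ω → S}

lemma past_jumpTime (n T : ℕ) : Past X T {ω | L.jumpTime i (fun k => X k ω) n = T} :=
  fun _ _ h h1 => jumpTime_congr h h1

lemma measurableSet_jumpTime (hX : ∀ k s, MeasurableSet {ω | X k ω = s}) (n T : ℕ) :
    MeasurableSet {ω | L.jumpTime i (fun k => X k ω) n = T} :=
  (past_jumpTime n T).measurableSet hX

lemma measurableSet_ac (hX : ∀ k s, MeasurableSet {ω | X k ω = s}) (T : ℕ) (z : S) :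
    MeasurableSet {ω | L.ac i (fun k => X k ω) T = z} :=
  Past.measurableSet (n := T) hX fun ω ω' h h1 => by
    rw [Set.mem_ofPred_eq] at h1 ⊢
    rw [← h1, ac, ac, h T le_rfl]

/-- Joint law of the chain at the `K`-th entrance, and of the labels and jump times before. -/
lemma real_entered {x : S} (hμ : IsMarkovChain (P x) X p x) (z : ℕ → S) (t : ℕ → ℕ)
    (h0 : t 0 = 0) (K : ℕ) (ht : ∀ k < K, t k < t (k + 1)) (hz : ∀ k < K, z (k + 1) ≠ z k) :
    (P x).real {ω | L.Entered i z t K (fun k => X k ω)} =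
      ∑ u, L.entranceMat i p z t K x u := by
  obtain ⟨W, h1, -, h3⟩ := exists_labels (L := L) (i := i) (p := p) z t h0 K ht hz
  simp_rw [h1]
  rw [← h3]
  exact hμ.real_path_sum (fun l => L.cell i (W l)) (t K)

variable (hX : ∀ x, IsMarkovChain (P x) X p x)
include hX

lemma real_first_jump {s y z : S} (hs : L.aggregate i s = y) (hyz : z ≠ y) (n : ℕ) :
    (P s).real {ω | L.jumpTime i (fun k => X k ω) 1 = (n + 1 : ℕ) ∧
      L.aac i (fun k => X k ω) 1 = z} = L.flow i p y z n s := by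
  have := (hX s).isProbabilityMeasure
  let B : ℕ → Set S := fun l => if l ≤ n then L.cell i y else L.cell i z
  have hB1 : ∀ l ≤ n, B l = L.cell i y := fun l hl => if_pos hl
  have hB2 : B (n + 1) = L.cell i z := if_neg (by omega)
  have h1 : (P s).real {ω | L.jumpTime i (fun k => X k ω) 1 = (n + 1 : ℕ) ∧
      L.aac i (fun k => X k ω) 1 = z} = (P s).real {ω | ∀ l ≤ n + 1, X l ω ∈ B l} := by
    refine measureReal_congr ?_
    filter_upwards [(hX s).start] with ω hω
    refine propext ?_
    have hac : L.ac i (fun k => X k ω) 0 = y := by rw [ac, hω, hs]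
    have hiff := jumpTime_succ_eq_iff (L := L) (i := i) (x := fun k => X k ω) (n := 0) (T := 0)
      (T' := n + 1) jumpTime_zero
    rw [hac] at hiff
    constructor
    · rintro ⟨h2, h3⟩ l hl
      rw [aac_eq h2] at h3
      rcases hl.eq_or_lt with rfl | hl
      · rw [hB2]; exact h3
      · rw [hB1 l (by omega)]; exact (hiff.1 h2).2.1 l (Nat.zero_le l) hl
    · intro h
      have hz : L.ac i (fun k => X k ω) (n + 1) = z := by
        have := h (n + 1) le_rfl
        rwa [hB2] at this
      have h2 := hiff.2 ⟨by omega, fun l _ hl => ?_, by rw [hz]; exact hyz⟩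
      · exact ⟨h2, (aac_eq h2).trans hz⟩
      · have := h l hl.le
        rwa [hB1 l (by omega)] at this
  rw [h1, (hX s).real_path_sum]
  have h4 : pathMat p B (0 + n + 1) = pathMat p B 0 * (hop p (L.cell i y) (L.cell i y) ^ n *
      hop p (L.cell i y) (L.cell i z)) :=
    pathMat_jump (fun k _ hk => hB1 k (by omega)) (by rw [zero_add, hB2])
  rw [zero_add] at h4
  rw [h4]
  refine Finset.sum_congr rfl fun u _ => ?_
  rw [Matrix.mul_apply, Finset.sum_eq_single s]
  · rw [pathMat, Matrix.of_apply, if_pos ⟨rfl, by rw [hB1 0 (by omega)]; exact hs⟩, one_mul]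
  · intro v _ hv
    rw [pathMat, Matrix.of_apply, if_neg fun h => hv h.1.symm, zero_mul]
  · simp

omit hX in
lemma firstJumpTo_eq_iUnion (z : S) : {ω | (fun k => X k ω) ∈ L.firstJumpTo i z} =
    ⋃ n : ℕ, {ω | L.jumpTime i (fun k => X k ω) 1 = (n + 1 : ℕ) ∧
      L.aac i (fun k => X k ω) 1 = z} := by
  ext ω
  simp only [firstJumpTo, Set.mem_ofPred_eq, Set.mem_iUnion]
  constructor
  · rintro ⟨h1, h2⟩
    obtain ⟨T, hT⟩ := ENat.ne_top_iff_exists.1 (ne_top_of_lt h1)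
    obtain ⟨T₀, -, h3⟩ := jumpTime_lt_of_succ_eq hT.symm
    obtain ⟨n, rfl⟩ : ∃ n, T = n + 1 := ⟨T - 1, by omega⟩
    exact ⟨n, hT.symm, h2⟩
  · rintro ⟨n, h1, h2⟩
    exact ⟨by rw [h1]; exact ENat.natCast_lt_top _, h2⟩

lemma measurableSet_first_jump (s z : S) (n : ℕ) :
    MeasurableSet {ω | L.jumpTime i (fun k => X k ω) 1 = (n + 1 : ℕ) ∧
      L.aac i (fun k => X k ω) 1 = z} := by
  have h : {ω | L.jumpTime i (fun k => X k ω) 1 = (n + 1 : ℕ) ∧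
      L.aac i (fun k => X k ω) 1 = z} = {ω | L.jumpTime i (fun k => X k ω) 1 = (n + 1 : ℕ)} ∩
      {ω | L.ac i (fun k => X k ω) (n + 1) = z} := by
    ext ω
    refine and_congr_right fun h => ?_
    rw [aac_eq h]
    rfl
  rw [h]
  exact (measurableSet_jumpTime (hX s).measurableSet 1 (n + 1)).inter
    (measurableSet_ac (hX s).measurableSet (n + 1) z)

lemma measurableSet_firstJumpTo (s z : S) :
    MeasurableSet {ω | (fun k => X k ω) ∈ L.firstJumpTo i z} := by
  rw [firstJumpTo_eq_iUnion]
  exact MeasurableSet.iUnion fun n => measurableSet_first_jump hX s z n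

lemma hasSum_flow {s y z : S} (hs : L.aggregate i s = y) (hyz : z ≠ y) :
    HasSum (fun n => L.flow i p y z n s)
      ((P s).real {ω | (fun k => X k ω) ∈ L.firstJumpTo i z}) := by
  have := (hX s).isProbabilityMeasure
  rw [firstJumpTo_eq_iUnion]
  simp_rw [← real_first_jump hX hs hyz]
  refine hasSum_measureReal (P s) ?_ fun n => measurableSet_first_jump hX s z n
  intro n m hnm
  refine Set.disjoint_left.2 fun ω h1 h2 => hnm ?_
  have : ((n + 1 : ℕ) : ℕ∞) = (m + 1 : ℕ) := h1.1.symm.trans h2.1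
  have : n + 1 = m + 1 := by exact_mod_cast this
  omega

/-- Joint law of the first two jumps and of the first entrance state. -/
lemma real_second_jump {x y z : S} (hx : L.aggregate i x = x) (hxy : y ≠ x) (hyz : z ≠ y) (n m : ℕ)
    {s : S} (hs : L.aggregate i s = y) :
    (P x).real {ω | L.jumpTime i (fun k => X k ω) 1 = (n + 1 : ℕ) ∧
      L.jumpTime i (fun k => X k ω) 2 = (n + m + 2 : ℕ) ∧ L.aac i (fun k => X k ω) 1 = y ∧
      L.aac i (fun k => X k ω) 2 = z ∧ X (n + 1) ω = s} =
    (hop p (L.cell i x) (L.cell i x) ^ n * hop p (L.cell i x) (L.cell i y)) x s *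
      L.flow i p y z m s := by
  have := (hX x).isProbabilityMeasure
  let D : ℕ → Set S := fun l => if l ≤ m then L.cell i y else L.cell i z
  have hD1 : ∀ l ≤ m, D l = L.cell i y := fun l hl => if_pos hl
  have hD2 : D (m + 1) = L.cell i z := if_neg (by omega)
  let B : ℕ → Set S := fun l => if l ≤ n then L.cell i x else L.cell i y
  have hB1 : ∀ l ≤ n, B l = L.cell i x := fun l hl => if_pos hl
  have hB2 : B (n + 1) = L.cell i y := if_neg (by omega)
  have h4 : pathMat p B (0 + n + 1) = pathMat p B 0 * (hop p (L.cell i x) (L.cell i x) ^ n *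
      hop p (L.cell i x) (L.cell i y)) :=
    pathMat_jump (fun k _ hk => hB1 k (by omega)) (by rw [zero_add, hB2])
  have h5 : pathMat p D (0 + m + 1) = pathMat p D 0 * (hop p (L.cell i y) (L.cell i y) ^ m *
      hop p (L.cell i y) (L.cell i z)) :=
    pathMat_jump (fun k _ hk => hD1 k (by omega)) (by rw [zero_add, hD2])
  rw [zero_add] at h4 h5
  have hone : ∀ (D : ℕ → Set S) (M : Matrix S S ℝ) (s u : S), s ∈ D 0 →
      (pathMat p D 0 * M) s u = M s u := by
    intro D M s u hsD
    rw [Matrix.mul_apply, Finset.sum_eq_single s]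
    · rw [pathMat, Matrix.of_apply, if_pos ⟨rfl, hsD⟩, one_mul]
    · intro v _ hv
      rw [pathMat, Matrix.of_apply, if_neg fun h => hv h.1.symm, zero_mul]
    · simp
  have hx0 : x ∈ B 0 := by rw [hB1 0 (by omega)]; exact hx
  have hs0 : s ∈ D 0 := by rw [hD1 0 (by omega)]; exact hs
  -- The Markov property at the entrance time `n + 1` separates the stay in `x` from the stay in `y`
  -- begun at the entrance state `s`.
  have hmain : (P x).real ({ω | ∀ k ≤ n + 1, X k ω ∈ B k} ∩ {ω | X (n + 1) ω = s} ∩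
      {ω | ∀ k ≤ m + 1, X (n + 1 + k) ω ∈ D k}) =
      (hop p (L.cell i x) (L.cell i x) ^ n * hop p (L.cell i x) (L.cell i y)) x s *
      L.flow i p y z m s := by
    have hpast : Past X (n + 1 + (m + 1)) ({ω | ∀ k ≤ n + 1, X k ω ∈ B k} ∩
        {ω | X (n + 1) ω = s} ∩ {ω | ∀ k ≤ m + 1, X (n + 1 + k) ω ∈ D k}) := by
      rintro ω ω' h ⟨⟨h1, h2⟩, h3⟩
      refine ⟨⟨fun k hk => h k (by omega) ▸ h1 k hk, ?_⟩, fun k hk => h (n + 1 + k) (by omega) ▸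
        h3 k hk⟩
      rw [Set.mem_ofPred_eq, ← h (n + 1) (by omega)]
      exact h2
    rw [measureReal_eq_sum (P x) (X (n + 1 + (m + 1))) ((hX x).measurableSet _)
      (hpast.measurableSet (hX x).measurableSet), flow, Finset.mul_sum]
    refine Finset.sum_congr rfl fun u _ => ?_
    rw [Set.inter_assoc, ← hone D (_ * _) s u hs0, ← h5, ← hone B (_ * _) x s hx0, ← h4,
      ← (hX x).real_path B (n + 1) s]
    exact (hX x).markov (past_path B (n + 1)) D (m + 1) s u
  rw [← hmain]
  refine measureReal_congr ?_
  filter_upwards [(hX x).start] with ω hω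
  refine propext ?_
  have hac : L.ac i (fun k => X k ω) 0 = x := by rw [ac, hω, hx]
  have hiff := jumpTime_succ_eq_iff (L := L) (i := i) (x := fun k => X k ω) (n := 0) (T := 0)
    (T' := n + 1) jumpTime_zero
  rw [hac] at hiff
  constructor
  · rintro ⟨h1, h2, h3, h3', h3''⟩
    rw [aac_eq h1] at h3
    rw [aac_eq h2] at h3'
    have h6 := (jumpTime_succ_eq_iff h1).1 h2
    refine ⟨⟨fun l hl => ?_, h3''⟩, fun l hl => ?_⟩
    · rcases hl.eq_or_lt with rfl | hl
      · rw [hB2]; exact h3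
      · rw [hB1 l (by omega)]; exact (hiff.1 h1).2.1 l (Nat.zero_le l) hl
    · rcases hl.eq_or_lt with rfl | hl
      · rw [hD2, show n + 1 + (m + 1) = n + m + 2 by omega]; exact h3'
      · rw [hD1 l (by omega)]
        exact (h6.2.1 (n + 1 + l) (by omega) (by omega)).trans h3
  · rintro ⟨⟨h1, h2⟩, h3⟩
    have hy : L.ac i (fun k => X k ω) (n + 1) = y := by
      have := h1 (n + 1) le_rfl
      rwa [hB2] at this
    have h6 := hiff.2 ⟨by omega, fun l _ hl => by
      have := h1 l hl.le
      rwa [hB1 l (by omega)] at this, by rw [hy]; exact hxy⟩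
    have hz : L.ac i (fun k => X k ω) (n + m + 2) = z := by
      have := h3 (m + 1) le_rfl
      rwa [hD2, show n + 1 + (m + 1) = n + m + 2 by omega] at this
    have h7 := (jumpTime_succ_eq_iff (T' := n + m + 2) h6).2 ⟨by omega, fun l hl hl' => by
      have := h3 (l - (n + 1)) (by omega)
      rw [hD1 _ (by omega), show n + 1 + (l - (n + 1)) = l by omega] at this
      exact (show L.ac i (fun k => X k ω) l = y from this).trans hy.symm,
      by rw [hz, hy]; exact hyz⟩
    exact ⟨h6, h7, (aac_eq h6).trans hy, (aac_eq h7).trans hz, h2⟩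

end Laws

end Landscape

open Classical in
lemma hop_pow_singleton {S : Type*} [Fintype S] (p : S → S → ℝ) (x u : S) (n : ℕ) :
    (hop p {x} {x} ^ n) x u = if u = x then p x x ^ n else 0 := by
  split_ifs with h
  · subst h
    induction n with
    | zero => simp
    | succ n ih =>
      rw [pow_succ, Matrix.mul_apply, Finset.sum_eq_single u, ih,
        hop_of_mem (Set.mem_singleton u) (Set.mem_singleton u), pow_succ]
      · intro v _ hv
        rw [hop_eq_zero_left (show v ∉ ({u} : Set S) from hv), mul_zero]
      · simp
  · exact hop_pow_eq_zero (Set.mem_singleton x) (show u ∉ ({x} : Set S) from h) n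

/-! ### The conditional laws entering the holding times -/

namespace LowTempChain

section Laws

open Classical

variable {S : Type*} [Fintype S] {C : LowTempChain S} {i : ℕ}
  {Ω : Type*} [MeasurableSpace Ω] {P : S → Measure Ω} {X : ℕ → Ω → S} {β : ℝ}

lemma cell_eq_block (hi : 1 ≤ i) {r : S} (hr : r ∈ C.metastates i) :
    C.cell i r = C.block i r := by
  ext x
  exact Landscape.aggregate_eq_iff hi hr

lemma cell_of_mem_nonAssigned (hi : 1 ≤ i) {r : S} (hr : r ∈ C.nonAssigned i) :
    C.cell i r = {r} := by
  rw [cell_eq_block hi (Or.inr hr), Landscape.block_of_mem_nonAssigned hi hr]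

lemma flow_nonneg (hβ : 0 < β) (y z : S) (n : ℕ) (s : S) : 0 ≤ C.flow i (C.p β) y z n s := by
  refine Finset.sum_nonneg fun u _ => ?_
  rw [Matrix.mul_apply]
  exact Finset.sum_nonneg fun v _ => mul_nonneg (hop_pow_nonneg (C.p_nonneg β hβ) n s v)
    (hop_nonneg (C.p_nonneg β hβ) v u)

lemma p_eq_zero (hβ : 0 < β) {r s : S} (hne : r ≠ s) (h : ¬ C.graph.Adj r s) : C.p β r s = 0 :=
  le_antisymm (not_lt.1 fun h' => h ((C.p_pos_iff β hβ r s hne).1 h')) (C.p_nonneg β hβ r s)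

lemma p_self_lt_one (hβ : 0 < β) {r s : S} (h : C.graph.Adj r s) : C.p β r r < 1 := by
  have h1 := C.p_sum β hβ r
  have h2 : C.p β r r + C.p β r s ≤ ∑ u, C.p β r u := by
    rw [← Finset.sum_pair h.ne]
    exact Finset.sum_le_sum_of_subset_of_nonneg (Finset.subset_univ _)
      fun u _ _ => C.p_nonneg β hβ r u
  have := (C.p_pos_iff β hβ r s h.ne).2 h
  linarith

variable (C) in
/-- `P_s(Y₁ = z)`. -/
def hit (P : S → Measure Ω) (X : ℕ → Ω → S) (i : ℕ) (z s : S) : ℝ :=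
  (P s).real {ω | (fun k => X k ω) ∈ C.firstJumpTo i z}

variable (hX : ∀ x, IsMarkovChain (P x) X (C.p β) x)
include hX

lemma exitLaw_eq {s y z : S} (hs : C.aggregate i s = y) (hyz : z ≠ y) (n : ℕ) :
    C.exitLaw P X i s z (n + 1) = C.flow i (C.p β) y z n s / C.hit P X i z s := by
  rw [exitLaw, cond_real _ (Landscape.measurableSet_firstJumpTo hX s z), hit,
    ← Landscape.real_first_jump hX hs hyz]
  congr 2
  ext ω
  simp only [Landscape.firstJumpTo, Set.mem_inter_iff, Set.mem_ofPred_eq]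
  constructor
  · exact fun h => ⟨h.2, h.1.2⟩
  · exact fun h => ⟨⟨by rw [h.1]; exact ENat.natCast_lt_top _, h.2⟩, h.1⟩

/-- Joint law of the first two jumps and the first entrance state, when the start is
non-assigned. -/
lemma real_firstJumpsTo_inter (hi : 1 ≤ i) (hβ : 0 < β) {x y z : S} (hx : x ∈ C.nonAssigned i)
    (hxy : y ≠ x) (hyz : z ≠ y) (s : S) :
    (P x).real ({ω | (fun k => X k ω) ∈ C.firstJumpsTo i y z} ∩
      {ω | X (C.jumpTime i (fun k => X k ω) 1).toNat ω = s}) =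
    if s ∈ C.cell i y then C.p β x s / (1 - C.p β x x) * C.hit P X i z s else 0 := by
  have := (hX x).isProbabilityMeasure
  have hxx : C.aggregate i x = x := Landscape.aggregate_self hi (Or.inr hx)
  split_ifs with hs
  · let G : ℕ × ℕ → Set Ω := fun q => {ω | C.jumpTime i (fun k => X k ω) 1 = (q.1 + 1 : ℕ) ∧
      C.jumpTime i (fun k => X k ω) 2 = (q.1 + q.2 + 2 : ℕ) ∧ C.aac i (fun k => X k ω) 1 = y ∧
      C.aac i (fun k => X k ω) 2 = z ∧ X (q.1 + 1) ω = s}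
    have hG : {ω | (fun k => X k ω) ∈ C.firstJumpsTo i y z} ∩
        {ω | X (C.jumpTime i (fun k => X k ω) 1).toNat ω = s} = ⋃ q, G q := by
      ext ω
      simp only [Set.mem_inter_iff, Set.mem_ofPred_eq, Set.mem_iUnion, Landscape.firstJumpsTo, G]
      constructor
      · rintro ⟨⟨h1, h2, h3⟩, h4⟩
        obtain ⟨T, hT⟩ := ENat.ne_top_iff_exists.1 (ne_top_of_lt h1)
        obtain ⟨T₁, hT₁, hlt⟩ := Landscape.jumpTime_lt_of_succ_eq hT.symm
        obtain ⟨T₀, -, hlt'⟩ := Landscape.jumpTime_lt_of_succ_eq hT₁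
        refine ⟨(T₁ - 1, T - T₁ - 1), ?_, ?_, h2, h3, ?_⟩
        · rw [hT₁, show T₁ - 1 + 1 = T₁ by omega]
        · rw [← hT, show T₁ - 1 + (T - T₁ - 1) + 2 = T by omega]
        · rw [hT₁, ENat.toNat_natCast] at h4
          rw [show T₁ - 1 + 1 = T₁ by omega, h4]
      · rintro ⟨q, h1, h2, h3, h4, h5⟩
        refine ⟨⟨by rw [h2]; exact ENat.natCast_lt_top _, h3, h4⟩, ?_⟩
        rw [h1, ENat.toNat_natCast, h5]
    have hd : Pairwise (Function.onFun Disjoint G) := by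
      intro q q' hq
      refine Set.disjoint_left.2 fun ω h1 h2 => hq ?_
      have h3 : ((q.1 + 1 : ℕ) : ℕ∞) = (q'.1 + 1 : ℕ) := h1.1.symm.trans h2.1
      have h4 : ((q.1 + q.2 + 2 : ℕ) : ℕ∞) = (q'.1 + q'.2 + 2 : ℕ) := h1.2.1.symm.trans h2.2.1
      have h3 : q.1 + 1 = q'.1 + 1 := by exact_mod_cast h3
      have h4 : q.1 + q.2 + 2 = q'.1 + q'.2 + 2 := by exact_mod_cast h4
      exact Prod.ext (by omega) (by omega)
    have hm : ∀ q, MeasurableSet (G q) := by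
      intro q
      refine Past.measurableSet (n := q.1 + q.2 + 2) (hX x).measurableSet ?_
      rintro ω ω' h ⟨h1, h2, h3, h4, h5⟩
      have h1' := Landscape.jumpTime_congr (x' := fun k => X k ω') (fun k hk => h k (by omega)) h1
      have h2' := Landscape.jumpTime_congr (x' := fun k => X k ω') (fun k hk => h k hk) h2
      refine ⟨h1', h2', ?_, ?_, by rw [← h _ (by omega), h5]⟩
      · rw [← h3, Landscape.aac_eq h1, Landscape.aac_eq h1', Landscape.ac, Landscape.ac,
          h _ (by omega)]
      · rw [← h4, Landscape.aac_eq h2, Landscape.aac_eq h2', Landscape.ac, Landscape.ac,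
          h _ le_rfl]
    have hval : ∀ q, (P x).real (G q) =
        (C.p β x x ^ q.1 * C.p β x s) * C.flow i (C.p β) y z q.2 s := by
      intro q
      rw [Landscape.real_second_jump hX hxx hxy hyz q.1 q.2 hs, cell_of_mem_nonAssigned hi hx,
        Matrix.mul_apply, Finset.sum_eq_single x, hop_pow_singleton, if_pos rfl,
        hop_of_mem (Set.mem_singleton x) hs]
      · intro v _ hv
        rw [hop_pow_singleton, if_neg hv, zero_mul]
      · simp
    obtain ⟨v, hv, -⟩ := Landscape.exists_adj_energy_lt hi hx
    have hlt := p_self_lt_one hβ hv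
    -- Summing over the length of the stay in the single state `x` is a geometric series; the sum
    -- over the stay in `y` is the probability of going to `z` next from `s`.
    have h1 : HasSum (fun n => C.p β x x ^ n * C.p β x s) (C.p β x s / (1 - C.p β x x)) := by
      rw [div_eq_inv_mul]
      exact (hasSum_geometric_of_lt_one (C.p_nonneg β hβ x x) hlt).mul_right _
    have h2 := Landscape.hasSum_flow hX hs hyz
    have h3 := h1.mul h2 (h1.summable.mul_of_nonneg h2.summable
      (fun n => mul_nonneg (pow_nonneg (C.p_nonneg β hβ x x) n) (C.p_nonneg β hβ x s))
      (fun n => flow_nonneg hβ y z n s))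
    rw [hG]
    have h4 := hasSum_measureReal (P x) hd hm
    simp_rw [hval] at h4
    exact h4.unique h3
  -- On the event, the label of the entrance state is `y`, so other values of `s` are impossible.
  · rw [← measureReal_empty (μ := P x)]
    congr 1
    ext ω
    simp only [Set.mem_inter_iff, Set.mem_ofPred_eq, Set.mem_empty_iff_false, iff_false,
      Landscape.firstJumpsTo]
    rintro ⟨⟨-, h1, -⟩, h2⟩
    refine hs ?_
    rw [← h2]
    exact h1

omit hX in
lemma firstJumpsTo_eq_iUnion (y z : S) : {ω | (fun k => X k ω) ∈ C.firstJumpsTo i y z} =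
    ⋃ q : ℕ × ℕ, {ω | C.jumpTime i (fun k => X k ω) 1 = q.1 ∧
      C.jumpTime i (fun k => X k ω) 2 = q.2 ∧ C.aac i (fun k => X k ω) 1 = y ∧
      C.aac i (fun k => X k ω) 2 = z} := by
  ext ω
  simp only [Set.mem_ofPred_eq, Set.mem_iUnion, Landscape.firstJumpsTo]
  constructor
  · rintro ⟨h1, h2, h3⟩
    obtain ⟨T, hT⟩ := ENat.ne_top_iff_exists.1 (ne_top_of_lt h1)
    obtain ⟨T₁, hT₁, -⟩ := Landscape.jumpTime_lt_of_succ_eq hT.symm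
    exact ⟨(T₁, T), hT₁, hT.symm, h2, h3⟩
  · rintro ⟨q, h1, h2, h3⟩
    exact ⟨by rw [h2]; exact ENat.natCast_lt_top _, h3⟩

lemma measurableSet_firstJumpsTo (x y z : S) :
    MeasurableSet {ω | (fun k => X k ω) ∈ C.firstJumpsTo i y z} := by
  rw [firstJumpsTo_eq_iUnion]
  refine MeasurableSet.iUnion fun q => ?_
  refine Past.measurableSet (n := max q.1 q.2) (hX x).measurableSet ?_
  rintro ω ω' h ⟨h1, h2, h3, h4⟩
  have h1' := Landscape.jumpTime_congr (x' := fun k => X k ω')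
    (fun k hk => h k (hk.trans (le_max_left _ _))) h1
  have h2' := Landscape.jumpTime_congr (x' := fun k => X k ω')
    (fun k hk => h k (hk.trans (le_max_right _ _))) h2
  refine ⟨h1', h2', ?_, ?_⟩
  · rw [← h3, Landscape.aac_eq h1, Landscape.aac_eq h1', Landscape.ac, Landscape.ac,
      h _ (le_max_left _ _)]
  · rw [← h4, Landscape.aac_eq h2, Landscape.aac_eq h2', Landscape.ac, Landscape.ac,
      h _ (le_max_right _ _)]

omit hX in
variable (C) in
/-- `P_x(Y₁ = y, Y₂ = z)`, decomposed according to the entrance state. -/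
def doubleHit (β : ℝ) (P : S → Measure Ω) (X : ℕ → Ω → S) (i : ℕ) (x y z : S) : ℝ :=
  ∑ s, if s ∈ C.cell i y then C.p β x s / (1 - C.p β x x) * C.hit P X i z s else 0

lemma entranceLaw_eq (hi : 1 ≤ i) (hβ : 0 < β) {x y z : S} (hx : x ∈ C.nonAssigned i)
    (hxy : y ≠ x) (hyz : z ≠ y) {s : S} (hs : s ∈ C.cell i y) :
    C.entranceLaw P X i x y z s =
      C.p β x s / (1 - C.p β x x) * C.hit P X i z s / C.doubleHit β P X i x y z := by
  have := (hX x).isProbabilityMeasure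
  have hm := measurableSet_firstJumpsTo (i := i) hX x y z
  rw [entranceLaw, cond_real _ hm, real_firstJumpsTo_inter hX hi hβ hx hxy hyz, if_pos hs]
  congr 1
  rw [measureReal_eq_sum (P x) (fun ω => X (C.jumpTime i (fun k => X k ω) 1).toNat ω) _ hm]
  · exact Finset.sum_congr rfl fun s _ => real_firstJumpsTo_inter hX hi hβ hx hxy hyz s
  · intro v
    -- When there is no first jump, `toNat` gives time zero; this part of the event has to be
    -- measured separately.
    have h : {ω | X (C.jumpTime i (fun k => X k ω) 1).toNat ω = v} =
        (⋃ T : ℕ, {ω | C.jumpTime i (fun k => X k ω) 1 = T} ∩ {ω | X T ω = v}) ∪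
        ((⋃ T : ℕ, {ω | C.jumpTime i (fun k => X k ω) 1 = T})ᶜ ∩ {ω | X 0 ω = v}) := by
      ext ω
      simp only [Set.mem_union, Set.mem_iUnion, Set.mem_inter_iff, Set.mem_compl_iff,
        Set.mem_ofPred_eq, not_exists]
      by_cases htop : C.jumpTime i (fun k => X k ω) 1 = ⊤
      · simp [htop]
      · obtain ⟨T, hT⟩ := ENat.ne_top_iff_exists.1 htop
        rw [← hT]
        constructor
        · exact fun h => Or.inl ⟨T, rfl, h⟩
        · rintro (⟨T', h1, h2⟩ | ⟨h1, -⟩)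
          · obtain rfl : T = T' := by exact_mod_cast h1
            exact h2
          · exact absurd rfl (h1 T)
    rw [h]
    refine (MeasurableSet.iUnion fun T => ?_).union (MeasurableSet.inter
      (MeasurableSet.iUnion fun T => ?_).compl ((hX x).measurableSet 0 v))
    · exact (Landscape.measurableSet_jumpTime (hX x).measurableSet 1 T).inter
        ((hX x).measurableSet T v)
    · exact Landscape.measurableSet_jumpTime (hX x).measurableSet 1 T

end Laws

/-! ### Limits of one-step, stay and hitting probabilities -/

section Asymptotics

open Classical

variable {S : Type*} [Fintype S] {C : LowTempChain S} {i : ℕ}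

lemma pLim_nonneg (r s : S) : 0 ≤ C.pLim r s :=
  ge_of_tendsto (C.p_tendsto r s) ((eventually_gt_atTop 0).mono fun β hβ => C.p_nonneg β hβ r s)

lemma pLim_eq_zero {r s : S} (hne : r ≠ s) (h : ¬ C.graph.Adj r s) : C.pLim r s = 0 :=
  tendsto_nhds_unique_of_eventuallyEq (C.p_tendsto r s) tendsto_const_nhds
    ((eventually_gt_atTop 0).mono fun _ hβ => p_eq_zero hβ hne h)

lemma pLim_sum (r : S) : ∑ s, C.pLim r s = 1 :=
  tendsto_nhds_unique_of_eventuallyEq (tendsto_finsetSum _ fun s _ => C.p_tendsto r s)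
    tendsto_const_nhds ((eventually_gt_atTop 0).mono fun β hβ => C.p_sum β hβ r)

lemma pLim_self_lt_one (hi : 1 ≤ i) {r : S} (hr : r ∈ C.nonAssigned i) : C.pLim r r < 1 := by
  obtain ⟨s, hs, hlt⟩ := Landscape.exists_adj_energy_lt hi hr
  have h1 := C.pLim_sum r
  have h2 : C.pLim r r + C.pLim r s ≤ ∑ u, C.pLim r u := by
    rw [← Finset.sum_pair hs.ne]
    exact Finset.sum_le_sum_of_subset_of_nonneg (Finset.subset_univ _)
      fun u _ _ => C.pLim_nonneg r u
  have := C.pLim_pos r s (Or.inr hs) hlt.le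
  linarith

/-- With `f = 1` this is the first jump from a non-assigned state; with `f` a hitting probability
tending to one, it is the first jump weighted by success of the second. -/
lemma tendsto_cell_sum_div (hi : 1 ≤ i) {r s : S} (hr : r ∈ C.nonAssigned i)
    (hs : s ∈ C.metastates i) (hne : s ≠ r) (f : ℝ → S → ℝ)
    (hf : ∀ u ∈ C.cell i s, Tendsto (fun β => f β u) atTop (𝓝 1)) :
    Tendsto (fun β => ∑ u, if u ∈ C.cell i s then C.p β r u / (1 - C.p β r r) * f β u else 0)
      atTop (𝓝 (C.jumpProb i r s)) := by
  rw [jumpProb, if_pos hr, if_pos hs, Finset.sum_div]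
  refine tendsto_finsetSum _ fun u _ => ?_
  by_cases hu : u ∈ C.cell i s
  · simp only [if_pos hu]
    have hur : r ≠ u := by
      rintro rfl
      exact hne (hu.symm.trans (Landscape.aggregate_self hi (Or.inr hr)))
    have hlim : (if C.graph.Adj r u ∧ u ∈ C.block i s then C.pLim r u else 0) = C.pLim r u := by
      by_cases hadj : C.graph.Adj r u
      · rw [if_pos ⟨hadj, by rwa [← cell_eq_block hi hs]⟩]
      · rw [if_neg fun h => hadj h.1, pLim_eq_zero hur hadj]
    rw [hlim]
    have h := ((C.p_tendsto r u).div ((C.p_tendsto r r).const_sub 1)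
      (sub_pos.2 (pLim_self_lt_one hi hr)).ne').mul (hf u hu)
    rwa [mul_one] at h
  · simp only [if_neg hu]
    rw [if_neg fun h => hu (by rw [cell_eq_block hi hs]; exact h.2), zero_div]
    exact tendsto_const_nhds

lemma isExitState_of_jumpProb_ne_zero {r s : S} (hr : r ∉ C.nonAssigned i)
    (h : C.jumpProb i r s ≠ 0) : C.IsExitState i r s ∧ C.jumpProb i r s = 1 := by
  rw [jumpProb, if_neg hr] at h ⊢
  split_ifs at h ⊢ with h1
  · exact ⟨h1, rfl⟩
  · exact absurd rfl h

lemma mem_nonAssigned_of_isExitState (hi : 1 ≤ i) {r s : S} (hr : r ∈ C.metastates i)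
    (hN : r ∉ C.nonAssigned i) (h : C.IsExitState i r s) : s ∈ C.nonAssigned i := by
  obtain ⟨⟨hs, x, hx, hxs⟩, -⟩ := h
  exact Landscape.mem_nonAssigned_of_adj_block hi hr hN hx hs hxs

lemma ne_of_jumpProb_ne_zero (hi : 1 ≤ i) {r s : S} (hr : r ∈ C.metastates i)
    (h : C.jumpProb i r s ≠ 0) : s ≠ r := by
  rintro rfl
  by_cases hN : s ∈ C.nonAssigned i
  · rw [jumpProb, if_pos hN, if_pos hr, Landscape.block_of_mem_nonAssigned hi hN] at h
    refine h ?_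
    rw [Finset.sum_eq_zero, zero_div]
    intro u _
    rw [if_neg]
    rintro ⟨h1, rfl⟩
    exact C.graph.irrefl h1
  · exact (isExitState_of_jumpProb_ne_zero hN h).1.1.1 (Landscape.mem_block_self hi hr)

/-- The cells partition the neighbors of `r`, whose limiting probabilities add up to `1 - p*(r,r)`.
-/
lemma sum_jumpProb (hi : 1 ≤ i) {r : S} (hr : r ∈ C.nonAssigned i) :
    ∑ s, C.jumpProb i r s = 1 := by
  have h1 : ∀ s, C.jumpProb i r s = (∑ u, if C.graph.Adj r u ∧ s = C.aggregate i u
      then C.pLim r u else 0) / (1 - C.pLim r r) := by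
    intro s
    rw [jumpProb, if_pos hr]
    by_cases hs : s ∈ C.metastates i
    · rw [if_pos hs, ← cell_eq_block hi hs]
      simp only [Landscape.cell, Set.mem_ofPred_eq, eq_comm (a := s)]
      congr!
    · rw [if_neg hs, Finset.sum_eq_zero, zero_div]
      intro u _
      rw [if_neg]
      rintro ⟨-, rfl⟩
      exact hs (Landscape.aggregate_spec hi u).1
  simp_rw [h1]
  have h2 : ∀ u, (∑ s, if C.graph.Adj r u ∧ s = C.aggregate i u then C.pLim r u else 0) =
      if C.graph.Adj r u then C.pLim r u else 0 := by
    intro u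
    by_cases h : C.graph.Adj r u <;> simp [h]
  have h3 : 1 - C.pLim r r = ∑ u ∈ Finset.univ.erase r, C.pLim r u := by
    rw [← C.pLim_sum r, ← Finset.add_sum_erase _ _ (Finset.mem_univ r), add_sub_cancel_left]
  rw [← Finset.sum_div, Finset.sum_comm, div_eq_one_iff_eq (sub_pos.2 (pLim_self_lt_one hi hr)).ne',
    h3]
  simp_rw [h2]
  rw [← Finset.add_sum_erase _ _ (Finset.mem_univ r), if_neg C.graph.irrefl, zero_add]
  refine Finset.sum_congr rfl fun u hu => ?_
  split_ifs with h
  · rfl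
  · exact (pLim_eq_zero (Finset.ne_of_mem_erase hu).symm h).symm

/-- Within finitely many steps, a valley is not left. -/
lemma tendsto_exit_zero (hi : 1 ≤ i) {r s : S} (hr : r ∈ C.metastates i)
    (hN : r ∉ C.nonAssigned i) (hs : s ∈ C.cell i r) (n : ℕ) :
    Tendsto (fun β => ∑ u, (hop (C.p β) (C.cell i r) (C.cell i r) ^ n *
      hop (C.p β) (C.cell i r) (C.cell i r)ᶜ) s u) atTop (𝓝 0) := by
  rw [cell_eq_block hi hr] at hs ⊢
  set V := C.block i r
  have h1 : ∀ z u, Tendsto (fun β => hop (C.p β) V Vᶜ z u) atTop (𝓝 0) := by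
    intro z u
    by_cases hz : z ∈ V
    swap
    · simp only [hop_eq_zero_left hz]; exact tendsto_const_nhds
    by_cases hu : u ∈ V
    · simp only [hop_eq_zero_right (show u ∉ Vᶜ from fun h => h hu)]; exact tendsto_const_nhds
    simp only [hop_of_mem hz (show u ∈ Vᶜ from hu)]
    have hne : z ≠ u := by rintro rfl; exact hu hz
    by_cases hadj : C.graph.Adj z u
    -- Every step out of a valley is uphill and has limiting probability zero.
    · rw [← C.pLim_zero z u (Landscape.energy_lt_of_adj_block hi hr hN hz hu hadj)]
      exact C.p_tendsto z u
    · rw [← pLim_eq_zero hne hadj]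
      exact C.p_tendsto z u
  have h2 : Tendsto (fun β => ∑ u, ∑ z, hop (C.p β) V Vᶜ z u) atTop (𝓝 0) := by
    simpa using tendsto_finsetSum Finset.univ fun u _ =>
      tendsto_finsetSum Finset.univ fun z _ => h1 z u
  refine tendsto_of_tendsto_of_tendsto_of_le_of_le' tendsto_const_nhds h2 ?_ ?_
  · filter_upwards [eventually_gt_atTop 0] with β hβ
    refine Finset.sum_nonneg fun u _ => ?_
    rw [Matrix.mul_apply]
    exact Finset.sum_nonneg fun z _ => mul_nonneg (hop_pow_nonneg (C.p_nonneg β hβ) n s z)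
      (hop_nonneg (C.p_nonneg β hβ) z u)
  · filter_upwards [eventually_gt_atTop 0] with β hβ
    refine Finset.sum_le_sum fun u _ => ?_
    rw [Matrix.mul_apply]
    refine Finset.sum_le_sum fun z _ => ?_
    refine mul_le_of_le_one_left (hop_nonneg (C.p_nonneg β hβ) z u) ?_
    have h3 := exit_add_survival (C.p_sum β hβ) hs n
    have h4 : 0 ≤ ∑ k ∈ Finset.range n, ∑ u, (hop (C.p β) V V ^ k * hop (C.p β) V Vᶜ) s u := by
      refine Finset.sum_nonneg fun k _ => Finset.sum_nonneg fun u _ => ?_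
      rw [Matrix.mul_apply]
      exact Finset.sum_nonneg fun z _ => mul_nonneg (hop_pow_nonneg (C.p_nonneg β hβ) k s z)
        (hop_nonneg (C.p_nonneg β hβ) z u)
    have h5 : (hop (C.p β) V V ^ n) s z ≤ ∑ u, (hop (C.p β) V V ^ n) s u :=
      Finset.single_le_sum (fun u _ => hop_pow_nonneg (C.p_nonneg β hβ) n s u)
        (Finset.mem_univ z)
    linarith

lemma tendsto_stay (hi : 1 ≤ i) {r s : S} (hr : r ∈ C.metastates i)
    (hN : r ∉ C.nonAssigned i) (hs : s ∈ C.cell i r) (n : ℕ) :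
    Tendsto (fun β => ∑ u, (hop (C.p β) (C.cell i r) (C.cell i r) ^ n) s u) atTop (𝓝 1) := by
  have h := tendsto_finsetSum (Finset.range n) fun k _ => tendsto_exit_zero hi hr hN hs k
  simp only [Finset.sum_const_zero] at h
  have h1 := h.const_sub 1
  rw [sub_zero] at h1
  refine h1.congr' ?_
  filter_upwards [eventually_gt_atTop 0] with β hβ
  have := exit_add_survival (C.p_sum β hβ) hs n
  linarith

/-- The flow is part of the exit mass. Prescribed holding times in a valley thus have vanishing
probability, which is why these weights must cancel exactly in the ratios and cannot be replaced by
their limits. -/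
lemma tendsto_flow_zero (hi : 1 ≤ i) {r s z : S} (hr : r ∈ C.metastates i)
    (hN : r ∉ C.nonAssigned i) (hs : s ∈ C.cell i r) (hz : z ≠ r) (n : ℕ) :
    Tendsto (fun β => C.flow i (C.p β) r z n s) atTop (𝓝 0) := by
  refine tendsto_of_tendsto_of_tendsto_of_le_of_le' tendsto_const_nhds
    (tendsto_exit_zero hi hr hN hs n) ?_ ?_
  · exact (eventually_gt_atTop 0).mono fun β hβ => flow_nonneg hβ r z n s
  · filter_upwards [eventually_gt_atTop 0] with β hβ
    refine Finset.sum_le_sum fun u _ => ?_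
    rw [Matrix.mul_apply, Matrix.mul_apply]
    refine Finset.sum_le_sum fun v _ => mul_le_mul_of_nonneg_left ?_
      (hop_pow_nonneg (C.p_nonneg β hβ) n s v)
    rw [hop_apply, hop_apply]
    by_cases h : v ∈ C.cell i r ∧ u ∈ C.cell i z
    · rw [if_pos h, if_pos ⟨h.1, fun hu => hz (h.2.symm.trans hu)⟩]
    · rw [if_neg h]
      split_ifs
      exacts [C.p_nonneg β hβ v u, le_rfl]

variable {Ω : Type*} [MeasurableSpace Ω] {P : ℝ → S → Measure Ω} {X : ℕ → Ω → S}

/-- From every state of a valley, the next metastate is the exit state with probability tending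
to one. -/
lemma tendsto_hit (hX : ∀ β > 0, ∀ x, IsMarkovChain (P β x) X (C.p β) x) (hi : 1 ≤ i) {r u s : S}
    (hr : r ∈ C.metastates i) (hN : r ∉ C.nonAssigned i) (hu : C.IsExitState i r u)
    (hs : s ∈ C.cell i r) : Tendsto (fun β => C.hit (P β) X i u s) atTop (𝓝 1) := by
  obtain ⟨b, hb, h⟩ := exit_at_exitState hi hr hN hu
  have huN := mem_nonAssigned_of_isExitState hi hr hN hu
  have hur : u ≠ r := by rintro rfl; exact hN huN
  have hb1 : Tendsto (fun β => 1 - b β) atTop (𝓝 1) := by simpa using hb.const_sub 1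
  refine tendsto_of_tendsto_of_tendsto_of_le_of_le' hb1 tendsto_const_nhds ?_ ?_
  · filter_upwards [eventually_gt_atTop 0, h] with β hβ h1
    refine le_of_forall_pos_sub_le fun η hη => ?_
    obtain ⟨n, hn⟩ := h1 s (by rwa [← cell_eq_block hi hr]) η hη
    refine hn.trans ?_
    have h2 := Landscape.hasSum_flow (hX β hβ) hs hur
    refine le_trans (le_of_eq ?_) (sum_le_hasSum (Finset.range n)
      (fun k _ => flow_nonneg hβ r u k s) h2)
    refine Finset.sum_congr rfl fun k _ => ?_
    -- The exit state is non-assigned, so its cell is `{u}`, and leaving the valley at `u` is the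
    -- same as jumping to the metastate `u`.
    rw [Landscape.flow, cell_of_mem_nonAssigned hi huN, cell_eq_block hi hr,
      Finset.sum_eq_single u]
    · intro v _ hv
      rw [Matrix.mul_apply]
      exact Finset.sum_eq_zero fun w _ => by
        rw [hop_eq_zero_right (show v ∉ ({u} : Set S) from hv), mul_zero]
    · simp
  · filter_upwards [eventually_gt_atTop 0] with β hβ
    have := (hX β hβ s).isProbabilityMeasure
    exact measureReal_le_one

end Asymptotics

/-! ### Comparing jump histories with the Markov renewal limit -/

section Ratio

open Classical

variable {S : Type*} [Fintype S] {C : LowTempChain S} {i : ℕ}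
  {Ω : Type*} [MeasurableSpace Ω] {P : ℝ → S → Measure Ω} {X : ℕ → Ω → S}

lemma sum_mul_apply (M N : Matrix S S ℝ) (x : S) :
    ∑ u, (M * N) x u = ∑ v, M x v * ∑ u, N v u := by
  simp_rw [Matrix.mul_apply, Finset.mul_sum]
  exact Finset.sum_comm

lemma hop_pow_mul_singleton (p : S → S → ℝ) (x : S) (V : Set S) (n : ℕ) (s : S) :
    (hop p {x} {x} ^ n * hop p {x} V) x s = p x x ^ n * if s ∈ V then p x s else 0 := by
  rw [Matrix.mul_apply, Finset.sum_eq_single x]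
  · rw [hop_pow_singleton, if_pos rfl, hop_apply]
    simp
  · intro v _ hv
    rw [hop_pow_singleton, if_neg hv, zero_mul]
  · simp

variable (C) in
/-- Probability that the accelerated aggregated chain follows `z` with jump times `t` up to the
`k`-th jump. -/
def chainWeight (i : ℕ) (z : ℕ → S) (t : ℕ → ℕ) (k : ℕ) (β : ℝ) : ℝ :=
  ∑ u, C.entranceMat i (C.p β) z t k (z 0) u

variable (C) in
/-- Probability that the Markov renewal limit follows `z` with jump times `t` up to the
`k`-th jump. -/
def limitWeight (P : ℝ → S → Measure Ω) (X : ℕ → Ω → S) (i : ℕ) (z : ℕ → S) (t : ℕ → ℕ) (k : ℕ)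
    (β : ℝ) : ℝ :=
  ∏ j ∈ Finset.range k, C.jumpProb i (z j) (z (j + 1)) *
    C.holdingLawAt β (P β) X i z j (t (j + 1) - t j)

variable {z : ℕ → S} {t : ℕ → ℕ} {k : ℕ} {β : ℝ}

lemma entranceMat_eq_zero {u : S} (hu : u ∉ C.cell i (z k)) (x : S) :
    C.entranceMat i (C.p β) z t k x u = 0 := by
  cases k with
  | zero => exact if_neg (by rintro ⟨rfl, h⟩; exact hu h)
  | succ k =>
    rw [Landscape.entranceMat, ← mul_assoc, Matrix.mul_apply]
    exact Finset.sum_eq_zero fun v _ => by rw [hop_eq_zero_right hu, mul_zero]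

/-- The renewal property: at a non-assigned label the chain is in one known state, so past and
future factorize. -/
lemma sum_entranceMat_mul (hi : 1 ≤ i) (hN : z k ∈ C.nonAssigned i) (M : Matrix S S ℝ) :
    ∑ u, (C.entranceMat i (C.p β) z t k * M) (z 0) u =
      C.chainWeight i z t k β * ∑ u, M (z k) u := by
  have h0 : ∀ v, v ≠ z k → C.entranceMat i (C.p β) z t k (z 0) v = 0 := fun v hv =>
    entranceMat_eq_zero (by rw [cell_of_mem_nonAssigned hi hN]; exact hv) _
  have h1 : C.chainWeight i z t k β = C.entranceMat i (C.p β) z t k (z 0) (z k) := by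
    rw [chainWeight, Finset.sum_eq_single (z k)]
    · exact fun v _ hv => h0 v hv
    · simp
  rw [sum_mul_apply, h1, Finset.sum_eq_single (z k)]
  · exact fun v _ hv => by rw [h0 v hv, zero_mul]
  · simp

lemma flow_of_nonAssigned (hi : 1 ≤ i) {x y : S} (hx : x ∈ C.nonAssigned i) (n : ℕ) :
    C.flow i (C.p β) x y n x = C.p β x x ^ n * ∑ s, if s ∈ C.cell i y then C.p β x s else 0 := by
  rw [Landscape.flow, cell_of_mem_nonAssigned hi hx, Finset.mul_sum]
  exact Finset.sum_congr rfl fun s _ => hop_pow_mul_singleton _ _ _ _ _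

lemma chainWeight_zero (hi : 1 ≤ i) (h0 : z 0 ∈ C.metastates i) : C.chainWeight i z t 0 β = 1 := by
  rw [chainWeight, Finset.sum_eq_single (z 0)]
  · exact if_pos ⟨rfl, Landscape.aggregate_self hi h0⟩
  · exact fun v _ hv => if_neg fun h => hv h.1.symm
  · simp

lemma chainWeight_one (hi : 1 ≤ i) (h0 : z 0 ∈ C.metastates i) :
    C.chainWeight i z t 1 β = C.flow i (C.p β) (z 0) (z 1) (t 1 - t 0 - 1) (z 0) := by
  rw [chainWeight, Landscape.entranceMat, sum_mul_apply, Finset.sum_eq_single (z 0)]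
  · rw [Landscape.entranceMat, Matrix.of_apply,
      if_pos ⟨rfl, Landscape.aggregate_self hi h0⟩, one_mul]
    rfl
  · intro v _ hv
    rw [Landscape.entranceMat, Matrix.of_apply, if_neg fun h => hv h.1.symm, zero_mul]
  · simp

lemma chainWeight_succ (hi : 1 ≤ i) (hN : z k ∈ C.nonAssigned i) :
    C.chainWeight i z t (k + 1) β = C.chainWeight i z t k β *
      (C.p β (z k) (z k) ^ (t (k + 1) - t k - 1) *
        ∑ s, if s ∈ C.cell i (z (k + 1)) then C.p β (z k) s else 0) := by
  rw [← flow_of_nonAssigned hi hN]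
  exact sum_entranceMat_mul hi hN _

/-- A valley may be entered at several states, so no factorization is available there. The jumps
into and out of it are kept together, starting from the last non-assigned state. -/
lemma chainWeight_add_two (hi : 1 ≤ i) (hN : z k ∈ C.nonAssigned i) :
    C.chainWeight i z t (k + 2) β = C.chainWeight i z t k β *
      (C.p β (z k) (z k) ^ (t (k + 1) - t k - 1) *
        ∑ s, if s ∈ C.cell i (z (k + 1)) then C.p β (z k) s *
          C.flow i (C.p β) (z (k + 1)) (z (k + 2)) (t (k + 2) - t (k + 1) - 1) s else 0) := by
  have h : C.chainWeight i z t (k + 2) β = ∑ u, (C.entranceMat i (C.p β) z t k *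
      ((hop (C.p β) (C.cell i (z k)) (C.cell i (z k)) ^ (t (k + 1) - t k - 1) *
        hop (C.p β) (C.cell i (z k)) (C.cell i (z (k + 1)))) *
      (hop (C.p β) (C.cell i (z (k + 1))) (C.cell i (z (k + 1))) ^ (t (k + 2) - t (k + 1) - 1) *
        hop (C.p β) (C.cell i (z (k + 1))) (C.cell i (z (k + 2)))))) (z 0) u := by
    rw [← mul_assoc]
    rfl
  rw [h, sum_entranceMat_mul hi hN, sum_mul_apply, cell_of_mem_nonAssigned hi hN]
  congr 1
  rw [Finset.mul_sum]
  refine Finset.sum_congr rfl fun s _ => ?_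
  rw [hop_pow_mul_singleton, mul_assoc]
  congr 1
  split_ifs
  · rfl
  · rw [zero_mul]

lemma limitWeight_succ : C.limitWeight P X i z t (k + 1) β = C.limitWeight P X i z t k β *
    (C.jumpProb i (z k) (z (k + 1)) * C.holdingLawAt β (P β) X i z k (t (k + 1) - t k)) := by
  rw [limitWeight, Finset.prod_range_succ]
  rfl

lemma holdingLawAt_of_nonAssigned (hN : z k ∈ C.nonAssigned i) (n : ℕ) (P : S → Measure Ω) :
    C.holdingLawAt β P X i z k (n + 1) = C.p β (z k) (z k) ^ n * (1 - C.p β (z k) (z k)) := by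
  cases k with
  | zero => simp [holdingLawAt, initialHoldingLaw, hN, geom]
  | succ k => simp [holdingLawAt, holdingLaw, hN, geom]

lemma div_tendsto_one {f g h : ℝ → ℝ} {c : ℝ} (hc : c ≠ 0) (hf : Tendsto f atTop (𝓝 1))
    (hg : Tendsto g atTop (𝓝 c)) (h1 : ∀ᶠ β in atTop, f β * (g β / c) = h β) :
    Tendsto h atTop (𝓝 1) := by
  have h2 := hf.mul (hg.div_const c)
  rw [div_self hc, one_mul] at h2
  exact h2.congr' h1

lemma tendsto_doubleHit (hX : ∀ β > 0, ∀ x, IsMarkovChain (P β x) X (C.p β) x) (hi : 1 ≤ i)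
    {x y u : S} (hx : x ∈ C.nonAssigned i) (hy : y ∈ C.metastates i) (hyN : y ∉ C.nonAssigned i)
    (hxy : y ≠ x) (hu : C.IsExitState i y u) :
    Tendsto (fun β => C.doubleHit β (P β) X i x y u) atTop (𝓝 (C.jumpProb i x y)) :=
  tendsto_cell_sum_div hi hx hy hxy (fun β s => C.hit (P β) X i u s)
    fun _ hs => tendsto_hit hX hi hy hyN hu hs

/-- The holding time law in a valley between two non-assigned states. -/
lemma holdingLaw_eq (hX : ∀ β > 0, ∀ x, IsMarkovChain (P β x) X (C.p β) x) (hi : 1 ≤ i)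
    {x y u : S} (hx : x ∈ C.nonAssigned i) (hy : y ∈ C.metastates i) (hyN : y ∉ C.nonAssigned i)
    (hxy : y ≠ x) (hu : C.IsExitState i y u) (n : ℕ) : ∀ᶠ β in atTop,
    C.holdingLaw β (P β) X i x y u (n + 1) =
      (∑ s, if s ∈ C.cell i y then C.p β x s * C.flow i (C.p β) y u n s else 0) /
        ((1 - C.p β x x) * C.doubleHit β (P β) X i x y u) := by
  have huy : u ≠ y := by
    rintro rfl
    exact hu.1.1 (Landscape.mem_block_self hi hy)
  -- The hitting probability is the denominator of the exit law and a factor of the entrance law. It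
  -- cancels once it is nonzero, which holds for large `β`.
  have hne : ∀ s, ∀ᶠ β in atTop, s ∈ C.cell i y → C.hit (P β) X i u s ≠ 0 := by
    intro s
    by_cases hs : s ∈ C.cell i y
    · exact ((tendsto_hit hX hi hy hyN hu hs).eventually_ne one_ne_zero).mono fun β h _ => h
    · exact Eventually.of_forall fun β h => absurd h hs
  filter_upwards [eventually_gt_atTop 0, eventually_all.2 hne] with β hβ h
  rw [holdingLaw, if_neg hyN, Finset.sum_div]
  refine Finset.sum_congr rfl fun s _ => ?_
  rw [← cell_eq_block hi hy]
  by_cases hs : s ∈ C.cell i y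
  swap
  · rw [if_neg fun h => hs h.1, if_neg hs, zero_div]
  rw [if_pos hs]
  by_cases hadj : C.graph.Adj x s
  · rw [if_pos ⟨hs, hadj⟩, exitLaw_eq (hX β hβ) hs huy,
      entranceLaw_eq (hX β hβ) hi hβ hx hxy huy hs]
    have := h s hs
    field_simp
  -- Entrance states not adjacent to `x` are omitted from the holding law, harmlessly, as `p(x,s) =
  -- 0` for them.
  · have hxs : x ≠ s := by
      rintro rfl
      exact hxy (hs.symm.trans (Landscape.aggregate_self hi (Or.inr hx)))
    rw [if_neg fun h => hadj h.2, p_eq_zero hβ hxs hadj, zero_mul, zero_div]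

/-- The accelerated aggregated chain and its jump times are asymptotically distributed as the
Markov renewal limit. -/
theorem tendsto_chainWeight_div (hX : ∀ β > 0, ∀ x, IsMarkovChain (P β x) X (C.p β) x)
    (hi : 1 ≤ i) (k : ℕ) (hz : ∀ j ≤ k, z j ∈ C.metastates i) (ht : ∀ j < k, t j < t (j + 1))
    (hD : ∀ᶠ β in atTop, C.limitWeight P X i z t k β ≠ 0) :
    Tendsto (fun β => C.chainWeight i z t k β / C.limitWeight P X i z t k β) atTop (𝓝 1) := by
  induction k using Nat.strong_induction_on with
  | _ k ih =>
    rcases k with _ | k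
    · simp only [chainWeight_zero hi (hz 0 le_rfl), limitWeight, Finset.range_zero,
        Finset.prod_empty, div_one]
      exact tendsto_const_nhds
    have hDk : ∀ᶠ β in atTop, C.limitWeight P X i z t k β ≠ 0 := by
      filter_upwards [hD] with β h h0
      rw [limitWeight_succ, h0, zero_mul] at h
      exact h rfl
    have hj : C.jumpProb i (z k) (z (k + 1)) ≠ 0 := by
      obtain ⟨β, h⟩ := hD.exists
      rw [limitWeight_succ] at h
      exact left_ne_zero_of_mul (right_ne_zero_of_mul h)
    have hne := ne_of_jumpProb_ne_zero hi (hz k (by omega)) hj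
    obtain ⟨d, hd⟩ : ∃ d, t (k + 1) - t k = d + 1 :=
      ⟨t (k + 1) - t k - 1, by have := ht k (by omega); omega⟩
    by_cases hN : z k ∈ C.nonAssigned i
    -- In a non-assigned state the geometric weights cancel, and the ratio acquires the one-step
    -- jump probability divided by `p̂`.
    · refine div_tendsto_one hj
        (ih k (by omega) (fun j hj => hz j (by omega)) (fun j hj => ht j (by omega)) hDk)
        (tendsto_cell_sum_div hi hN (hz (k + 1) le_rfl) hne (fun _ _ => 1)
          fun _ _ => tendsto_const_nhds) ?_
      obtain ⟨v, hv, -⟩ := Landscape.exists_adj_energy_lt hi hN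
      filter_upwards [eventually_gt_atTop 0, hDk] with β hβ h
      have h1 := sub_pos.2 (p_self_lt_one hβ hv)
      have h2 := C.p_diag β hβ (z k)
      have h3 : (∑ u, if u ∈ C.cell i (z (k + 1)) then
          C.p β (z k) u / (1 - C.p β (z k) (z k)) * 1 else 0) =
          (∑ s, if s ∈ C.cell i (z (k + 1)) then C.p β (z k) s else 0) /
            (1 - C.p β (z k) (z k)) := by
        rw [Finset.sum_div]
        refine Finset.sum_congr rfl fun s _ => ?_
        split_ifs
        · rw [mul_one]
        · rw [zero_div]
      rw [h3, limitWeight_succ, chainWeight_succ hi hN, hd, holdingLawAt_of_nonAssigned hN,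
        Nat.add_sub_cancel]
      field_simp
    obtain ⟨hexit, hone⟩ := isExitState_of_jumpProb_ne_zero hN hj
    -- If the valley is the initial metastate, the ratio is exactly the hitting probability of the
    -- exit state. Otherwise the valley was entered from a non-assigned state, and the induction
    -- goes back two jumps.
    rcases k with _ | k
    · refine (tendsto_hit hX hi (hz 0 (by omega)) hN hexit
        (Landscape.aggregate_self hi (hz 0 (by omega)))).congr' ?_
      filter_upwards [eventually_gt_atTop 0, hD] with β hβ h
      have h1 : C.limitWeight P X i z t 1 β =
          C.flow i (C.p β) (z 0) (z 1) d (z 0) / C.hit (P β) X i (z 1) (z 0) := by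
        rw [limitWeight_succ, hone, hd, holdingLawAt, initialHoldingLaw, if_neg hN,
          exitLaw_eq (hX β hβ) (Landscape.aggregate_self hi (hz 0 (by omega))) hne]
        simp [limitWeight]
      rw [h1] at h
      rw [zero_add, h1, chainWeight_one hi (hz 0 (by omega)), hd, Nat.add_sub_cancel]
      have h2 := left_ne_zero_of_mul h
      rw [div_div_cancel₀ h2]
    · have hDj : ∀ᶠ β in atTop, C.limitWeight P X i z t k β ≠ 0 := by
        filter_upwards [hDk] with β h h0
        rw [limitWeight_succ, h0, zero_mul] at h
        exact h rfl
      have hj' : C.jumpProb i (z k) (z (k + 1)) ≠ 0 := by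
        obtain ⟨β, h⟩ := hDk.exists
        rw [limitWeight_succ] at h
        exact left_ne_zero_of_mul (right_ne_zero_of_mul h)
      have hne' := ne_of_jumpProb_ne_zero hi (hz k (by omega)) hj'
      have hNk : z k ∈ C.nonAssigned i := by
        by_contra hNk
        exact hN (mem_nonAssigned_of_isExitState hi (hz k (by omega)) hNk
          (isExitState_of_jumpProb_ne_zero hNk hj').1)
      obtain ⟨d', hd'⟩ : ∃ d', t (k + 1) - t k = d' + 1 :=
        ⟨t (k + 1) - t k - 1, by have := ht k (by omega); omega⟩
      -- For the two jumps together, the flow through the valley and the geometric weight cancel,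
      -- leaving the probability of the pair of jumps divided by `p̂` for the first of them. The
      -- second one has `p̂ = 1`.
      refine div_tendsto_one hj'
        (ih k (by omega) (fun j hj => hz j (by omega)) (fun j hj => ht j (by omega)) hDj)
        (tendsto_doubleHit hX hi hNk (hz (k + 1) (by omega)) hN hne' hexit) ?_
      filter_upwards [hD, holdingLaw_eq hX hi hNk (hz (k + 1) (by omega)) hN hne' hexit d]
        with β h h1
      have h2 : C.limitWeight P X i z t (k + 2) β = C.limitWeight P X i z t k β *
          (C.jumpProb i (z k) (z (k + 1)) *
            (C.p β (z k) (z k) ^ d' * (1 - C.p β (z k) (z k)))) *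
          ((∑ s, if s ∈ C.cell i (z (k + 1)) then C.p β (z k) s *
            C.flow i (C.p β) (z (k + 1)) (z (k + 2)) d s else 0) /
          ((1 - C.p β (z k) (z k)) * C.doubleHit β (P β) X i (z k) (z (k + 1)) (z (k + 2)))) := by
        rw [limitWeight_succ, limitWeight_succ, hone, one_mul, hd, hd',
          holdingLawAt_of_nonAssigned hNk, holdingLawAt, h1]
      rw [h2] at h
      rw [h2, chainWeight_add_two hi hNk, hd', show t (k + 2) - t (k + 1) - 1 = d from Nat.sub_eq_of_eq_add hd,
        Nat.add_sub_cancel]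
      generalize (∑ s, if s ∈ C.cell i (z (k + 1)) then C.p β (z k) s *
            C.flow i (C.p β) (z (k + 1)) (z (k + 2)) d s else 0) = F at h ⊢
      have g1 := left_ne_zero_of_mul h
      have g2 := right_ne_zero_of_mul h
      have g3 := left_ne_zero_of_mul g1
      have g4 := right_ne_zero_of_mul (right_ne_zero_of_mul g1)
      have g5 := left_ne_zero_of_mul g4
      have g6 := right_ne_zero_of_mul g4
      have g7 : F ≠ 0 := (div_ne_zero_iff.1 g2).1
      have g8 : C.doubleHit β (P β) X i (z k) (z (k + 1)) (z (k + 2)) ≠ 0 :=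
        right_ne_zero_of_mul (div_ne_zero_iff.1 g2).2
      field_simp

end Ratio

end LowTempChain

/-! ### Counting process and decomposition into runs -/

section Counting

variable {S : Type*} {σ : ℕ → ℕ∞}

lemma monotone_times (hσ : ∀ k, σ k < σ (k + 1) ∨ σ (k + 1) = ⊤) : Monotone σ :=
  monotone_nat_of_le_succ fun k => (hσ k).elim le_of_lt fun h => h ▸ le_top

lemma counting_eq (hσ : ∀ k, σ k < σ (k + 1) ∨ σ (k + 1) = ⊤) {J n : ℕ} (h1 : σ J ≤ n)
    (h2 : (n : ℕ∞) < σ (J + 1)) : counting σ n = J := by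
  refine IsGreatest.csSup_eq ⟨h1, fun k hk => ?_⟩
  by_contra! hlt
  exact absurd (h2.trans_le (monotone_times hσ hlt)) (not_lt.2 hk)

open Classical in
/-- Decomposition of a finite sequence into its maximal constant runs. -/
lemma exists_runs [Fintype S] (L : Landscape S) (i : ℕ) (y : ℕ → S) (n : ℕ) :
    ∃ (J : ℕ) (z : ℕ → S) (t : ℕ → ℕ), t 0 = 0 ∧ z 0 = y 0 ∧ (∀ j < J, t j < t (j + 1)) ∧
      t J ≤ n ∧ z J = y n ∧ (∀ j ≤ J, ∃ k ≤ n, z j = y k) ∧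
      (∀ p, pathMat p (fun l => L.cell i (y l)) n =
        L.entranceMat i p z t J * hop p (L.cell i (z J)) (L.cell i (z J)) ^ (n - t J)) ∧
      ∀ (σ : ℕ → ℕ∞) (Y : ℕ → S), σ 0 = 0 → (∀ k, σ k < σ (k + 1) ∨ σ (k + 1) = ⊤) →
        (∀ k, σ (k + 1) ≠ ⊤ → Y (k + 1) ≠ Y k) →
        ((∀ k ≤ n, Y (counting σ k) = y k) ↔
          (∀ j ≤ J, Y j = z j ∧ σ j = t j) ∧ (n : ℕ∞) < σ (J + 1)) := by
  induction n with
  | zero =>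
    refine ⟨0, fun _ => y 0, fun _ => 0, rfl, rfl, by simp, le_rfl, rfl, fun j _ => ⟨0, le_rfl, rfl⟩,
      fun p => ?_, fun σ Y h0 hσ hY => ?_⟩
    · rw [Nat.sub_zero, pow_zero, mul_one]; rfl
    · have h1 : (0 : ℕ∞) < σ (0 + 1) := by
        rcases hσ 0 with h | h
        · rwa [h0] at h
        · rw [h]; exact ENat.top_pos
      have h2 := counting_eq hσ (J := 0) (n := 0) (by simp [h0]) (by simpa using h1)
      simp only [Nat.le_zero, forall_eq, h2, h0, Nat.cast_zero, h1, and_true]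
  | succ n ih =>
    obtain ⟨J, z, t, ht0, hz0, ht, htn, hzn, hzy, hA, hB⟩ := ih
    by_cases hy : y (n + 1) = y n
    · refine ⟨J, z, t, ht0, hz0, ht, by omega, by rw [hzn, hy],
        fun j hj => (hzy j hj).imp fun k hk => ⟨by omega, hk.2⟩, fun p => ?_,
        fun σ Y h0 hσ hY => ?_⟩
      · rw [pathMat, hA p, hy, ← hzn, show n + 1 - t J = n - t J + 1 by omega, pow_succ, mul_assoc]
      · have hiff := hB σ Y h0 hσ hY
        constructor
        · intro h
          obtain ⟨h1, h2⟩ := hiff.1 fun k hk => h k (by omega)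
          refine ⟨h1, ?_⟩
          -- A jump at time `n + 1` would change the label, contrary to the prolonged run.
          by_contra! hle
          have h3 : σ (J + 1) = ((n + 1 : ℕ) : ℕ∞) :=
            le_antisymm hle (by push_cast; exact Order.add_one_le_of_lt h2)
          have h4 : ((n + 1 : ℕ) : ℕ∞) < σ (J + 1 + 1) := by
            rcases hσ (J + 1) with h | h
            · rwa [h3] at h
            · rw [h]; exact ENat.natCast_lt_top _
          have h5 := h (n + 1) le_rfl
          rw [counting_eq hσ h3.le h4, hy, ← hzn, ← (h1 J le_rfl).1] at h5
          exact hY J (by rw [h3]; exact ENat.natCast_ne_top _) h5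
        · rintro ⟨h1, h2⟩ k hk
          have h3 : (n : ℕ∞) < σ (J + 1) := lt_trans (by exact_mod_cast Nat.lt_succ_self n) h2
          rcases Nat.le_succ_iff_eq_or_le.1 hk with rfl | hk
          · rw [counting_eq hσ (J := J) _ h2, (h1 J le_rfl).1, hzn, hy]
            rw [(h1 J le_rfl).2]
            exact_mod_cast htn.trans (Nat.le_succ n)
          · exact hiff.2 ⟨h1, h3⟩ k hk
    · let z' : ℕ → S := fun j => if j ≤ J then z j else y (n + 1)
      let t' : ℕ → ℕ := fun j => if j ≤ J then t j else n + 1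
      have hz' : ∀ j ≤ J, z' j = z j := fun j hj => if_pos hj
      have ht' : ∀ j ≤ J, t' j = t j := fun j hj => if_pos hj
      have hzJ : z' (J + 1) = y (n + 1) := if_neg (by omega)
      have htJ : t' (J + 1) = n + 1 := if_neg (by omega)
      refine ⟨J + 1, z', t', by rw [ht' 0 (by omega), ht0], by rw [hz' 0 (by omega), hz0],
        fun j hj => ?_, htJ.le, hzJ, fun j hj => ?_, fun p => ?_, fun σ Y h0 hσ hY => ?_⟩
      · rcases Nat.lt_succ_iff_lt_or_eq.1 hj with hj | rfl
        · rw [ht' j hj.le, ht' (j + 1) hj]; exact ht j hj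
        · rw [ht' j le_rfl, htJ]; omega
      · rcases Nat.le_succ_iff_eq_or_le.1 hj with rfl | hj
        · exact ⟨n + 1, le_rfl, hzJ⟩
        · obtain ⟨k, hk, hk'⟩ := hzy j hj
          exact ⟨k, by omega, by rw [hz' j hj, hk']⟩
      · have hE : ∀ j ≤ J, L.entranceMat i p z' t' j = L.entranceMat i p z t j := by
          intro j
          induction j with
          | zero => intro _; rw [Landscape.entranceMat, Landscape.entranceMat, hz' 0 (by omega)]
          | succ j ihj =>
            intro hj
            rw [Landscape.entranceMat, Landscape.entranceMat, ihj (by omega), hz' j (by omega),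
              hz' (j + 1) hj, ht' j (by omega), ht' (j + 1) hj]
        rw [pathMat, hA p, htJ, Nat.sub_self, pow_zero, mul_one, Landscape.entranceMat,
          hE J le_rfl, hz' J le_rfl, hzJ, ht' J le_rfl, htJ, ← hzn, mul_assoc,
          show n + 1 - t J - 1 = n - t J by omega]
      · have hiff := hB σ Y h0 hσ hY
        constructor
        · intro h
          obtain ⟨h1, h2⟩ := hiff.1 fun k hk => h k (by omega)
          have h5 := h (n + 1) le_rfl
          -- Without a jump at time `n + 1` the label would still be `y n`, contrary to the start of
          -- a new run.
          have h3 : σ (J + 1) = ((n + 1 : ℕ) : ℕ∞) := by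
            by_contra hne
            have h4 : ((n + 1 : ℕ) : ℕ∞) < σ (J + 1) :=
              lt_of_le_of_ne (by push_cast; exact Order.add_one_le_of_lt h2) (Ne.symm hne)
            have h6 : σ J ≤ ((n + 1 : ℕ) : ℕ∞) := by
              rw [(h1 J le_rfl).2]
              exact_mod_cast htn.trans (Nat.le_succ n)
            rw [counting_eq hσ h6 h4, (h1 J le_rfl).1, hzn] at h5
            exact hy h5.symm
          have h4 : ((n + 1 : ℕ) : ℕ∞) < σ (J + 1 + 1) := by
            rcases hσ (J + 1) with h | h
            · rwa [h3] at h
            · rw [h]; exact ENat.natCast_lt_top _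
          refine ⟨fun j hj => ?_, h4⟩
          rcases Nat.le_succ_iff_eq_or_le.1 hj with rfl | hj
          · rw [hzJ, htJ, ← h5, counting_eq hσ h3.le h4]
            exact ⟨rfl, h3⟩
          · rw [hz' j hj, ht' j hj]; exact h1 j hj
        · rintro ⟨h1, h2⟩ k hk
          have h3 := h1 (J + 1) le_rfl
          rw [hzJ, htJ] at h3
          rcases Nat.le_succ_iff_eq_or_le.1 hk with rfl | hk
          · rw [counting_eq hσ h3.2.le h2, h3.1]
          · refine hiff.2 ⟨fun j hj => ?_, ?_⟩ k hk
            · have := h1 j (by omega)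
              rwa [hz' j hj, ht' j hj] at this
            · rw [h3.2]; exact_mod_cast Nat.lt_succ_self n

end Counting

/-! ### Finite-time events of the Markov renewal limit -/

namespace LowTempChain

section Limit

open Classical

variable {S : Type*} [Fintype S] {C : LowTempChain S} {i : ℕ}
  {Ω : Type*} [MeasurableSpace Ω] {P : ℝ → S → Measure Ω} {X : ℕ → Ω → S} {β : ℝ}
  {Ω' : Type*} [MeasurableSpace Ω'] {μ : Measure Ω'} {Yh : ℕ → Ω' → S} {σh : ℕ → Ω' → ℕ∞} {y₀ : S}

lemma mem_metastates_of_jumpProb_ne_zero (hi : 1 ≤ i) {r s : S} (hr : r ∈ C.metastates i)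
    (h : C.jumpProb i r s ≠ 0) : s ∈ C.metastates i := by
  by_cases hN : r ∈ C.nonAssigned i
  · by_contra hs
    rw [jumpProb, if_pos hN, if_neg hs] at h
    exact h rfl
  · exact Or.inr (mem_nonAssigned_of_isExitState hi hr hN (isExitState_of_jumpProb_ne_zero hN h).1)

lemma jumpProb_ne_zero_of_limitWeight {z : ℕ → S} {t : ℕ → ℕ} {k : ℕ}
    (h : C.limitWeight P X i z t k β ≠ 0) : ∀ j < k, C.jumpProb i (z j) (z (j + 1)) ≠ 0 :=
  fun j hj => left_ne_zero_of_mul (Finset.prod_ne_zero_iff.1 h j (Finset.mem_range.2 hj))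

lemma ne_of_limitWeight_ne_zero (hi : 1 ≤ i) {z : ℕ → S} {t : ℕ → ℕ} {k : ℕ}
    (h0 : z 0 ∈ C.metastates i) (h : C.limitWeight P X i z t k β ≠ 0) :
    ∀ j < k, z (j + 1) ≠ z j := by
  have hz : ∀ j < k + 1, z j ∈ C.metastates i := by
    intro j
    induction j with
    | zero => exact fun _ => h0
    | succ j ih =>
      exact fun hj => mem_metastates_of_jumpProb_ne_zero hi (ih (by omega))
        (jumpProb_ne_zero_of_limitWeight h j (by omega))
  exact fun j hj => ne_of_jumpProb_ne_zero hi (hz j (by omega))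
    (jumpProb_ne_zero_of_limitWeight h j hj)

variable (hμ : C.IsMarkovRenewalLimit β (P β) X i y₀ μ Yh σh)
include hμ

lemma IsMarkovRenewalLimit.real_eq {z : ℕ → S} {t : ℕ → ℕ} (hz : z 0 = y₀) (h0 : t 0 = 0) {k : ℕ}
    (ht : ∀ j < k, t j < t (j + 1)) :
    μ.real {ω | ∀ j ≤ k, Yh j ω = z j ∧ σh j ω = t j} = C.limitWeight P X i z t k β :=
  hμ.law k z t hz h0 ht

/-- Since `p̂` vanishes on the diagonal, a finite history repeating a label has weight zero, and
there are only countably many finite histories. -/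
lemma IsMarkovRenewalLimit.ae_ne (hi : 1 ≤ i) (hy : y₀ ∈ C.metastates i) :
    ∀ᵐ ω ∂μ, ∀ k, σh (k + 1) ω ≠ ⊤ → Yh (k + 1) ω ≠ Yh k ω := by
  have := hμ.isProbabilityMeasure
  refine ae_all_iff.2 fun k => ?_
  have key : ∀ v : Fin (k + 2) → S × ℕ, ∀ᵐ ω ∂μ,
      (∀ j : Fin (k + 2), Yh j ω = (v j).1 ∧ σh j ω = (v j).2) → Yh (k + 1) ω ≠ Yh k ω := by
    intro v
    let z : ℕ → S := fun j => if h : j < k + 2 then (v ⟨j, h⟩).1 else y₀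
    let t : ℕ → ℕ := fun j => if h : j < k + 2 then (v ⟨j, h⟩).2 else 0
    have hz : ∀ j (h : j < k + 2), z j = (v ⟨j, h⟩).1 := fun j h => dif_pos h
    have ht : ∀ j (h : j < k + 2), t j = (v ⟨j, h⟩).2 := fun j h => dif_pos h
    by_cases hgood : z 0 = y₀ ∧ t 0 = 0 ∧ ∀ j < k + 1, t j < t (j + 1)
    · by_cases heq : z (k + 1) = z k
      · have h1 := hμ.real_eq hgood.1 hgood.2.1 hgood.2.2
        have h2 : C.limitWeight P X i z t (k + 1) β = 0 := by
          by_contra hne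
          exact ne_of_limitWeight_ne_zero hi (hgood.1 ▸ hy) hne k (by omega) heq
        rw [h2, measureReal_eq_zero_iff] at h1
        filter_upwards [measure_eq_zero_iff_ae_notMem.1 h1] with ω hω h
        exact absurd (fun j hj => by
          rw [hz j (by omega), ht j (by omega)]; exact h ⟨j, by omega⟩) hω
      · refine Eventually.of_forall fun ω h => ?_
        have h1 := (h ⟨k + 1, by omega⟩).1
        have h2 := (h ⟨k, by omega⟩).1
        rw [← hz (k + 1) (by omega)] at h1
        rw [← hz k (by omega)] at h2
        intro h3
        exact heq (h1.symm.trans (h3.trans h2))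
    · filter_upwards [hμ.start, hμ.increasing] with ω h1 h2 h
      refine absurd ⟨?_, ?_, fun j hj => ?_⟩ hgood
      · rw [hz 0 (by omega), ← h1.1]; exact (h ⟨0, by omega⟩).1.symm
      · have h3 := (h ⟨0, by omega⟩).2
        rw [← ht 0 (by omega)] at h3
        have h4 : ((t 0 : ℕ) : ℕ∞) = (0 : ℕ) := h3.symm.trans h1.2
        exact_mod_cast h4
      · have h3 := (h ⟨j, by omega⟩).2
        have h4 := (h ⟨j + 1, by omega⟩).2
        rw [← ht j (by omega)] at h3
        rw [← ht (j + 1) (by omega)] at h4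
        have h5 := h2 j
        simp only at h3 h4
        rw [h3, h4] at h5
        rcases h5 with h5 | h5
        · exact_mod_cast h5
        · exact absurd h5 (ENat.natCast_ne_top _)
  filter_upwards [ae_all_iff.2 key, hμ.increasing] with ω h1 h2 h3
  have hfin : ∀ j : Fin (k + 2), σh j ω ≠ ⊤ := fun j =>
    ne_top_of_le_ne_top h3 (monotone_times h2 (Nat.le_of_lt_succ j.2))
  refine h1 (fun j => (Yh j ω, (σh j ω).toNat)) fun j => ⟨rfl, ?_⟩
  exact (ENat.natCast_toNat (hfin j)).symm

variable (C P X) in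
omit hμ in
/-- Probability, given the jumps up to the `J`-th one, that the Markov renewal limit jumps again
within `m` time units. -/
def jumpWithin (i : ℕ) (z : ℕ → S) (J m : ℕ) (β : ℝ) : ℝ :=
  ∑ u, ∑ τ ∈ Finset.range m, C.jumpProb i (z J) u *
    C.holdingLawAt β (P β) X i (Function.update z (J + 1) u) J (τ + 1)

/-- The law is known for finite jump times only, and there may be no further jump. So the histories
with a next jump by time `n`, finitely many and disjoint, are subtracted. -/
lemma IsMarkovRenewalLimit.real_no_jump {z : ℕ → S} {t : ℕ → ℕ} (hz : z 0 = y₀) (h0 : t 0 = 0)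
    {J n : ℕ} (ht : ∀ j < J, t j < t (j + 1)) (htn : t J ≤ n) :
    μ.real {ω | (∀ j ≤ J, Yh j ω = z j ∧ σh j ω = t j) ∧ (n : ℕ∞) < σh (J + 1) ω} =
      C.limitWeight P X i z t J β * (1 - C.jumpWithin P X i z J (n - t J) β) := by
  have := hμ.isProbabilityMeasure
  set F := {ω | ∀ j ≤ J, Yh j ω = z j ∧ σh j ω = t j}
  have hFm : MeasurableSet F := by
    have : F = ⋂ j ∈ Set.Iic J, ({ω | Yh j ω = z j} ∩ {ω | σh j ω = t j}) := by
      ext ω; simp [F]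
    rw [this]
    exact MeasurableSet.biInter (Set.to_countable _) fun j _ =>
      (hμ.measurableSet_chain j (z j)).inter (hμ.measurableSet_time j (t j))
  let G : S × Fin (n - t J) → Set Ω' := fun q =>
    F ∩ ({ω | Yh (J + 1) ω = q.1} ∩ {ω | σh (J + 1) ω = (t J + q.2 + 1 : ℕ)})
  have hGm : ∀ q, MeasurableSet (G q) := fun q => hFm.inter
    ((hμ.measurableSet_chain _ _).inter (hμ.measurableSet_time _ _))
  have hGd : Pairwise (Function.onFun Disjoint G) := by
    rintro ⟨u, a⟩ ⟨u', a'⟩ hq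
    refine Set.disjoint_left.2 ?_
    rintro ω ⟨-, h1, h2⟩ ⟨-, h3, h4⟩
    refine hq (Prod.ext (h1.symm.trans h3) (Fin.ext ?_))
    have h5 : ((t J + (a : ℕ) + 1 : ℕ) : ℕ∞) = (t J + a' + 1 : ℕ) := h2.symm.trans h4
    have h6 : t J + (a : ℕ) + 1 = t J + a' + 1 := by exact_mod_cast h5
    exact Nat.add_left_cancel (Nat.succ_injective h6)
  have hsplit : {ω | (∀ j ≤ J, Yh j ω = z j ∧ σh j ω = t j) ∧ (n : ℕ∞) < σh (J + 1) ω} =ᵐ[μ]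
      (F \ ⋃ q, G q : Set Ω') := by
    filter_upwards [hμ.increasing] with ω hω
    refine propext ⟨fun h => ⟨h.1, ?_⟩, fun h => ⟨h.1, ?_⟩⟩
    · simp only [G, Set.mem_iUnion, not_exists]
      rintro ⟨u, a⟩ ⟨-, -, h1⟩
      have h2 := h.2
      rw [show σh (J + 1) ω = _ from h1] at h2
      have h3 : n < t J + a + 1 := by exact_mod_cast h2
      have := a.2
      omega
    · by_contra! hle
      obtain ⟨T, hT⟩ := ENat.ne_top_iff_exists.1 (ne_top_of_le_ne_top (ENat.natCast_ne_top n) hle)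
      have h1 := hω J
      rw [(h.1 J le_rfl).2, ← hT] at h1
      rw [← hT] at hle
      have h2 : T ≤ n := by exact_mod_cast hle
      have h3 : t J < T := by
        rcases h1 with h1 | h1
        · exact_mod_cast h1
        · exact absurd h1 (ENat.natCast_ne_top _)
      refine h.2 (Set.mem_iUnion.2 ⟨(Yh (J + 1) ω, ⟨T - t J - 1, by omega⟩), h.1, rfl, ?_⟩)
      rw [Set.mem_ofPred_eq, ← hT]
      congr 1
      simp only
      omega
  have hG : ∀ q : S × Fin (n - t J), μ.real (G q) = C.limitWeight P X i z t J β *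
      (C.jumpProb i (z J) q.1 *
        C.holdingLawAt β (P β) X i (Function.update z (J + 1) q.1) J (q.2 + 1)) := by
    rintro ⟨u, a⟩
    set z' := Function.update z (J + 1) u
    set t' := Function.update t (J + 1) (t J + a + 1)
    have hz' : ∀ j ≤ J, z' j = z j := fun j hj => Function.update_of_ne (by omega) _ _
    have ht' : ∀ j ≤ J, t' j = t j := fun j hj => Function.update_of_ne (by omega) _ _
    have hzJ : z' (J + 1) = u := Function.update_self _ _ _
    have htJ : t' (J + 1) = t J + a + 1 := Function.update_self _ _ _
    have h1 : G (u, a) = {ω | ∀ j ≤ J + 1, Yh j ω = z' j ∧ σh j ω = t' j} := by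
      ext ω
      simp only [G, F, Set.mem_inter_iff, Set.mem_ofPred_eq, Nat.le_succ_iff_eq_or_le]
      constructor
      · rintro ⟨h1, h2⟩ j (rfl | hj)
        · rw [hzJ, htJ]; exact h2
        · rw [hz' j hj, ht' j hj]; exact h1 j hj
      · refine fun h => ⟨fun j hj => ?_, ?_⟩
        · rw [← hz' j hj, ← ht' j hj]; exact h j (Or.inr hj)
        · have := h (J + 1) (Or.inl rfl)
          rwa [hzJ, htJ] at this
    -- The factors of the first `J` jumps look ahead no farther than the label of index `J`, so they
    -- do not see the changed entry.
    have hlw : C.limitWeight P X i z' t' J β = C.limitWeight P X i z t J β := by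
      refine Finset.prod_congr rfl fun j hj => ?_
      have hj := Finset.mem_range.1 hj
      rw [hz' j hj.le, hz' (j + 1) hj, ht' j hj.le, ht' (j + 1) hj]
      congr 1
      cases j with
      | zero => rw [holdingLawAt, holdingLawAt, hz' 0 (by omega), hz' 1 (by omega)]
      | succ j => rw [holdingLawAt, holdingLawAt, hz' j (by omega), hz' (j + 1) (by omega),
          hz' (j + 2) (by omega)]
    rw [h1, hμ.real_eq (by rw [hz' 0 (by omega), hz]) (by rw [ht' 0 (by omega), h0]) (by
      intro j hj
      rcases Nat.lt_succ_iff_lt_or_eq.1 hj with hj | rfl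
      · rw [ht' j hj.le, ht' (j + 1) hj]; exact ht j hj
      · rw [ht' j le_rfl, htJ]; omega), limitWeight_succ, hlw, hz' J le_rfl, hzJ, ht' J le_rfl, htJ,
      show t J + (a : ℕ) + 1 - t J = a + 1 by omega]
  rw [measureReal_congr hsplit, measureReal_sdiff (Set.iUnion_subset fun q => Set.inter_subset_left)
    (MeasurableSet.iUnion hGm), measureReal_iUnion_fintype hGd hGm, hμ.real_eq hz h0 ht, mul_sub,
    mul_one]
  simp_rw [hG]
  rw [← Finset.mul_sum, Fintype.sum_prod_type, jumpWithin]
  congr 2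
  refine Finset.sum_congr rfl fun u _ => ?_
  exact (Finset.sum_range fun τ => C.jumpProb i (z J) u *
    C.holdingLawAt β (P β) X i (Function.update z (J + 1) u) J (τ + 1)).symm

end Limit

/-! ### The last stay and the two convergence statements -/

section Main

open Classical

variable {S : Type*} [Fintype S] {C : LowTempChain S} {i : ℕ}
  {Ω : Type*} [MeasurableSpace Ω] {P : ℝ → S → Measure Ω} {X : ℕ → Ω → S}
  {z : ℕ → S} {t : ℕ → ℕ}

/-- The holding law ignores the next label and `p̂` sums to one, so only a geometric sum is left. -/
lemma jumpWithin_of_nonAssigned (hi : 1 ≤ i) {J : ℕ} (hN : z J ∈ C.nonAssigned i) (m : ℕ) (β : ℝ) :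
    C.jumpWithin P X i z J m β = 1 - C.p β (z J) (z J) ^ m := by
  have h1 : ∀ u τ, C.holdingLawAt β (P β) X i (Function.update z (J + 1) u) J (τ + 1) =
      C.p β (z J) (z J) ^ τ * (1 - C.p β (z J) (z J)) := by
    intro u τ
    have hu : Function.update z (J + 1) u J = z J := Function.update_of_ne (by omega) _ _
    rw [holdingLawAt_of_nonAssigned (by rw [hu]; exact hN), hu]
  simp_rw [jumpWithin, h1, ← Finset.mul_sum, ← Finset.sum_mul]
  rw [sum_jumpProb hi hN, one_mul, mul_comm, mul_neg_geom_sum]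

/-- Each holding time probability in a valley is a vanishing flow divided by a quantity with nonzero
limit: a hitting probability tending to one initially, and a multiple of `p̂` for the preceding jump
later on. -/
lemma tendsto_jumpWithin (hX : ∀ β > 0, ∀ x, IsMarkovChain (P β x) X (C.p β) x) (hi : 1 ≤ i)
    {J : ℕ} (hz : ∀ j ≤ J, z j ∈ C.metastates i)
    (hj : ∀ j < J, C.jumpProb i (z j) (z (j + 1)) ≠ 0) (hN : z J ∉ C.nonAssigned i) (m : ℕ) :
    Tendsto (C.jumpWithin P X i z J m) atTop (𝓝 0) := by
  rw [show (0 : ℝ) = ∑ u : S, ∑ τ ∈ Finset.range m, 0 by simp]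
  refine tendsto_finsetSum _ fun u _ => tendsto_finsetSum _ fun τ _ => ?_
  by_cases hu : C.jumpProb i (z J) u = 0
  · simp only [hu, zero_mul]
    exact tendsto_const_nhds
  obtain ⟨hexit, hone⟩ := isExitState_of_jumpProb_ne_zero hN hu
  have hne := ne_of_jumpProb_ne_zero hi (hz J le_rfl) hu
  simp only [hone, one_mul]
  rcases J with _ | J
  · have h1 := (tendsto_flow_zero hi (hz 0 le_rfl) hN
      (Landscape.aggregate_self hi (hz 0 le_rfl)) hne τ).div
      (tendsto_hit hX hi (hz 0 le_rfl) hN hexit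
        (Landscape.aggregate_self hi (hz 0 le_rfl))) one_ne_zero
    rw [zero_div] at h1
    refine h1.congr' ?_
    filter_upwards [eventually_gt_atTop 0] with β hβ
    rw [holdingLawAt, Function.update_of_ne (by omega), zero_add, Function.update_self,
      initialHoldingLaw, if_neg hN,
      exitLaw_eq (hX β hβ) (Landscape.aggregate_self hi (hz 0 le_rfl)) hne]
    rfl
  · have hjJ := hj J (Nat.lt_succ_self J)
    have hNJ : z J ∈ C.nonAssigned i := by
      by_contra hNJ
      exact hN (mem_nonAssigned_of_isExitState hi (hz J (by omega)) hNJ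
        (isExitState_of_jumpProb_ne_zero hNJ hjJ).1)
    have hne' := ne_of_jumpProb_ne_zero hi (hz J (by omega)) hjJ
    have h1 : Tendsto (fun β => ∑ s, if s ∈ C.cell i (z (J + 1)) then
        C.p β (z J) s * C.flow i (C.p β) (z (J + 1)) u τ s else 0) atTop (𝓝 0) := by
      have h0 : Tendsto (fun β => ∑ s, if s ∈ C.cell i (z (J + 1)) then
          C.p β (z J) s * C.flow i (C.p β) (z (J + 1)) u τ s else 0) atTop
          (𝓝 (∑ _s : S, (0 : ℝ))) := by
        refine tendsto_finsetSum _ fun s _ => ?_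
        split_ifs with hs
        · simpa using (C.p_tendsto (z J) s).mul
            (tendsto_flow_zero hi (hz (J + 1) le_rfl) hN hs hne τ)
        · exact tendsto_const_nhds
      simpa only [Finset.sum_const_zero] using h0
    have h2 := ((C.p_tendsto (z J) (z J)).const_sub 1).mul
      (tendsto_doubleHit hX hi hNJ (hz (J + 1) le_rfl) hN hne' hexit)
    have h3 := h1.div h2 (mul_ne_zero (sub_pos.2 (pLim_self_lt_one hi hNJ)).ne' hjJ)
    rw [zero_div] at h3
    refine h3.congr' ?_
    filter_upwards [holdingLaw_eq hX hi hNJ (hz (J + 1) le_rfl) hN hne' hexit τ] with β h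
    rw [holdingLawAt, Function.update_of_ne (by omega), Function.update_of_ne (by omega),
      Function.update_self, h]
    rfl

lemma entranceMat_nonneg {β : ℝ} (hβ : 0 < β) (k : ℕ) (x u : S) :
    0 ≤ C.entranceMat i (C.p β) z t k x u := by
  induction k generalizing u with
  | zero =>
    rw [Landscape.entranceMat, Matrix.of_apply]
    split_ifs <;> norm_num
  | succ k ih =>
    rw [Landscape.entranceMat, Matrix.mul_apply]
    refine Finset.sum_nonneg fun v _ => mul_nonneg (ih v) ?_
    rw [Matrix.mul_apply]
    exact Finset.sum_nonneg fun w _ => mul_nonneg (hop_pow_nonneg (C.p_nonneg β hβ) _ v w)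
      (hop_nonneg (C.p_nonneg β hβ) w u)

/-- Once a valley is entered, it is not left within finitely many steps. -/
lemma tendsto_stay_div (hi : 1 ≤ i) {J : ℕ} (hz : z J ∈ C.metastates i)
    (hN : z J ∉ C.nonAssigned i) (m : ℕ)
    (hne : ∀ᶠ β in atTop, C.chainWeight i z t J β ≠ 0) :
    Tendsto (fun β => (∑ u, (C.entranceMat i (C.p β) z t J *
      hop (C.p β) (C.cell i (z J)) (C.cell i (z J)) ^ m) (z 0) u) / C.chainWeight i z t J β)
      atTop (𝓝 1) := by
  set V := C.cell i (z J)
  -- The law of the entrance state is not controlled, so a bound uniform over the valley is used: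
  -- one minus the sum of the defects of all its states.
  have h1 : Tendsto (fun β => 1 - ∑ s, if s ∈ V then 1 - ∑ u, (hop (C.p β) V V ^ m) s u else 0)
      atTop (𝓝 1) := by
    have h2 : Tendsto (fun β => ∑ s, if s ∈ V then 1 - ∑ u, (hop (C.p β) V V ^ m) s u else 0)
        atTop (𝓝 (∑ s : S, 0)) := by
      refine tendsto_finsetSum _ fun s _ => ?_
      split_ifs with hs
      · simpa using (tendsto_stay hi hz hN hs m).const_sub 1
      · exact tendsto_const_nhds
    simpa using h2.const_sub 1
  have hle : ∀ β > 0, ∀ s ∈ V, ∑ u, (hop (C.p β) V V ^ m) s u ≤ 1 := by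
    intro β hβ s hs
    rw [← exit_add_survival (C.p_sum β hβ) hs m]
    refine le_add_of_nonneg_left (Finset.sum_nonneg fun k _ => Finset.sum_nonneg fun u _ => ?_)
    rw [Matrix.mul_apply]
    exact Finset.sum_nonneg fun v _ => mul_nonneg (hop_pow_nonneg (C.p_nonneg β hβ) _ s v)
      (hop_nonneg (C.p_nonneg β hβ) v u)
  have hW : ∀ β > 0, 0 ≤ C.chainWeight i z t J β := fun β hβ =>
    Finset.sum_nonneg fun u _ => entranceMat_nonneg hβ J (z 0) u
  refine tendsto_of_tendsto_of_tendsto_of_le_of_le' h1 tendsto_const_nhds ?_ ?_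
  · filter_upwards [eventually_gt_atTop 0, hne] with β hβ hne
    rw [le_div_iff₀ (lt_of_le_of_ne (hW β hβ) hne.symm), sum_mul_apply, chainWeight, mul_comm,
      Finset.sum_mul]
    refine Finset.sum_le_sum fun v _ => ?_
    by_cases hv : v ∈ V
    · refine mul_le_mul_of_nonneg_left ?_ (entranceMat_nonneg hβ J (z 0) v)
      have h2 := Finset.single_le_sum (s := Finset.univ)
        (f := fun s => if s ∈ V then 1 - ∑ u, (hop (C.p β) V V ^ m) s u else 0)
        (fun s _ => by
          split_ifs with hs
          · exact sub_nonneg.2 (hle β hβ s hs)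
          · exact le_rfl) (Finset.mem_univ v)
      simp only [if_pos hv] at h2
      linarith
    · rw [entranceMat_eq_zero hv, zero_mul, zero_mul]
  · filter_upwards [eventually_gt_atTop 0, hne] with β hβ hne
    rw [div_le_one (lt_of_le_of_ne (hW β hβ) hne.symm), sum_mul_apply, chainWeight]
    refine Finset.sum_le_sum fun v _ => ?_
    by_cases hv : v ∈ V
    · exact mul_le_of_le_one_right (entranceMat_nonneg hβ J (z 0) v) (hle β hβ v hv)
    · rw [entranceMat_eq_zero hv, zero_mul]

variable {Ω' : Type*} [MeasurableSpace Ω'] {P' : ℝ → S → Measure Ω'} {Yh : ℕ → Ω' → S}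
  {σh : ℕ → Ω' → ℕ∞}

/-- Convergence of the accelerated aggregated chain to the Markov renewal process. -/
theorem tendsto_markovRenewal (hX : ∀ β > 0, ∀ x, IsMarkovChain (P β x) X (C.p β) x)
    (hi : 1 ≤ i) (hY : ∀ β > 0, ∀ y₀ ∈ C.metastates i,
      C.IsMarkovRenewalLimit β (P β) X i y₀ (P' β y₀) Yh σh)
    (n : ℕ) (y : ℕ → S) (t : ℕ → ℕ) (hy : ∀ k ≤ n + 1, y k ∈ C.metastates i)
    (ht1 : 0 < t 1) (ht : ∀ k, 1 ≤ k → k ≤ n → t k < t (k + 1))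
    (hpos : ∀ᶠ β in atTop, 0 < (P' β (y 0)).real {ω | ∀ k ≤ n,
      (Yh k ω, Yh (k + 1) ω) = (y k, y (k + 1)) ∧ σh (k + 1) ω = t (k + 1)}) :
    Tendsto (fun β =>
      (P β (y 0)).real {ω | ∀ k ≤ n,
        (C.aac i (fun j => X j ω) k, C.aac i (fun j => X j ω) (k + 1)) = (y k, y (k + 1)) ∧
          C.jumpTime i (fun j => X j ω) (k + 1) = t (k + 1)} /
      (P' β (y 0)).real {ω | ∀ k ≤ n,
        (Yh k ω, Yh (k + 1) ω) = (y k, y (k + 1)) ∧ σh (k + 1) ω = t (k + 1)})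
      atTop (𝓝 1) := by
  -- The statement leaves `t 0` free, whereas the jump histories start at time zero.
  let t' : ℕ → ℕ := fun k => if k = 0 then 0 else t k
  have ht'0 : t' 0 = 0 := rfl
  have ht's : ∀ k, t' (k + 1) = t (k + 1) := fun k => if_neg (by omega)
  have ht' : ∀ j < n + 1, t' j < t' (j + 1) := by
    rintro (_ | j) hj
    · rw [ht's]; exact ht1
    · rw [ht's, ht's]; exact ht (j + 1) (by omega) (by omega)
  have hevent : ∀ (A : ℕ → S) (T : ℕ → ℕ∞), T 0 = 0 →
      ((∀ k ≤ n, (A k, A (k + 1)) = (y k, y (k + 1)) ∧ T (k + 1) = t (k + 1)) ↔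
        ∀ k ≤ n + 1, A k = y k ∧ T k = t' k) := by
    intro A T hT
    simp only [Prod.mk.injEq]
    constructor
    · rintro h (_ | k) hk
      · exact ⟨(h 0 (by omega)).1.1, by rw [hT, ht'0]; rfl⟩
      · rw [ht's]
        exact ⟨(h k (by omega)).1.2, (h k (by omega)).2⟩
    · intro h k hk
      have h1 := h (k + 1) (by omega)
      rw [ht's] at h1
      exact ⟨⟨(h k (by omega)).1, h1.1⟩, h1.2⟩
  have hden : ∀ β > 0, (P' β (y 0)).real {ω | ∀ k ≤ n,
      (Yh k ω, Yh (k + 1) ω) = (y k, y (k + 1)) ∧ σh (k + 1) ω = t (k + 1)} =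
      C.limitWeight P X i y t' (n + 1) β := by
    intro β hβ
    have hμ := hY β hβ (y 0) (hy 0 (by omega))
    rw [← hμ.real_eq rfl ht'0 ht']
    refine measureReal_congr ?_
    filter_upwards [hμ.start] with ω hω
    exact propext (hevent (fun k => Yh k ω) (fun k => σh k ω) hω.2)
  have hD : ∀ᶠ β in atTop, C.limitWeight P X i y t' (n + 1) β ≠ 0 := by
    filter_upwards [eventually_gt_atTop 0, hpos] with β hβ h
    rw [hden β hβ] at h
    exact h.ne'
  -- A positive denominator forces successive labels to differ, so that the event for the chain is a
  -- genuine history of jumps.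
  have hne : ∀ k < n + 1, y (k + 1) ≠ y k := by
    obtain ⟨β, h⟩ := hD.exists
    exact ne_of_limitWeight_ne_zero hi (hy 0 (by omega)) h
  refine (tendsto_chainWeight_div hX hi (n + 1) hy ht' hD).congr' ?_
  filter_upwards [eventually_gt_atTop 0] with β hβ
  rw [hden β hβ]
  congr 1
  rw [chainWeight, ← Landscape.real_entered (hX β hβ (y 0)) y t' ht'0 (n + 1) ht' hne]
  congr 1
  ext ω
  exact (hevent (fun k => C.aac i (fun j => X j ω) k)
    (fun k => C.jumpTime i (fun j => X j ω) k) rfl).symm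

/-- The aggregated chain is asymptotically semi-Markovian. -/
theorem tendsto_semiMarkov (hX : ∀ β > 0, ∀ x, IsMarkovChain (P β x) X (C.p β) x)
    (hi : 1 ≤ i) (hY : ∀ β > 0, ∀ y₀ ∈ C.metastates i,
      C.IsMarkovRenewalLimit β (P β) X i y₀ (P' β y₀) Yh σh)
    (n : ℕ) (y : ℕ → S) (hy : ∀ k ≤ n + 1, y k ∈ C.metastates i)
    (hpos : ∀ᶠ β in atTop, 0 < (P' β (y 0)).real {ω | ∀ k ≤ n,
      (Yh (counting (fun j => σh j ω) k) ω, Yh (counting (fun j => σh j ω) (k + 1)) ω) =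
        (y k, y (k + 1))}) :
    Tendsto (fun β =>
      (P β (y 0)).real {ω | ∀ k ≤ n,
        (C.ac i (fun j => X j ω) k, C.ac i (fun j => X j ω) (k + 1)) = (y k, y (k + 1))} /
      (P' β (y 0)).real {ω | ∀ k ≤ n,
        (Yh (counting (fun j => σh j ω) k) ω, Yh (counting (fun j => σh j ω) (k + 1)) ω) =
          (y k, y (k + 1))})
      atTop (𝓝 1) := by
  have hevent : ∀ A : ℕ → S, (∀ k ≤ n, (A k, A (k + 1)) = (y k, y (k + 1))) ↔
      ∀ k ≤ n + 1, A k = y k := by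
    intro A
    simp only [Prod.mk.injEq]
    constructor
    · rintro h (_ | k) hk
      · exact (h 0 (by omega)).1
      · exact (h k (by omega)).2
    · exact fun h k hk => ⟨h k (by omega), h (k + 1) (by omega)⟩
  obtain ⟨J, z, t, ht0, hz0, ht, htn, -, hzy, hA, hB⟩ :=
    exists_runs C.toLandscape i y (n + 1)
  have hz : ∀ j ≤ J, z j ∈ C.metastates i := by
    intro j hj
    obtain ⟨k, hk, hjk⟩ := hzy j hj
    rw [hjk]
    exact hy k hk
  set m := n + 1 - t J
  have hden : ∀ β > 0, (P' β (y 0)).real {ω | ∀ k ≤ n,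
      (Yh (counting (fun j => σh j ω) k) ω, Yh (counting (fun j => σh j ω) (k + 1)) ω) =
        (y k, y (k + 1))} =
      C.limitWeight P X i z t J β * (1 - C.jumpWithin P X i z J m β) := by
    intro β hβ
    have hμ := hY β hβ (y 0) (hy 0 (by omega))
    rw [← hμ.real_no_jump hz0 ht0 ht htn]
    refine measureReal_congr ?_
    filter_upwards [hμ.start, hμ.increasing, hμ.ae_ne hi (hy 0 (by omega))] with ω h1 h2 h3
    refine propext ?_
    exact (hevent fun k => Yh (counting (fun j => σh j ω) k) ω).trans
      (hB (fun j => σh j ω) (fun j => Yh j ω) h1.2 h2 h3)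
  have hnum : ∀ β > 0, (P β (y 0)).real {ω | ∀ k ≤ n,
      (C.ac i (fun j => X j ω) k, C.ac i (fun j => X j ω) (k + 1)) = (y k, y (k + 1))} =
      ∑ u, (C.entranceMat i (C.p β) z t J *
        hop (C.p β) (C.cell i (z J)) (C.cell i (z J)) ^ m) (z 0) u := by
    intro β hβ
    rw [hz0, ← hA, ← (hX β hβ (y 0)).real_path_sum]
    congr 1
    ext ω
    exact hevent fun k => C.ac i (fun j => X j ω) k
  have hD : ∀ᶠ β in atTop, C.limitWeight P X i z t J β ≠ 0 := by
    filter_upwards [eventually_gt_atTop 0, hpos] with β hβ h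
    rw [hden β hβ] at h
    exact left_ne_zero_of_mul h.ne'
  have hj : ∀ j < J, C.jumpProb i (z j) (z (j + 1)) ≠ 0 := by
    obtain ⟨β, h⟩ := hD.exists
    exact jumpProb_ne_zero_of_limitWeight h
  have hmain := tendsto_chainWeight_div hX hi J hz ht hD
  -- In a non-assigned last state, numerator and denominator carry the same factor `p(z,z)^m`. In a
  -- valley, the conditional probabilities of staying for `m` more steps tend to one on both sides.
  by_cases hN : z J ∈ C.nonAssigned i
  · refine hmain.congr' ?_
    filter_upwards [eventually_gt_atTop 0] with β hβ
    have hp := C.p_diag β hβ (z J)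
    rw [hden β hβ, hnum β hβ, jumpWithin_of_nonAssigned hi hN, sub_sub_cancel,
      sum_entranceMat_mul hi hN, cell_of_mem_nonAssigned hi hN]
    have h1 : ∑ u, (hop (C.p β) {z J} {z J} ^ m) (z J) u = C.p β (z J) (z J) ^ m := by
      simp [hop_pow_singleton]
    rw [h1, mul_div_mul_right _ _ (pow_pos hp m).ne']
  · have hcw : ∀ᶠ β in atTop, C.chainWeight i z t J β ≠ 0 := by
      filter_upwards [hmain.eventually_ne one_ne_zero] with β h h0
      rw [h0, zero_div] at h
      exact h rfl
    have h1 := tendsto_stay_div (t := t) hi (hz J le_rfl) hN m hcw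
    have h2 := (tendsto_jumpWithin hX hi hz hj hN m).const_sub 1
    rw [sub_zero] at h2
    have h3 := (h1.mul hmain).div h2 one_ne_zero
    rw [mul_one, div_one] at h3
    refine h3.congr' ?_
    filter_upwards [eventually_gt_atTop 0, hcw] with β hβ h
    rw [hden β hβ, hnum β hβ, Pi.div_apply, div_mul_div_cancel₀ h, div_div]

end Main

end LowTempChain

end

end Metabasin

theorem mainTheorem7 {S : Type*} [Fintype S] (C : Metabasin.LowTempChain S)
    {Ω : Type*} [MeasurableSpace Ω] (P : ℝ → S → Measure Ω) (X : ℕ → Ω → S)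
    (hX : ∀ β > 0, ∀ x, Metabasin.IsMarkovChain (P β x) X (C.p β) x)
    (i : ℕ) (hi : 1 ≤ i) (hin : i ≤ C.numMin)
    {Ω' : Type*} [MeasurableSpace Ω'] (P' : ℝ → S → Measure Ω')
    (Yh : ℕ → Ω' → S) (σh : ℕ → Ω' → ℕ∞)
    (hY : ∀ β > 0, ∀ y₀ ∈ C.metastates i,
      C.IsMarkovRenewalLimit β (P β) X i y₀ (P' β y₀) Yh σh) :
    (∀ (n : ℕ) (y : ℕ → S) (t : ℕ → ℕ), (∀ k ≤ n + 1, y k ∈ C.metastates i) →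
      0 < t 1 → (∀ k, 1 ≤ k → k ≤ n → t k < t (k + 1)) →
      (∀ᶠ β in atTop, 0 < (P' β (y 0)).real {ω | ∀ k ≤ n,
        (Yh k ω, Yh (k + 1) ω) = (y k, y (k + 1)) ∧ σh (k + 1) ω = t (k + 1)}) →
      Tendsto (fun β =>
        (P β (y 0)).real {ω | ∀ k ≤ n,
          (C.aac i (fun j => X j ω) k, C.aac i (fun j => X j ω) (k + 1)) = (y k, y (k + 1)) ∧
            C.jumpTime i (fun j => X j ω) (k + 1) = t (k + 1)} /
        (P' β (y 0)).real {ω | ∀ k ≤ n,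
          (Yh k ω, Yh (k + 1) ω) = (y k, y (k + 1)) ∧ σh (k + 1) ω = t (k + 1)})
        atTop (𝓝 1)) ∧
    (∀ (n : ℕ) (y : ℕ → S), (∀ k ≤ n + 1, y k ∈ C.metastates i) →
      (∀ᶠ β in atTop, 0 < (P' β (y 0)).real {ω | ∀ k ≤ n,
        (Yh (Metabasin.counting (fun j => σh j ω) k) ω,
          Yh (Metabasin.counting (fun j => σh j ω) (k + 1)) ω) = (y k, y (k + 1))}) →
      Tendsto (fun β =>
        (P β (y 0)).real {ω | ∀ k ≤ n,
          (C.ac i (fun j => X j ω) k, C.ac i (fun j => X j ω) (k + 1)) = (y k, y (k + 1))} /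
        (P' β (y 0)).real {ω | ∀ k ≤ n,
          (Yh (Metabasin.counting (fun j => σh j ω) k) ω,
            Yh (Metabasin.counting (fun j => σh j ω) (k + 1)) ω) = (y k, y (k + 1))})
        atTop (𝓝 1)) := by
  exact ⟨Metabasin.LowTempChain.tendsto_markovRenewal hX hi hY,
    Metabasin.LowTempChain.tendsto_semiMarkov hX hi hY⟩
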